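/- Let $(X,\mu)$ be a standard probability space and let $\mathcal R$ be a countable pmp equivalence relation on $X$, i.e. a Borel equivalence relation with countable classes such that every partially defined injective Borel map with graph in $\mathcal R$ preserves $\mu$. Let $L(\mathcal R)$ be its von Neumann algebra, acting on $L^2(\mathcal R)$ (for the measure $E\mapsto\int_X\#\{y:(x,y)\in E\}\,d\mu(x)$ on $\mathcal R$) and generated by $L^\infty(X)$ and the partial isometries $u_\theta$ of the partial Borel isomorphisms $\theta$ with graph in $\mathcal R$, with trace $\tau(a)=\langle a1_\Delta,1_\Delta\rangle$, where $\Delta\subset X\times X$ is the diagonal. Let $Y,Z\subset X$ be measurable subsets of positive measure, let $\Gamma_1,\Gamma_2,\Lambda$ be countable groups, and let $\Gamma_1\times\Gamma_2\curvearrowright Y$ and $\Lambda\curvearrowright Z$ be (essentially) free measure preserving actions such that, up to null sets, $\mathcal R|_Y=\mathcal R(\Gamma_1\times\Gamma_2\curvearrowright Y)$ and $\mathcal R|_Z\supseteq\mathcal R(\Lambda\curvearrowright Z)$, where $\mathcal R(G\curvearrowright W)$ denotes the orbit equivalence relation. Regard the crossed products $L^\infty(Y)\rtimes\Gamma_1\subset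 1_YL(\mathcal R)1_Y$ and $L^\infty(Z)\rtimes\Lambda\subset 1_ZL(\mathcal R)1_Z$ as von Neumann subalgebras in the canonical way. For a tracial von Neumann algebra $M$ with separable $L^2(M)$ and von Neumann subalgebras $P\subset pMp$, $Q\subset qMq$ (unital, $p,q\in M$ projections), write $P\prec_MQ$ if there is no sequence of unitaries $u_n\in P$ with $\|E_Q(x^*u_ny)\|_2\to0$ for all $x,y\in pMq$, where $E_Q$ is the trace preserving conditional expectation onto $Q$; write $P\prec^s_MQ$ if $Pp'\prec_MQ$ for every non-zero projection $p'\in P'\cap pMp$. Assume that (i) $L^\infty(Y)\rtimes\Gamma_1\prec_{L(\mathcal R)}L^\infty(Z)\rtimes\Lambda$, and (ii) $L^\infty(Z)\rtimes\Lambda\prec^s_{L(\mathcal R)}L^\infty(Y)\rtimes\Gamma_1$. Then $\Gamma_1$ and $\Lambda$ are measure equivalent: there are commuting (essentially) free measure preserving actions of $\Gamma_1$ and $\Lambda$ on a non-zero $\sigma$-finite standard measure space, each admitting a fundamental domain of finite measure. -/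

import Mathlib

open MeasureTheory Set Filter Topology
open scoped ENNReal

noncomputable section

/-! ### The counting measure of a Borel subset of `X × X` over its first coordinate -/

/-- Analytic sets are measurable with respect to every finite Borel measure. -/

theorem analyticSet_nullMeasurableSet {X : Type*} [TopologicalSpace X] [PolishSpace X]
    [MeasurableSpace X] [BorelSpace X] (μ : Measure X) [IsFiniteMeasure μ] {s : Set X}
    (hs : AnalyticSet s) : NullMeasurableSet s μ := by
  rw [AnalyticSet] at hs
  rcases hs with rfl | ⟨f, hf, rfl⟩
  · exact MeasurableSet.empty.nullMeasurableSet
  have step : ∀ (B : Set (ℕ → ℕ)) (n : ℕ) (δ : ℝ≥0∞), δ ≠ 0 →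
      ∃ K : ℕ, μ (f '' B) ≤ μ (f '' (B ∩ {x | x n ≤ K})) + δ := by
    intro B n δ hδ
    have hmono : Monotone fun K : ℕ => f '' (B ∩ {x | x n ≤ K}) := by
      intro a b hab
      exact image_mono fun x hx => ⟨hx.1, le_trans hx.2 hab⟩
    have hU : (⋃ K : ℕ, f '' (B ∩ {x | x n ≤ K})) = f '' B := by
      ext y
      simp only [mem_iUnion, mem_image, mem_inter_iff, mem_ofPred_eq]
      constructor
      · rintro ⟨K, x, ⟨h, -⟩, rfl⟩
        exact ⟨x, h, rfl⟩
      · rintro ⟨x, h, rfl⟩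
        exact ⟨x n, x, ⟨h, le_rfl⟩, rfl⟩
    have hsup := hmono.measure_iUnion (μ := μ)
    rw [hU] at hsup
    by_cases h0 : μ (f '' B) = 0
    · exact ⟨0, by simp [h0]⟩
    have hlt : μ (f '' B) - δ < μ (f '' B) :=
      ENNReal.sub_lt_self (measure_ne_top _ _) h0 hδ
    rw [hsup] at hlt
    obtain ⟨K, hK⟩ := lt_iSup_iff.1 hlt
    rw [← hsup] at hK
    exact ⟨K, tsub_le_iff_right.1 hK.le⟩
  have key : ∀ ε : ℝ≥0∞, ε ≠ 0 → ∃ C : Set X, IsClosed C ∧ C ⊆ range f ∧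
      μ (range f) ≤ μ C + ε := by
    intro ε hε
    obtain ⟨δ, hδ, hsum⟩ := ENNReal.exists_pos_sum_of_countable' hε ℕ
    choose K hK using fun (B : Set (ℕ → ℕ)) (n : ℕ) => step B n (δ n) (hδ n).ne'
    let B : ℕ → Set (ℕ → ℕ) := fun n =>
      Nat.rec univ (fun n B => B ∩ {x | x n ≤ K B n}) n
    have hB0 : B 0 = univ := rfl
    have hBs : ∀ n, B (n + 1) = B n ∩ {x | x n ≤ K (B n) n} := fun n => rfl
    let k : ℕ → ℕ := fun n => K (B n) n
    have hB : ∀ n, B n = {x | ∀ i < n, x i ≤ k i} := by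
      intro n
      induction n with
      | zero => simp [hB0]
      | succ n ih =>
        rw [hBs]
        ext x
        rw [mem_inter_iff, ih]
        simp only [mem_ofPred_eq, Nat.lt_succ_iff_lt_or_eq]
        constructor
        · rintro ⟨h1, h2⟩ i (hi | rfl)
          · exact h1 i hi
          · simpa [k, ih] using h2
        · intro h
          exact ⟨fun i hi => h i (Or.inl hi), by simpa [k, ih] using h n (Or.inr rfl)⟩
    have hle : ∀ n, μ (range f) ≤ μ (f '' B n) + ∑ i ∈ Finset.range n, δ i := by
      intro n
      induction n with
      | zero => simp [hB0]
      | succ n ih =>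
        rw [Finset.sum_range_succ, hBs]
        calc μ (range f) ≤ μ (f '' B n) + ∑ i ∈ Finset.range n, δ i := ih
          _ ≤ (μ (f '' (B n ∩ {x | x n ≤ K (B n) n})) + δ n) + ∑ i ∈ Finset.range n, δ i := by
            gcongr
            exact hK (B n) n
          _ = _ := by ring
    have hle' : ∀ n, μ (range f) ≤ μ (closure (f '' B n)) + ε := fun n =>
      (hle n).trans (add_le_add (measure_mono subset_closure)
        ((ENNReal.sum_le_tsum _).trans hsum.le))
    have hcpt : IsCompact (Set.pi univ fun i => Iic (k i)) :=
      isCompact_univ_pi fun i => (finite_Iic (k i)).isCompact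
    have hCc : IsCompact (f '' Set.pi univ fun i => Iic (k i)) := hcpt.image hf
    refine ⟨_, hCc.isClosed, image_subset_range _ _, ?_⟩
    have hanti : Antitone fun n => closure (f '' B n) := by
      refine antitone_nat_of_succ_le fun n => closure_mono (image_mono ?_)
      rw [hBs]
      exact inter_subset_left
    have hinter : (⋂ n, closure (f '' B n)) ⊆ f '' Set.pi univ fun i => Iic (k i) := by
      intro y hy
      by_contra hyC
      obtain ⟨U, V, hU, hV, hCU, hyV, hUV⟩ :=
        SeparatedNhds.of_isCompact_isCompact hCc (isCompact_singleton (x := y))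
          (disjoint_singleton_right.2 hyC)
      have hex : ∃ n, B n ⊆ f ⁻¹' U := by
        by_contra! hcon
        choose x hxB hxU using fun n => not_subset.1 (hcon n)
        let x' : ℕ → ℕ → ℕ := fun n i => if i < n then x n i else 0
        have hx' : ∀ n, x' n ∈ Set.pi univ fun i => Iic (k i) := by
          intro n i _
          have := hxB n
          rw [hB] at this
          by_cases hi : i < n
          · simpa [x', hi] using this i hi
          · simp [x', hi]
        obtain ⟨z, hz, φ, hφ, hlim⟩ := hcpt.tendsto_subseq hx'
        have hlim' : Tendsto (fun n => x (φ n)) atTop (𝓝 z) := by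
          rw [tendsto_pi_nhds] at hlim ⊢
          intro i
          refine (hlim i).congr' ?_
          filter_upwards [eventually_gt_atTop i] with n hn
          have : i < φ n := lt_of_lt_of_le hn (hφ.id_le n)
          simp [x', this]
        have hzU : f z ∈ U := hCU (mem_image_of_mem f hz)
        have := hlim'.eventually ((hU.preimage hf).mem_nhds hzU)
        obtain ⟨n, hn⟩ := this.exists
        exact hxU _ hn
      obtain ⟨n, hn⟩ := hex
      have hyn := mem_iInter.1 hy n
      rw [mem_closure_iff] at hyn
      obtain ⟨w, hwV, hwB⟩ := hyn V hV (hyV rfl)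
      exact disjoint_left.1 hUV (image_subset_iff.2 hn hwB) hwV
    have hmeas : μ (⋂ n, closure (f '' B n)) = ⨅ n, μ (closure (f '' B n)) :=
      hanti.measure_iInter (fun n => isClosed_closure.measurableSet.nullMeasurableSet)
        ⟨0, measure_ne_top _ _⟩
    calc μ (range f) ≤ (⨅ n, μ (closure (f '' B n))) + ε := by
          rw [ENNReal.iInf_add]
          exact le_iInf hle'
      _ ≤ _ := by
          rw [← hmeas]
          gcongr
  choose C hCc hCs hCm using fun n : ℕ => key ((n : ℝ≥0∞) + 1)⁻¹ (by simp)
  have htm : MeasurableSet (⋃ n, C n) := MeasurableSet.iUnion fun n => (hCc n).measurableSet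
  have hts : (⋃ n, C n) ⊆ range f := iUnion_subset hCs
  have hle : μ (range f) ≤ μ (⋃ n, C n) := by
    have h1 : ∀ n : ℕ, μ (range f) ≤ μ (⋃ n, C n) + ((n : ℝ≥0∞) + 1)⁻¹ := fun n =>
      (hCm n).trans (by gcongr; exact subset_iUnion C n)
    have hlim : Tendsto (fun n : ℕ => μ (⋃ n, C n) + ((n : ℝ≥0∞) + 1)⁻¹) atTop
        (𝓝 (μ (⋃ n, C n) + 0)) := by
      refine Tendsto.const_add _ ?_
      have := (tendsto_add_atTop_iff_nat 1).2 ENNReal.tendsto_inv_nat_nhds_zero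
      simpa using this
    simpa using ge_of_tendsto' hlim h1
  exact htm.nullMeasurableSet.congr
    (ae_eq_of_subset_of_measure_ge hts hle htm.nullMeasurableSet (measure_ne_top _ _))

/-- For a Borel set `E ⊆ X × X`, the number of points in the section `E_x` is an almost everywhere
measurable function of `x`. -/
theorem aemeasurable_count_section {X : Type*} [MeasurableSpace X] [StandardBorelSpace X]
    (μ : Measure X) [IsFiniteMeasure μ] {E : Set (X × X)} (hE : MeasurableSet E) :
    AEMeasurable (fun x => Measure.count (Prod.mk x ⁻¹' E)) μ := by
  classical
  let g : (n : ℕ) → X → (Fin n → Bool) := fun n y i => MeasurableSpace.mapNatBool X y i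
  have hg : ∀ n, Measurable (g n) := fun n =>
    measurable_pi_lambda _ fun i =>
      (measurable_pi_apply (i : ℕ)).comp (MeasurableSpace.measurable_mapNatBool X)
  have hformula : ∀ x, Measure.count (Prod.mk x ⁻¹' E) =
      ⨆ n, (((g n '' (Prod.mk x ⁻¹' E)).encard : ℕ∞) : ℝ≥0∞) := by
    intro x
    rw [Measure.count_apply (measurable_prodMk_left hE)]
    set S := Prod.mk x ⁻¹' E
    have hfin : ∀ F : Set X, F ⊆ S → F.Finite →
        ((F.encard : ℕ∞) : ℝ≥0∞) ≤ ⨆ n, (((g n '' S).encard : ℕ∞) : ℝ≥0∞) := by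
      intro F hFS hF
      have hsep : ∃ n, InjOn (g n) F := by
        have hpair : ∀ a b : X, ∃ N, ∀ n, N ≤ n → g n a = g n b → a = b := by
          intro a b
          by_cases hab : a = b
          · exact ⟨0, fun _ _ _ => hab⟩
          · have : MeasurableSpace.mapNatBool X a ≠ MeasurableSpace.mapNatBool X b :=
              fun h => hab (MeasurableSpace.injective_mapNatBool X h)
            obtain ⟨i, hi⟩ := Function.ne_iff.1 this
            refine ⟨i + 1, fun n hn h => (hi ?_).elim⟩
            exact congrFun h ⟨i, hn⟩
        choose N hN using hpair
        obtain ⟨B, hB⟩ := ((hF.prod hF).image fun q => N q.1 q.2).bddAbove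
        refine ⟨B, fun a ha b hb h => hN a b B (hB ?_) h⟩
        exact ⟨(a, b), ⟨ha, hb⟩, rfl⟩
      obtain ⟨n, hn⟩ := hsep
      rw [← hn.encard_image]
      refine le_trans ?_ (le_iSup _ n)
      exact_mod_cast encard_le_encard (image_mono hFS)
    apply le_antisymm
    · by_cases hS : S.Finite
      · exact hfin S Subset.rfl hS
      · rw [Set.Infinite.encard_eq hS]
        refine le_of_eq_of_le ENat.toENNReal_top (top_le_iff.2 (ENNReal.eq_top_of_forall_nnreal_le ?_))
        intro c
        obtain ⟨k, hk⟩ := exists_nat_ge c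
        obtain ⟨F, hFS, hF⟩ := Set.exists_subset_encard_eq (s := S) (k := (k : ℕ∞))
          (by rw [Set.Infinite.encard_eq hS]; exact le_top)
        have := hfin F hFS (Set.finite_of_encard_eq_coe hF)
        rw [hF] at this
        refine le_trans ?_ this
        simp only [ENat.toENNReal_coe]
        exact_mod_cast hk
    · refine iSup_le fun n => ?_
      exact_mod_cast encard_image_le (g n) S
  have hcell : ∀ n (s : Fin n → Bool),
      NullMeasurableSet {x | s ∈ g n '' (Prod.mk x ⁻¹' E)} μ := by
    intro n s
    let _ := upgradeStandardBorel X
    have himg : {x | s ∈ g n '' (Prod.mk x ⁻¹' E)} =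
        Prod.fst '' (E ∩ (fun p : X × X => g n p.2) ⁻¹' {s}) := by
      ext x
      constructor
      · rintro ⟨y, hy, hys⟩
        exact ⟨(x, y), ⟨hy, hys⟩, rfl⟩
      · rintro ⟨⟨a, y⟩, ⟨hy, hys⟩, rfl⟩
        exact ⟨y, hy, hys⟩
    rw [himg]
    apply analyticSet_nullMeasurableSet
    exact (hE.inter ((hg n).comp measurable_snd (measurableSet_singleton s))).analyticSet_image
      measurable_fst
  have hstep : ∀ n, AEMeasurable
      (fun x => (((g n '' (Prod.mk x ⁻¹' E)).encard : ℕ∞) : ℝ≥0∞)) μ := by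
    intro n
    have heq : (fun x => (((g n '' (Prod.mk x ⁻¹' E)).encard : ℕ∞) : ℝ≥0∞)) =
        fun x => ∑ s : Fin n → Bool,
          ({x | s ∈ g n '' (Prod.mk x ⁻¹' E)}.indicator (fun _ => (1 : ℝ≥0∞)) x) := by
      funext x
      rw [Set.encard_eq_coe_toFinset_card, ENat.toENNReal_coe]
      simp only [Set.indicator_apply, mem_ofPred_eq, Finset.sum_boole]
      congr 2
      ext s
      simp
    rw [heq]
    exact Finset.aemeasurable_fun_sum _ fun s _ => aemeasurable_const.indicator₀ (hcell n s)
  simp_rw [hformula]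
  exact AEMeasurable.iSup hstep

/-- The measure `E ↦ ∫ #{y | (x, y) ∈ E} dμ(x)` on `X × X`. -/
def leftCountingMeasure {X : Type*} [MeasurableSpace X] [StandardBorelSpace X]
    (μ : Measure X) [IsFiniteMeasure μ] : Measure (X × X) :=
  Measure.ofMeasurable (fun E _ => ∫⁻ x, Measure.count (Prod.mk x ⁻¹' E) ∂μ) (by simp) (by
    intro E hE hd
    rw [← lintegral_tsum fun i => aemeasurable_count_section μ (hE i)]
    refine lintegral_congr fun x => ?_
    rw [preimage_iUnion]
    exact measure_iUnion (fun i j hij => (hd hij).preimage _)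
      fun i => measurable_prodMk_left (hE i))

theorem leftCountingMeasure_apply {X : Type*} [MeasurableSpace X] [StandardBorelSpace X]
    (μ : Measure X) [IsFiniteMeasure μ] {E : Set (X × X)} (hE : MeasurableSet E) :
    leftCountingMeasure μ E = ∫⁻ x, Measure.count (Prod.mk x ⁻¹' E) ∂μ :=
  Measure.ofMeasurable_apply E hE

/-! ### Countable pmp equivalence relations -/

/-- The equivalence relation `r` on `(X, μ)` is Borel, has countable classes, and preserves `μ`:
every partially defined injective Borel map whose graph lies in `r` is measure preserving. -/
structure IsCountablePMP {X : Type*} [MeasurableSpace X] (μ : Measure X) (r : Setoid X) :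
    Prop where
  measurableSet_graph : MeasurableSet {p : X × X | r p.1 p.2}
  countable_class : ∀ x, {y | r x y}.Countable
  measure_image : ∀ (A : Set X) (φ : X → X), MeasurableSet A → Measurable φ → InjOn φ A →
    (∀ x ∈ A, r x (φ x)) → μ (φ '' A) = μ A

/-- The usual measure on `r ⊆ X × X`, namely `E ↦ ∫ #{y | (x, y) ∈ E ∩ r} dμ(x)`. -/
def relMeasure {X : Type*} [MeasurableSpace X] [StandardBorelSpace X]
    (μ : Measure X) [IsFiniteMeasure μ] (r : Setoid X) : Measure (X × X) :=
  (leftCountingMeasure μ).restrict {p | r p.1 p.2}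

/-- The Hilbert space `L²(r)`. -/
abbrev RelL2 {X : Type*} [MeasurableSpace X] [StandardBorelSpace X]
    (μ : Measure X) [IsFiniteMeasure μ] (r : Setoid X) : Type _ :=
  Lp ℂ 2 (relMeasure μ r)

theorem relMeasure_diagonal_ne_top {X : Type*} [MeasurableSpace X] [StandardBorelSpace X]
    (μ : Measure X) [IsFiniteMeasure μ] (r : Setoid X) :
    relMeasure μ r (diagonal X) ≠ ∞ := by
  refine ne_top_of_le_ne_top ?_ (Measure.restrict_apply_le _ _)
  rw [leftCountingMeasure_apply μ measurableSet_diagonal]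
  have : ∀ x : X, Measure.count (Prod.mk x ⁻¹' diagonal X) = 1 := by
    intro x
    have : Prod.mk x ⁻¹' diagonal X = {x} := by
      ext y
      simp [eq_comm]
    rw [this, Measure.count_singleton]
  simp [this]

/-- The indicator function of the diagonal: the vector of `L²(r)` that implements the trace of
`L(r)`. -/
def diagVec {X : Type*} [MeasurableSpace X] [StandardBorelSpace X]
    (μ : Measure X) [IsFiniteMeasure μ] (r : Setoid X) : RelL2 μ r :=
  indicatorConstLp 2 measurableSet_diagonal (relMeasure_diagonal_ne_top μ r) (1 : ℂ)

/-- `T` is the operator `(T ξ)(x, y) = c(x) ξ(φ(x), y)` on `L²(r)`. -/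
def IsWeightedTranslation {X : Type*} [MeasurableSpace X] [StandardBorelSpace X]
    (μ : Measure X) [IsFiniteMeasure μ] (r : Setoid X) (c : X → ℂ) (φ : X → X)
    (T : RelL2 μ r →L[ℂ] RelL2 μ r) : Prop :=
  ∀ ξ : RelL2 μ r, T ξ =ᵐ[relMeasure μ r] fun p => c p.1 * ξ (φ p.1, p.2)

/-- The projection `1_Y ∈ L^∞(X) ⊆ L(r)`: multiplication by `1_Y(x)` on `L²(r)`. -/
def supportProj {X : Type*} [MeasurableSpace X] [StandardBorelSpace X]
    (μ : Measure X) [IsFiniteMeasure μ] (r : Setoid X) (Y : Set X) (hY : MeasurableSet Y) :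
    RelL2 μ r →L[ℂ] RelL2 μ r :=
  LinearMap.mkContinuous
    { toFun := fun ξ => ((Lp.memLp ξ).indicator (measurable_fst hY)).toLp
      map_add' := by
        intro ξ η
        rw [← MemLp.toLp_add, MemLp.toLp_eq_toLp_iff]
        filter_upwards [Lp.coeFn_add ξ η] with p hp
        by_cases h : p ∈ Prod.fst ⁻¹' Y
        · simpa only [Pi.add_apply, Set.indicator_of_mem h] using hp
        · simp [h]
      map_smul' := by
        intro c ξ
        rw [RingHom.id_apply, ← MemLp.toLp_const_smul, MemLp.toLp_eq_toLp_iff]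
        filter_upwards [Lp.coeFn_smul c ξ] with p hp
        by_cases h : p ∈ Prod.fst ⁻¹' Y
        · simpa only [Pi.smul_apply, Set.indicator_of_mem h] using hp
        · simp [h] }
    1 (by
      intro ξ
      simp only [LinearMap.coe_mk, AddHom.coe_mk, one_mul, Lp.norm_toLp]
      rw [Lp.norm_def]
      exact ENNReal.toReal_mono (Lp.eLpNorm_ne_top ξ) (eLpNorm_indicator_le _))

theorem coeFn_supportProj {X : Type*} [MeasurableSpace X] [StandardBorelSpace X]
    (μ : Measure X) [IsFiniteMeasure μ] (r : Setoid X) (Y : Set X) (hY : MeasurableSet Y)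
    (ξ : RelL2 μ r) :
    supportProj μ r Y hY ξ =ᵐ[relMeasure μ r] (Prod.fst ⁻¹' Y).indicator ξ := by
  rw [supportProj, LinearMap.mkContinuous_apply, LinearMap.coe_mk, AddHom.coe_mk]
  exact MemLp.coeFn_toLp _

theorem isWeightedTranslation_supportProj {X : Type*} [MeasurableSpace X] [StandardBorelSpace X]
    (μ : Measure X) [IsFiniteMeasure μ] (r : Setoid X) (Y : Set X) (hY : MeasurableSet Y) :
    IsWeightedTranslation μ r (Y.indicator 1) id (supportProj μ r Y hY) := by
  intro ξ
  filter_upwards [coeFn_supportProj μ r Y hY ξ] with p hp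
  rw [hp]
  by_cases h : p.1 ∈ Y
  · rw [Set.indicator_of_mem (show p ∈ Prod.fst ⁻¹' Y from h), Set.indicator_of_mem h,
      Pi.one_apply, one_mul, id]
  · rw [Set.indicator_of_notMem (show p ∉ Prod.fst ⁻¹' Y from h), Set.indicator_of_notMem h,
      zero_mul]

/-! ### Von Neumann algebras and intertwining -/

/-- The von Neumann algebra generated by a set of operators: the double commutant of `S ∪ S*`. -/
def vonNeumannGenerated {H : Type*} [NormedAddCommGroup H] [InnerProductSpace ℂ H]
    [CompleteSpace H] (S : Set (H →L[ℂ] H)) : VonNeumannAlgebra H where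
  toStarSubalgebra := StarSubalgebra.centralizer ℂ (StarSubalgebra.centralizer ℂ S : Set (H →L[ℂ] H))
  centralizer_centralizer' := by
    change Set.centralizer (Set.centralizer
      ((StarSubalgebra.centralizer ℂ (StarSubalgebra.centralizer ℂ S : Set (H →L[ℂ] H)) :
        StarSubalgebra ℂ (H →L[ℂ] H)) : Set (H →L[ℂ] H))) =
      ((StarSubalgebra.centralizer ℂ (StarSubalgebra.centralizer ℂ S : Set (H →L[ℂ] H)) :
        StarSubalgebra ℂ (H →L[ℂ] H)) : Set (H →L[ℂ] H))
    rw [StarSubalgebra.coe_centralizer, Set.centralizer_centralizer_centralizer]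

/-- For a von Neumann algebra with trace `τ(a) = ⟪Ω, a Ω⟫` and a von Neumann subalgebra `Q` of one
of its corners, `‖E_Q(a)‖₂`, where `E_Q` is the trace preserving conditional expectation onto `Q`.
The vector `E_Q(a) Ω` is the orthogonal projection of `a Ω` onto `L²(Q)`, the closure of `Q Ω`. -/
def condExpNorm {H : Type*} [NormedAddCommGroup H] [InnerProductSpace ℂ H] [CompleteSpace H]
    (Ω : H) (Q : Set (H →L[ℂ] H)) (a : H →L[ℂ] H) : ℝ :=
  ‖(Submodule.span ℂ ((fun b : H →L[ℂ] H => b Ω) '' Q)).topologicalClosure.starProjection (a Ω)‖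

/-- Popa's intertwining `P ≺_M Q`, for a von Neumann algebra `M` with trace `τ(a) = ⟪Ω, a Ω⟫` and
von Neumann subalgebras `P ⊆ p M p` and `Q ⊆ q M q` with units `p` and `q`: there is no sequence of
unitaries `u n` of `P` with `‖E_Q(x* (u n) y)‖₂ → 0` for all `x, y ∈ p M q`. -/
def Intertwines {H : Type*} [NormedAddCommGroup H] [InnerProductSpace ℂ H] [CompleteSpace H]
    (Ω : H) (M : VonNeumannAlgebra H) (p : H →L[ℂ] H) (P : Set (H →L[ℂ] H))
    (q : H →L[ℂ] H) (Q : Set (H →L[ℂ] H)) : Prop :=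
  ¬ ∃ u : ℕ → (H →L[ℂ] H),
    (∀ n, u n ∈ P ∧ star (u n) * u n = p ∧ u n * star (u n) = p) ∧
    ∀ x ∈ M, ∀ y ∈ M, p * x * q = x → p * y * q = y →
      Tendsto (fun n => condExpNorm Ω Q (star x * u n * y)) atTop (𝓝 0)

/-- Strong intertwining `P ≺ˢ_M Q`: one has `P p' ≺_M Q` for every nonzero projection
`p' ∈ P' ∩ p M p`. -/
def StronglyIntertwines {H : Type*} [NormedAddCommGroup H] [InnerProductSpace ℂ H]
    [CompleteSpace H] (Ω : H) (M : VonNeumannAlgebra H) (p : H →L[ℂ] H) (P : Set (H →L[ℂ] H))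
    (q : H →L[ℂ] H) (Q : Set (H →L[ℂ] H)) : Prop :=
  ∀ p' ∈ M, IsStarProjection p' → p' ≠ 0 → p * p' * p = p' → (∀ a ∈ P, a * p' = p' * a) →
    Intertwines Ω M p' ((fun a => a * p') '' P) q Q

/-- The von Neumann algebra `L(r)` on `L²(r)`, generated by `L^∞(X)` and the partial isometries
`(u ξ)(x, y) = 1_B(x) ξ(φ(x), y)`, where `φ` is a partial Borel isomorphism with domain `B` and
graph in `r`. -/
def relVonNeumann {X : Type*} [MeasurableSpace X] [StandardBorelSpace X]
    (μ : Measure X) [IsFiniteMeasure μ] (r : Setoid X) : VonNeumannAlgebra (RelL2 μ r) :=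
  vonNeumannGenerated
    ({T | ∃ f : X → ℂ, Measurable f ∧ (∃ C, ∀ x, ‖f x‖ ≤ C) ∧
        IsWeightedTranslation μ r f id T} ∪
     {T | ∃ (B : Set X) (φ : X → X), MeasurableSet B ∧ Measurable φ ∧ InjOn φ B ∧
        (∀ x ∈ B, r x (φ x)) ∧ IsWeightedTranslation μ r (B.indicator 1) φ T})

/-! ### Actions, crossed products and measure equivalence -/

/-- The action `α` of `G` on `(Y, ν)` is measure preserving and (essentially) free. -/
structure IsFreeMPAction {Y G : Type*} [MeasurableSpace Y] [Group G] (ν : Measure Y)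
    (α : G →* Equiv.Perm Y) : Prop where
  measurePreserving : ∀ g, MeasurePreserving (α g) ν ν
  free : ∀ g, g ≠ 1 → ∀ᵐ y ∂ν, α g y ≠ y

open Classical in
/-- A permutation of a subset `Y ⊆ X`, extended by the identity outside `Y`. -/
def extendById {X : Type*} {Y : Set X} (σ : Equiv.Perm Y) (x : X) : X :=
  if h : x ∈ Y then (σ ⟨x, h⟩ : X) else x

/-- For a free measure preserving action `α` of `G` on `Y ⊆ X` whose orbits lie in `r`, the crossed
product `L^∞(Y) ⋊ G` as a von Neumann subalgebra of `1_Y L(r) 1_Y` with unit `1_Y`: it is generated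
by `L^∞(Y)` and the canonical unitaries `(u_g ξ)(x, y) = 1_Y(x) ξ(g⁻¹ x, y)`. -/
def crossedProduct {X G : Type*} [MeasurableSpace X] [StandardBorelSpace X] [Group G]
    (μ : Measure X) [IsFiniteMeasure μ] (r : Setoid X) (Y : Set X) (hY : MeasurableSet Y)
    (α : G →* Equiv.Perm Y) : Set (RelL2 μ r →L[ℂ] RelL2 μ r) :=
  {a | a ∈ vonNeumannGenerated
      ({T | ∃ f : X → ℂ, Measurable f ∧ (∃ C, ∀ x, ‖f x‖ ≤ C) ∧ (∀ x, x ∉ Y → f x = 0) ∧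
          IsWeightedTranslation μ r f id T} ∪
       {T | ∃ g : G, IsWeightedTranslation μ r (Y.indicator 1) (extendById (α g⁻¹)) T}) ∧
    supportProj μ r Y hY * a = a ∧ a * supportProj μ r Y hY = a}

/-- Measure equivalence of groups: there are commuting free measure preserving actions on a
(nonzero, `σ`-finite) standard measure space, each with a fundamental domain of finite measure. -/
def MeasureEquivalent (Γ Λ : Type*) [Group Γ] [Group Λ] : Prop :=
  ∃ (Ω : Type) (_ : MeasurableSpace Ω) (_ : StandardBorelSpace Ω) (m : Measure Ω)
    (_ : MulAction Γ Ω) (_ : MulAction Λ Ω),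
    SigmaFinite m ∧ m ≠ 0 ∧ SMulCommClass Γ Λ Ω ∧
    (∀ g : Γ, MeasurePreserving (fun ω : Ω => g • ω) m m) ∧
    (∀ h : Λ, MeasurePreserving (fun ω : Ω => h • ω) m m) ∧
    (∀ g : Γ, g ≠ 1 → ∀ᵐ ω ∂m, g • ω ≠ ω) ∧
    (∀ h : Λ, h ≠ 1 → ∀ᵐ ω ∂m, h • ω ≠ ω) ∧
    (∃ D : Set Ω, MeasurableSet D ∧ IsFundamentalDomain Γ D m ∧ m D < ∞) ∧
    (∃ D : Set Ω, MeasurableSet D ∧ IsFundamentalDomain Λ D m ∧ m D < ∞)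

end

/-!
Write `λ` for the measure `relMeasure μ r` on `r ⊆ X × X`, and extend both actions to `X` by the
identity. The group `Γ₁` then acts on the first variable of `r ∩ (Y × Z)` and `Λ` on the second
one; the two actions commute, preserve `λ` and are free. A non-null invariant subset that has a
fundamental domain of finite measure for each of the two groups is a measure equivalence coupling.

The two intertwining hypotheses give one half of this each. By `tendsto_condExpNorm_leftOp`, the
canonical unitaries `u_g` of a group `G` acting on `A` tend to zero relative to `L^∞(B) ⋊ H` along
a sequence in `G` as soon as the translates of the `H`-saturation of every graph in `r ∩ (A × B)`
asymptotically leave every graph. So if the crossed product by `G` intertwines into the one by `H`,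
then `G` acts on the quotient of `r ∩ (A × B)` by `H` in such a way that some set of finite measure
does not become asymptotically disjoint from its translates. A vector of minimal norm in the closed
convex hull of its translates produces an invariant set of positive finite measure
(`exists_invariant_set`). Thus `r ∩ (A × B)` has a non-null `G × H`-invariant subset with an
`H`-fundamental domain of finite measure: `exists_invariant_of_intertwines`.

The hypothesis on `Γ₁` gives a `Γ₁ × Λ`-invariant set `E ⊆ r ∩ (Y × Z)` with a `Λ`-fundamental
domain of finite measure. Its projection to `Z` is a `Λ`-invariant set `Z₀`, so `1_{Z₀}` commutes
with the crossed product by `Λ`, and strong intertwining yields an invariant set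
`E' ⊆ r ∩ (Z₀ × Y)` with a `Γ₁`-fundamental domain of finite measure. Almost every fibre of `E` over
`Z₀` is nonempty and `Γ₁ × Γ₂` is transitive on the classes of `r|_Y`, so the translate of the flip
of `E'` by some element of `Γ₂` meets `E` in a non-null set
(`exists_relMeasure_inter_translate_ne_zero`). As `Γ₂` commutes with `Γ₁`, this intersection is
invariant, and it inherits both fundamental domains.

The condition that yields `tendsto_condExpNorm_leftOp` is checked on the vectors `ρ_e Ω`, where
`ρ_e` is the right multiplication by a partial isomorphism `e`; it commutes with `L(r)`, and `ρ_e Ω`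
is the indicator function of the graph of `e` (`rightOp_diagVec`). All this only uses a cover of
`r ∩ (Y × Z)` by countably many graphs of partial isomorphisms (`exists_isRelCover`), which is
available because `r|_Y` is the orbit relation of a countable group, together with measurable
selection up to null sets.
-/

open MeasureTheory Set Filter Topology
open scoped ENNReal

noncomputable section

/-! ### Measurable selection and countable-to-one maps -/

/-- The sequences of natural numbers that extend the finite sequence whose reversal is the given
list. -/
def initialCylinder : List ℕ → Set (ℕ → ℕ)
  | [] => univ
  | k :: l => {v | v ∈ initialCylinder l ∧ v l.length = k}

theorem measurableSet_initialCylinder (l : List ℕ) : MeasurableSet (initialCylinder l) := by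
  induction l with
  | nil => exact MeasurableSet.univ
  | cons k l ih =>
    exact ih.inter (measurable_pi_apply (X := fun _ : ℕ => ℕ) l.length (measurableSet_singleton k))

/-- The Jankov-von Neumann selection theorem up to null sets: a Borel set contains the graph of a
Borel map that is defined almost everywhere on the projection of the set. The selection follows the
leftmost branch of a parametrization of the set by the Baire space. -/
theorem exists_measurable_selection {X : Type*} [MeasurableSpace X] [StandardBorelSpace X]
    (μ : Measure X) [IsFiniteMeasure μ] {E : Set (X × X)} (hE : MeasurableSet E) :
    ∃ (A : Set X) (f : X → X), MeasurableSet A ∧ Measurable f ∧ (∀ x ∈ A, (x, f x) ∈ E) ∧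
      ∀ᵐ x ∂μ, (∃ y, (x, y) ∈ E) → x ∈ A := by
  classical
  let _ := upgradeStandardBorel X
  have hA : AnalyticSet E := hE.analyticSet
  rw [AnalyticSet] at hA
  rcases hA with rfl | ⟨F, hF, rfl⟩
  · exact ⟨∅, id, MeasurableSet.empty, measurable_id, by simp, by simp⟩
  -- `F` parametrizes `E` by the Baire space; `I l` is the projection of the part of `E` that is
  -- parametrized by the cylinder of `l`.
  let I : List ℕ → Set X := fun l => (fun v => (F v).1) '' initialCylinder l
  have hI : ∀ l, NullMeasurableSet (I l) μ := fun l =>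
    analyticSet_nullMeasurableSet μ
      ((measurableSet_initialCylinder l).analyticSet.image_of_continuous (continuous_fst.comp hF))
  -- `s n x` is the beginning of length `n`, reversed, of the leftmost branch over `x`.
  let s : ℕ → X → List ℕ := fun n x =>
    Nat.rec [] (fun _ l => sInf {k | x ∈ I (k :: l)} :: l) n
  have hs0 : ∀ x, s 0 x = [] := fun _ => rfl
  have hss : ∀ n x, s (n + 1) x = sInf {k | x ∈ I (k :: s n x)} :: s n x := fun _ _ => rfl
  have hlen : ∀ n x, (s n x).length = n := by
    intro n x
    induction n with
    | zero => rfl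
    | succ n ih => rw [hss, List.length_cons, ih]
  have hinf : ∀ (l : List ℕ) (k : ℕ), NullMeasurableSet {x | sInf {j | x ∈ I (j :: l)} = k} μ := by
    intro l k
    have : {x | sInf {j | x ∈ I (j :: l)} = k} =
        (I (k :: l) \ ⋃ j ∈ Iio k, I (j :: l)) ∪ ({_x | k = 0} \ ⋃ j, I (j :: l)) := by
      ext x
      simp only [mem_ofPred_eq, mem_union, Set.mem_sdiff, mem_iUnion, mem_Iio, not_exists]
      constructor
      · intro h
        rcases Set.eq_empty_or_nonempty {j | x ∈ I (j :: l)} with h0 | h0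
        · right
          refine ⟨by rw [← h, h0, Nat.sInf_empty], fun j hj => ?_⟩
          have : j ∈ {j | x ∈ I (j :: l)} := hj
          rw [h0] at this
          exact this
        · left
          refine ⟨h ▸ Nat.sInf_mem h0, fun j hj hx => ?_⟩
          have := Nat.sInf_le (s := {j | x ∈ I (j :: l)}) hx
          omega
      · rintro (⟨h1, h2⟩ | ⟨h1, h2⟩)
        · refine le_antisymm (Nat.sInf_le h1) ?_
          by_contra hcon
          push Not at hcon
          exact h2 _ hcon (Nat.sInf_mem (s := {j | x ∈ I (j :: l)}) ⟨k, h1⟩)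
        · have : {j | x ∈ I (j :: l)} = ∅ := by
            ext j
            simpa using h2 j
          rw [this, Nat.sInf_empty, h1]
    rw [this]
    exact ((hI _).diff (NullMeasurableSet.biUnion (Set.to_countable _) fun j _ => hI _)).union
      ((NullMeasurableSet.const _).diff (NullMeasurableSet.iUnion fun j => hI _))
  have hsm : ∀ n (l : List ℕ), NullMeasurableSet {x | s n x = l} μ := by
    intro n
    induction n with
    | zero =>
      intro l
      simp only [hs0]
      exact NullMeasurableSet.const _
    | succ n ih =>
      intro l
      cases l with
      | nil =>
        have : {x | s (n + 1) x = []} = ∅ := by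
          ext x
          simp [hss]
        rw [this]
        exact nullMeasurableSet_empty
      | cons k l =>
        have : {x | s (n + 1) x = k :: l} =
            {x | s n x = l} ∩ {x | sInf {j | x ∈ I (j :: l)} = k} := by
          ext x
          simp only [hss, mem_ofPred_eq, mem_inter_iff, List.cons.injEq]
          constructor
          · rintro ⟨h1, h2⟩
            exact ⟨h2, h2 ▸ h1⟩
          · rintro ⟨h1, h2⟩
            exact ⟨h1 ▸ h2, h1⟩
        rw [this]
        exact (ih l).inter (hinf l k)
  let h : X → ℕ → ℕ := fun x n => (s (n + 1) x).headD 0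
  have hh : ∀ n, AEMeasurable (fun x => h x n) μ := by
    intro n
    have hnm : NullMeasurable (fun x => h x n) μ := by
      intro t _
      have : (fun x => h x n) ⁻¹' t =
          ⋃ l ∈ {l : List ℕ | l.headD 0 ∈ t}, {x | s (n + 1) x = l} := by
        ext x
        simp [h]
      rw [this]
      exact NullMeasurableSet.biUnion (Set.to_countable _) fun l _ => hsm (n + 1) l
    exact (aestronglyMeasurable_iff_nullMeasurable_separable.2
      ⟨hnm, univ, TopologicalSpace.IsSeparable.of_separableSpace univ, by simp⟩).aemeasurable
  have hhm : AEMeasurable h μ := aemeasurable_pi_iff.2 hh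
  have hbranch : ∀ x, (∃ y, (x, y) ∈ range F) → (F (h x)).1 = x := by
    rintro x ⟨y, v, hv⟩
    have hmem : ∀ n, x ∈ I (s n x) := by
      intro n
      induction n with
      | zero => exact ⟨v, mem_univ _, by simp [hv]⟩
      | succ n ih =>
        rw [hss]
        apply Nat.sInf_mem (s := {k | x ∈ I (k :: s n x)})
        obtain ⟨w, hw, hwx⟩ := ih
        exact ⟨w (s n x).length, w, ⟨hw, rfl⟩, hwx⟩
    choose w hw hwx using hmem
    have hag : ∀ n (u : ℕ → ℕ), u ∈ initialCylinder (s n x) → ∀ i < n, u i = h x i := by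
      intro n u
      induction n with
      | zero => intro _ i hi; omega
      | succ n ih =>
        intro hu i hi
        have hu' : u ∈ initialCylinder (s n x) ∧
            u (s n x).length = sInf {k | x ∈ I (k :: s n x)} := by
          rw [hss] at hu
          exact hu
        rcases Nat.lt_succ_iff_lt_or_eq.1 hi with hi | rfl
        · exact ih hu'.1 i hi
        · rw [hlen] at hu'
          rw [hu'.2]
          simp [h, hss]
    -- The points `w n` over `x` converge to the branch `h x`, and the map to the first coordinate
    -- is continuous, so `h x` lies over `x` too.
    have hlim : Tendsto w atTop (𝓝 (h x)) := by
      rw [tendsto_pi_nhds]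
      intro i
      refine tendsto_const_nhds.congr' ?_
      filter_upwards [eventually_gt_atTop i] with n hn
      exact (hag n _ (hw n) i hn).symm
    have h1 := ((continuous_fst.comp hF).tendsto (h x)).comp hlim
    refine tendsto_nhds_unique h1 ?_
    refine tendsto_const_nhds.congr fun n => (hwx n).symm
  have hfm : AEMeasurable (fun x => (F (h x)).2) μ :=
    (measurable_snd.comp hF.measurable).comp_aemeasurable hhm
  have hpr : NullMeasurableSet {x | ∃ y, (x, y) ∈ range F} μ := by
    have : {x | ∃ y, (x, y) ∈ range F} = Prod.fst '' range F := by
      ext x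
      constructor
      · rintro ⟨y, hy⟩
        exact ⟨_, hy, rfl⟩
      · rintro ⟨⟨a, y⟩, hy, rfl⟩
        exact ⟨y, hy⟩
    rw [this]
    exact analyticSet_nullMeasurableSet μ (hE.analyticSet.image_of_continuous continuous_fst)
  have hset : NullMeasurableSet {x | (∃ y, (x, y) ∈ range F) ∧ (x, hfm.mk _ x) ∈ range F} μ :=
    hpr.inter ((measurable_id.prodMk hfm.measurable_mk) hE).nullMeasurableSet
  obtain ⟨A, hAs, hAm, hAe⟩ := hset.exists_measurable_subset_ae_eq
  refine ⟨A, hfm.mk _, hAm, hfm.measurable_mk, fun x hx => (hAs hx).2, ?_⟩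
  filter_upwards [hAe.mem_iff, hfm.ae_eq_mk] with x hx1 hx2 hx3
  refine hx1.2 ⟨hx3, ?_⟩
  rw [← hx2]
  exact ⟨h x, Prod.ext (hbranch x hx3) rfl⟩

/-- A countable-to-one Borel map is injective on each of countably many Borel sets that cover almost
all of its domain. Disintegrate the measure over the map: the fibre measures live on countable sets,
so almost every point is an atom of its fibre measure, and a point that carries more than half of
the fibre mass of a cell `C` is the only such point of `C` in its fibre. -/
theorem exists_injOn_pieces {X : Type*} [MeasurableSpace X] [StandardBorelSpace X]
    (μ : Measure X) [IsFiniteMeasure μ] {A : Set X} (hA : MeasurableSet A) {φ : X → X}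
    (hφ : Measurable φ) (hc : ∀ x ∈ A, {y | y ∈ A ∧ φ y = φ x}.Countable) :
    ∃ P : ℕ → Set X, (∀ n, MeasurableSet (P n)) ∧ (∀ n, P n ⊆ A) ∧ (∀ n, InjOn φ (P n)) ∧
      ∀ᵐ x ∂μ, x ∈ A → ∃ n, x ∈ P n := by
  classical
  rcases isEmpty_or_nonempty X with hX | hX
  · exact ⟨fun _ => ∅, by simp, by simp, by simp, Eventually.of_forall fun x => isEmptyElim x⟩
  -- The kernel `κ` disintegrates `μ|_A` over `φ`.
  let ρ : Measure (X × X) := (μ.restrict A).map (fun x => (φ x, x))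
  have hpm : Measurable fun x : X => (φ x, x) := hφ.prodMk measurable_id
  have hfin : IsFiniteMeasure ρ := Measure.isFiniteMeasure_map _ _
  let κ := ρ.condKernel
  have hdis : ρ.fst.compProd κ = ρ := ρ.disintegrate κ
  have hdiag : MeasurableSet {q : (X × X) × X | q.2 = q.1.2} :=
    measurableSet_eq_fun measurable_snd (measurable_snd.comp measurable_fst)
  have hw : Measurable fun p : X × X => κ p.1 {p.2} := by
    have := ProbabilityTheory.Kernel.measurable_kernel_prodMk_left
      (κ := κ.comap Prod.fst (measurable_fst (α := X) (β := X))) hdiag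
    exact this
  have hsupp : ∀ᵐ y ∂ρ.fst, κ y {x | x ∈ A ∧ φ x = y}ᶜ = 0 := by
    have hS : MeasurableSet {p : X × X | p.2 ∈ A ∧ φ p.2 = p.1}ᶜ :=
      ((measurable_snd hA).inter
        (measurableSet_eq_fun (hφ.comp measurable_snd) measurable_fst)).compl
    have h0 : ρ {p : X × X | p.2 ∈ A ∧ φ p.2 = p.1}ᶜ = 0 := by
      rw [Measure.map_apply hpm hS, Measure.restrict_apply (hpm hS)]
      have : (fun x => (φ x, x)) ⁻¹' {p : X × X | p.2 ∈ A ∧ φ p.2 = p.1}ᶜ ∩ A = ∅ := by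
        ext x
        simp
      rw [this, measure_empty]
    rw [← hdis, Measure.compProd_apply hS, lintegral_eq_zero_iff
      (ProbabilityTheory.Kernel.measurable_kernel_prodMk_left hS)] at h0
    exact h0
  have hcount : ∀ y, {x | x ∈ A ∧ φ x = y}.Countable := by
    intro y
    rcases Set.eq_empty_or_nonempty {x | x ∈ A ∧ φ x = y} with h | ⟨x, hx⟩
    · rw [h]; exact countable_empty
    · have := hc x hx.1
      rwa [hx.2] at this
  have hatom : ∀ᵐ x ∂(μ.restrict A), κ (φ x) {x} ≠ 0 := by
    have hN : MeasurableSet {p : X × X | κ p.1 {p.2} = 0} := hw (measurableSet_singleton 0)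
    have h0 : ρ {p : X × X | κ p.1 {p.2} = 0} = 0 := by
      rw [← hdis, Measure.compProd_apply hN, lintegral_eq_zero_iff
        (ProbabilityTheory.Kernel.measurable_kernel_prodMk_left hN)]
      filter_upwards [hsupp] with y hy
      have hsub : Prod.mk y ⁻¹' {p : X × X | κ p.1 {p.2} = 0} ⊆
          {x | x ∈ A ∧ φ x = y}ᶜ ∪ ⋃ x ∈ {x | (x ∈ A ∧ φ x = y) ∧ κ y {x} = 0}, {x} := by
        intro x hx
        by_cases h : x ∈ A ∧ φ x = y
        · right
          simp only [mem_iUnion]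
          exact ⟨x, ⟨h, hx⟩, rfl⟩
        · exact Or.inl h
      refine measure_mono_null hsub (measure_union_null hy ?_)
      refine (measure_biUnion_null_iff ((hcount y).mono fun x hx => hx.1)).2 fun x hx => hx.2
    rw [Measure.map_apply hpm hN] at h0
    rw [ae_iff]
    simpa using h0
  -- The cells `g n ⁻¹' {c}` form a refining sequence of finite partitions that separates points.
  let g : (n : ℕ) → X → (Fin n → Bool) := fun n y i => MeasurableSpace.mapNatBool X y i
  have hg : ∀ n, Measurable (g n) := fun n =>
    measurable_pi_lambda _ fun i =>
      (measurable_pi_apply (i : ℕ)).comp (MeasurableSpace.measurable_mapNatBool X)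
  let Q : (Σ n : ℕ, (Fin n → Bool)) → Set X := fun c =>
    {x | x ∈ A ∧ g c.1 x = c.2 ∧ κ (φ x) (g c.1 ⁻¹' {c.2}) < 2 * κ (φ x) {x}}
  have hQm : ∀ c, MeasurableSet (Q c) := by
    intro c
    refine hA.inter (((hg c.1) (measurableSet_singleton c.2)).inter ?_)
    exact measurableSet_lt ((κ.measurable_coe ((hg c.1) (measurableSet_singleton c.2))).comp hφ)
      ((hw.comp hpm).const_mul 2)
  have hQi : ∀ c, InjOn φ (Q c) := by
    rintro c x ⟨hxA, hxc, hx⟩ y ⟨hyA, hyc, hy⟩ hxy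
    by_contra hne
    rw [← hxy] at hy
    have h1 : κ (φ x) {x} + κ (φ x) {y} ≤ κ (φ x) (g c.1 ⁻¹' {c.2}) := by
      rw [← measure_union (by simpa using hne) (measurableSet_singleton y)]
      refine measure_mono ?_
      rintro z (rfl | rfl)
      · exact hxc
      · exact hyc
    have hlt := ENNReal.add_lt_add hx hy
    rw [← mul_add, ← two_mul] at hlt
    exact absurd hlt (not_lt.2 (by gcongr))
  have hQc : ∀ x ∈ A, κ (φ x) {x} ≠ 0 → ∃ c, x ∈ Q c := by
    intro x hx h0
    have hanti : Antitone fun n => g n ⁻¹' {g n x} := by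
      intro m n hmn y hy
      have hy' : g n y = g n x := hy
      change g m y = g m x
      funext i
      exact congrFun hy' ⟨i, lt_of_lt_of_le i.2 hmn⟩
    have hint : (⋂ n, g n ⁻¹' {g n x}) = {x} := by
      ext y
      simp only [mem_iInter, mem_preimage, mem_singleton_iff]
      constructor
      · intro h
        refine MeasurableSpace.injective_mapNatBool X (funext fun i => ?_)
        exact congrFun (h (i + 1)) ⟨i, Nat.lt_succ_self i⟩
      · rintro rfl n
        rfl
    -- The cells that contain `x` shrink to `{x}`, so their fibre mass drops below twice that of
    -- `x`.
    have hlim := tendsto_measure_iInter_atTop (μ := κ (φ x))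
      (fun n => ((hg n) (measurableSet_singleton (g n x))).nullMeasurableSet) hanti
      ⟨0, measure_ne_top _ _⟩
    rw [hint] at hlim
    have hlt : κ (φ x) {x} < 2 * κ (φ x) {x} := by
      rw [two_mul]
      exact ENNReal.lt_add_right (measure_ne_top _ _) h0
    obtain ⟨n, hn⟩ := (hlim.eventually (gt_mem_nhds hlt)).exists
    exact ⟨⟨n, g n x⟩, hx, rfl, hn⟩
  obtain ⟨enum, henum⟩ := exists_surjective_nat (Σ n : ℕ, (Fin n → Bool))
  refine ⟨fun n => Q (enum n), fun n => hQm _, fun n x hx => hx.1, fun n => hQi _, ?_⟩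
  rw [ae_restrict_iff' hA] at hatom
  filter_upwards [hatom] with x hx hxA
  obtain ⟨c, hc⟩ := hQc x hxA (hx hxA)
  obtain ⟨n, rfl⟩ := henum c
  exact ⟨n, hc⟩

/-! ### Null sets of a countable pmp equivalence relation -/

theorem relMeasure_apply {X : Type*} [MeasurableSpace X] [StandardBorelSpace X]
    {μ : Measure X} [IsFiniteMeasure μ] {r : Setoid X} (hr : IsCountablePMP μ r)
    {E : Set (X × X)} (hE : MeasurableSet E) :
    relMeasure μ r E = ∫⁻ x, Measure.count {z | r x z ∧ (x, z) ∈ E} ∂μ := by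
  rw [relMeasure, Measure.restrict_apply hE,
    leftCountingMeasure_apply μ (hE.inter hr.measurableSet_graph)]
  refine lintegral_congr fun x => ?_
  congr 1
  ext z
  simp [and_comm]

theorem aemeasurable_count_rel {X : Type*} [MeasurableSpace X] [StandardBorelSpace X]
    {μ : Measure X} [IsFiniteMeasure μ] {r : Setoid X} (hr : IsCountablePMP μ r)
    {E : Set (X × X)} (hE : MeasurableSet E) :
    AEMeasurable (fun x => Measure.count {z | r x z ∧ (x, z) ∈ E}) μ := by
  refine (aemeasurable_count_section μ (hr.measurableSet_graph.inter hE)).congr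
    (Eventually.of_forall fun x => ?_)
  congr 1

/-- A property holds almost everywhere on `r` iff for almost every `x` it holds at `(x, z)` for
every `z` in the class of `x`. -/
theorem ae_relMeasure_iff {X : Type*} [MeasurableSpace X] [StandardBorelSpace X]
    {μ : Measure X} [IsFiniteMeasure μ] {r : Setoid X} (hr : IsCountablePMP μ r)
    {p : X × X → Prop} :
    (∀ᵐ q ∂relMeasure μ r, p q) ↔ ∀ᵐ x ∂μ, ∀ z, r x z → p (x, z) := by
  constructor
  · intro h
    obtain ⟨N, hN, hNm, hN0⟩ := exists_measurable_superset_of_null (ae_iff.1 h)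
    rw [relMeasure_apply hr hNm, lintegral_eq_zero_iff'] at hN0
    · filter_upwards [hN0] with x hx z hz
      rw [Pi.zero_apply, Measure.count_eq_zero_iff] at hx
      by_contra hp
      have : z ∈ {z | r x z ∧ (x, z) ∈ N} := ⟨hz, hN hp⟩
      rw [hx] at this
      exact this
    · exact aemeasurable_count_rel hr hNm
  · intro h
    obtain ⟨N, hN, hNm, hN0⟩ := exists_measurable_superset_of_null (ae_iff.1 h)
    have h1 : relMeasure μ r (Prod.fst ⁻¹' N) = 0 := by
      rw [relMeasure_apply hr (measurable_fst hNm)]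
      rw [lintegral_eq_zero_iff']
      · filter_upwards [measure_eq_zero_iff_ae_notMem.1 hN0] with x hx
        simp [hx]
      · exact aemeasurable_count_rel hr (measurable_fst hNm)
    have h2 : ∀ᵐ q ∂relMeasure μ r, r q.1 q.2 := by
      rw [relMeasure]
      exact ae_restrict_mem hr.measurableSet_graph
    filter_upwards [measure_eq_zero_iff_ae_notMem.1 h1, h2] with q hq1 hq2
    by_contra hp
    refine hq1 (hN fun hcon => hp (hcon _ hq2))

/-- A Borel subset of `r` with almost all sections empty in the first variable has almost all
sections empty in the second variable. -/
theorem ae_section_swap {X : Type*} [MeasurableSpace X] [StandardBorelSpace X]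
    {μ : Measure X} [IsFiniteMeasure μ] {r : Setoid X} (hr : IsCountablePMP μ r)
    {F : Set (X × X)} (hF : MeasurableSet F) (hFr : ∀ p ∈ F, r p.1 p.2)
    (h : ∀ᵐ x ∂μ, ∀ z, (x, z) ∉ F) : ∀ᵐ z ∂μ, ∀ x, (x, z) ∉ F := by
  obtain ⟨A, f, hA, hf, hAF, hAe⟩ := exists_measurable_selection μ (measurable_swap hF)
  have hAr : ∀ z ∈ A, r z (f z) := fun z hz => r.symm (hFr _ (hAF z hz))
  obtain ⟨P, hPm, hPA, hPi, hPe⟩ := exists_injOn_pieces μ hA hf (fun z hz =>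
    (hr.countable_class z).mono fun y hy =>
      r.trans (hAr z hz) (r.symm (by have := hAr y hy.1; rwa [hy.2] at this)))
  have hP0 : ∀ n, μ (P n) = 0 := by
    intro n
    rw [← hr.measure_image (P n) f (hPm n) hf (hPi n) fun z hz => hAr z (hPA n hz)]
    refine measure_mono_null ?_ (ae_iff.1 h)
    rintro _ ⟨z, hz, rfl⟩ hcon
    exact hcon z (hAF z (hPA n hz))
  filter_upwards [hAe, hPe, ae_all_iff.2 fun n => measure_eq_zero_iff_ae_notMem.1 (hP0 n)]
    with z h1 h2 h3 x hx
  obtain ⟨n, hn⟩ := h2 (h1 ⟨x, hx⟩)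
  exact h3 n hn

/-- The saturation of a null set is a null set. -/
theorem ae_forall_rel {X : Type*} [MeasurableSpace X] [StandardBorelSpace X]
    {μ : Measure X} [IsFiniteMeasure μ] {r : Setoid X} (hr : IsCountablePMP μ r)
    {p : X → Prop} (h : ∀ᵐ x ∂μ, p x) : ∀ᵐ x ∂μ, ∀ z, r x z → p z := by
  obtain ⟨N, hN, hNm, hN0⟩ := exists_measurable_superset_of_null (ae_iff.1 h)
  have := ae_section_swap hr (F := {q | r q.1 q.2} ∩ Prod.fst ⁻¹' N)
    (hr.measurableSet_graph.inter (measurable_fst hNm)) (fun q hq => hq.1) (by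
      filter_upwards [measure_eq_zero_iff_ae_notMem.1 hN0] with x hx z hz
      exact hx hz.2)
  filter_upwards [this] with x hx z hz
  by_contra hp
  exact hx z ⟨r.symm hz, hN hp⟩

theorem ae_swap_relMeasure {X : Type*} [MeasurableSpace X] [StandardBorelSpace X]
    {μ : Measure X} [IsFiniteMeasure μ] {r : Setoid X} (hr : IsCountablePMP μ r)
    {p : X × X → Prop} (h : ∀ᵐ q ∂relMeasure μ r, p q) : ∀ᵐ q ∂relMeasure μ r, p q.swap := by
  obtain ⟨N, hN, hNm, hN0⟩ := exists_measurable_superset_of_null (ae_iff.1 h)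
  have h1 := (ae_relMeasure_iff hr).1 (measure_eq_zero_iff_ae_notMem.1 hN0)
  have h2 := ae_section_swap hr (hr.measurableSet_graph.inter hNm) (fun q hq => hq.1) (by
    filter_upwards [h1] with x hx z hz
    exact hx z hz.1 hz.2)
  rw [ae_relMeasure_iff hr]
  filter_upwards [h2] with x hx z hz
  by_contra hp
  exact hx z ⟨r.symm hz, hN hp⟩

/-! ### Partial Borel isomorphisms with graph in `r` -/

/-- A partial Borel isomorphism of `X` with graph in `r`. The maps `toFun` and `invFun` are defined
everywhere, but only their restrictions to `source` and `target` matter. -/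
structure RelPartialIso {X : Type*} [MeasurableSpace X] (r : Setoid X) where
  source : Set X
  target : Set X
  toFun : X → X
  invFun : X → X
  measurableSet_source : MeasurableSet source
  measurableSet_target : MeasurableSet target
  measurable_toFun : Measurable toFun
  measurable_invFun : Measurable invFun
  map_source : ∀ x ∈ source, toFun x ∈ target
  map_target : ∀ x ∈ target, invFun x ∈ source
  left_inv : ∀ x ∈ source, invFun (toFun x) = x
  right_inv : ∀ x ∈ target, toFun (invFun x) = x
  rel : ∀ x ∈ source, r x (toFun x)

namespace RelPartialIso

variable {X : Type*} [MeasurableSpace X] {r : Setoid X}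

/-- The inverse of a partial isomorphism. -/
def symm (e : RelPartialIso r) : RelPartialIso r where
  source := e.target
  target := e.source
  toFun := e.invFun
  invFun := e.toFun
  measurableSet_source := e.measurableSet_target
  measurableSet_target := e.measurableSet_source
  measurable_toFun := e.measurable_invFun
  measurable_invFun := e.measurable_toFun
  map_source := e.map_target
  map_target := e.map_source
  left_inv := e.right_inv
  right_inv := e.left_inv
  rel := fun x hx => by
    have := e.rel _ (e.map_target x hx)
    rw [e.right_inv x hx] at this
    exact r.symm this

/-- The restriction of a partial isomorphism to a Borel subset of its source. -/
def restr (e : RelPartialIso r) (S : Set X) (hS : MeasurableSet S) : RelPartialIso r where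
  source := e.source ∩ S
  target := e.target ∩ e.invFun ⁻¹' S
  toFun := e.toFun
  invFun := e.invFun
  measurableSet_source := e.measurableSet_source.inter hS
  measurableSet_target := e.measurableSet_target.inter (e.measurable_invFun hS)
  measurable_toFun := e.measurable_toFun
  measurable_invFun := e.measurable_invFun
  map_source := fun x hx => ⟨e.map_source x hx.1, by
    rw [mem_preimage, e.left_inv x hx.1]; exact hx.2⟩
  map_target := fun x hx => ⟨e.map_target x hx.1, hx.2⟩
  left_inv := fun x hx => e.left_inv x hx.1
  right_inv := fun x hx => e.right_inv x hx.1
  rel := fun x hx => e.rel x hx.1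

/-- The graph of a partial isomorphism. -/
def graph (e : RelPartialIso r) : Set (X × X) :=
  {p | p.1 ∈ e.source ∧ e.toFun p.1 = p.2}

theorem mem_graph_iff_target (e : RelPartialIso r) (p : X × X) :
    p ∈ e.graph ↔ p.2 ∈ e.target ∧ e.invFun p.2 = p.1 := by
  constructor
  · rintro ⟨h1, h2⟩
    rw [← h2]
    exact ⟨e.map_source _ h1, e.left_inv _ h1⟩
  · rintro ⟨h1, h2⟩
    rw [graph, mem_ofPred_eq, ← h2]
    exact ⟨e.map_target _ h1, e.right_inv _ h1⟩

theorem mem_graph_symm (e : RelPartialIso r) (p : X × X) : p.swap ∈ e.symm.graph ↔ p ∈ e.graph := by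
  rw [mem_graph_iff_target e p]
  rfl

theorem rel_invFun (e : RelPartialIso r) {x : X} (hx : x ∈ e.target) : r x (e.invFun x) :=
  e.symm.rel x hx

theorem exists_ofInjOn [StandardBorelSpace X] {A : Set X} {φ : X → X} (hA : MeasurableSet A)
    (hφ : Measurable φ) (hi : InjOn φ A) (hr : ∀ x ∈ A, r x (φ x)) :
    ∃ e : RelPartialIso r, e.source = A ∧ e.toFun = φ ∧ e.target = φ '' A := by
  have hemb : MeasurableEmbedding (fun x : A => φ x) := by
    have := hA.standardBorel
    exact (hφ.comp measurable_subtype_coe).measurableEmbedding hi.injective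
  obtain ⟨τ, hτ, hτe⟩ := hemb.exists_measurable_extend measurable_subtype_coe (fun a => ⟨a⟩)
  have hτ' : ∀ x ∈ A, τ (φ x) = x := fun x hx => congrFun hτe ⟨x, hx⟩
  exact ⟨{  source := A
            target := φ '' A
            toFun := φ
            invFun := τ
            measurableSet_source := hA
            measurableSet_target := hA.image_of_measurable_injOn hφ hi
            measurable_toFun := hφ
            measurable_invFun := hτ
            map_source := fun x hx => mem_image_of_mem φ hx
            map_target := by
              rintro _ ⟨x, hx, rfl⟩
              rwa [hτ' x hx]
            left_inv := hτ'
            right_inv := by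
              rintro _ ⟨x, hx, rfl⟩
              rw [hτ' x hx]
            rel := hr }, rfl, rfl, rfl⟩

theorem measure_preimage {μ : Measure X} (e : RelPartialIso r) (hr : IsCountablePMP μ r) {S : Set X}
    (hS : MeasurableSet S) : μ (e.source ∩ e.toFun ⁻¹' S) = μ (e.target ∩ S) := by
  rw [← hr.measure_image _ e.toFun (e.measurableSet_source.inter (e.measurable_toFun hS))
    e.measurable_toFun ?_ fun x hx => e.rel x hx.1]
  · congr 1
    ext z
    constructor
    · rintro ⟨x, hx, rfl⟩
      exact ⟨e.map_source x hx.1, hx.2⟩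
    · rintro ⟨h1, h2⟩
      refine ⟨e.invFun z, ⟨e.map_target z h1, ?_⟩, e.right_inv z h1⟩
      rwa [mem_preimage, e.right_inv z h1]
  · intro x hx y hy hxy
    rw [← e.left_inv x hx.1, hxy, e.left_inv y hy.1]

end RelPartialIso

open RelPartialIso

theorem count_image_of_injOn {X : Type*} [MeasurableSpace X] {S T : Set X} {f : X → X}
    (hS : MeasurableSet S) (hT : MeasurableSet T) (hf : InjOn f S) (h : f '' S = T) :
    Measure.count S = Measure.count T := by
  rw [Measure.count_apply hS, Measure.count_apply hT, ← h, hf.encard_image]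

theorem measurableSet_section_rel {X : Type*} [MeasurableSpace X]
    {μ : Measure X} {r : Setoid X} (hr : IsCountablePMP μ r)
    {E : Set (X × X)} (hE : MeasurableSet E) (x : X) : MeasurableSet {z | r x z ∧ (x, z) ∈ E} :=
  measurable_prodMk_left (hr.measurableSet_graph.inter hE)

section Measure

variable {X : Type*} [MeasurableSpace X] [StandardBorelSpace X] {μ : Measure X}
  [IsFiniteMeasure μ] {r : Setoid X}

theorem RelPartialIso.measurableSet_graph (e : RelPartialIso r) : MeasurableSet e.graph :=
  (measurable_fst e.measurableSet_source).inter
    (measurableSet_eq_fun (e.measurable_toFun.comp measurable_fst) measurable_snd)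

theorem RelPartialIso.relMeasure_graph_inter (e : RelPartialIso r) (hr : IsCountablePMP μ r)
    {F : Set (X × X)} (hF : MeasurableSet F) :
    relMeasure μ r (F ∩ e.graph) = μ {x | x ∈ e.source ∧ (x, e.toFun x) ∈ F} := by
  have hm : MeasurableSet {x | x ∈ e.source ∧ (x, e.toFun x) ∈ F} :=
    e.measurableSet_source.inter ((measurable_id.prodMk e.measurable_toFun) hF)
  rw [relMeasure_apply hr (hF.inter e.measurableSet_graph), ← lintegral_indicator_one hm]
  refine lintegral_congr fun x => ?_
  by_cases hx : x ∈ {x | x ∈ e.source ∧ (x, e.toFun x) ∈ F}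
  · have : {z | r x z ∧ (x, z) ∈ F ∩ e.graph} = {e.toFun x} := by
      ext z
      constructor
      · rintro ⟨-, -, -, h⟩
        exact h.symm
      · rintro rfl
        exact ⟨e.rel x hx.1, hx.2, hx.1, rfl⟩
    rw [this, Measure.count_singleton, indicator_of_mem hx, Pi.one_apply]
  · have : {z | r x z ∧ (x, z) ∈ F ∩ e.graph} = ∅ := by
      ext z
      simp only [mem_ofPred_eq, mem_empty_iff_false, iff_false]
      rintro ⟨-, h1, h2, h3⟩
      dsimp only at h2 h3
      subst h3
      exact hx ⟨h2, h1⟩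
    rw [this, measure_empty, indicator_of_notMem hx]

theorem RelPartialIso.relMeasure_graph_ne_top (e : RelPartialIso r) (hr : IsCountablePMP μ r) :
    relMeasure μ r e.graph ≠ ∞ := by
  have := e.relMeasure_graph_inter hr MeasurableSet.univ
  rw [univ_inter] at this
  rw [this]
  exact measure_ne_top _ _

theorem RelPartialIso.relMeasure_swap (e : RelPartialIso r) (hr : IsCountablePMP μ r)
    {F : Set (X × X)} (hF : MeasurableSet F) (hFe : F ⊆ e.graph) :
    relMeasure μ r (Prod.swap ⁻¹' F) = relMeasure μ r F := by
  have h1 : Prod.swap ⁻¹' F = Prod.swap ⁻¹' F ∩ e.symm.graph := by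
    refine (inter_eq_left.2 fun p hp => ?_).symm
    exact (mem_graph_symm e p.swap).2 (hFe hp)
  rw [h1, e.symm.relMeasure_graph_inter hr (measurable_swap hF), ← inter_eq_left.2 hFe,
    e.relMeasure_graph_inter hr hF]
  have hS : MeasurableSet {x | (x, e.toFun x) ∈ F} :=
    (measurable_id.prodMk e.measurable_toFun) hF
  have := e.symm.measure_preimage hr hS
  change μ (e.target ∩ e.invFun ⁻¹' _) = μ (e.source ∩ _) at this
  refine Eq.trans ?_ this
  congr 1
  ext z
  constructor
  · rintro ⟨h1, h2, -⟩
    refine ⟨h1, ?_⟩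
    change (e.invFun z, e.toFun (e.invFun z)) ∈ F
    rw [e.right_inv z h1]
    exact h2
  · rintro ⟨h1, h2⟩
    change (e.invFun z, e.toFun (e.invFun z)) ∈ F at h2
    rw [e.right_inv z h1] at h2
    exact ⟨h1, h2, hFe h2⟩

/-- A partial isomorphism acting on the second variable of `r` preserves the measure of `r`. -/
theorem RelPartialIso.measurePreserving_snd (e : RelPartialIso r) (hr : IsCountablePMP μ r) :
    MeasurePreserving (Prod.map id e.toFun) ((relMeasure μ r).restrict (Prod.snd ⁻¹' e.source))
      ((relMeasure μ r).restrict (Prod.snd ⁻¹' e.target)) := by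
  have hm : Measurable (Prod.map (id : X → X) e.toFun) := measurable_id.prodMap e.measurable_toFun
  refine ⟨hm, Measure.ext fun E hE => ?_⟩
  have hs : MeasurableSet (Prod.snd ⁻¹' e.source : Set (X × X)) :=
    measurable_snd e.measurableSet_source
  have ht : MeasurableSet (Prod.snd ⁻¹' e.target : Set (X × X)) :=
    measurable_snd e.measurableSet_target
  rw [Measure.map_apply hm hE, Measure.restrict_apply (hm hE), Measure.restrict_apply hE,
    relMeasure_apply hr ((hm hE).inter hs), relMeasure_apply hr (hE.inter ht)]
  refine lintegral_congr fun x => ?_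
  refine count_image_of_injOn (f := e.toFun) (measurableSet_section_rel hr ((hm hE).inter hs) x)
    (measurableSet_section_rel hr (hE.inter ht) x) ?_ ?_
  · intro z hz w hw hzw
    rw [← e.left_inv z hz.2.2, hzw, e.left_inv w hw.2.2]
  · ext w
    constructor
    · rintro ⟨z, ⟨h1, h2, h3⟩, rfl⟩
      exact ⟨r.trans h1 (e.rel z h3), h2, e.map_source z h3⟩
    · rintro ⟨h1, h2, h3⟩
      refine ⟨e.invFun w, ⟨r.trans h1 (e.rel_invFun h3), ?_, e.map_target w h3⟩, e.right_inv w h3⟩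
      change (x, e.toFun (e.invFun w)) ∈ E
      rwa [e.right_inv w h3]

theorem measurePreserving_prodMap_left (hr : IsCountablePMP μ r) (f : X ≃ᵐ X)
    (hf : MeasurePreserving f μ μ) (hrel : ∀ᵐ x ∂μ, r x (f x)) :
    MeasurePreserving (Prod.map f id) (relMeasure μ r) (relMeasure μ r) := by
  have hm : Measurable (Prod.map f (id : X → X)) := f.measurable.prodMap measurable_id
  refine ⟨hm, Measure.ext fun E hE => ?_⟩
  rw [Measure.map_apply hm hE, relMeasure_apply hr (hm hE), relMeasure_apply hr hE]
  refine Eq.trans (lintegral_congr_ae ?_) (hf.lintegral_comp_emb f.measurableEmbedding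
    fun x => Measure.count {z | r x z ∧ (x, z) ∈ E})
  filter_upwards [hrel] with x hx
  congr 1
  ext z
  exact and_congr_left fun _ => ⟨fun h => r.trans (r.symm hx) h, fun h => r.trans hx h⟩

theorem measurePreserving_prodMap_right (hr : IsCountablePMP μ r) (f : X ≃ᵐ X)
    (hf : MeasurePreserving f μ μ) (hrel : ∀ᵐ x ∂μ, r x (f x)) :
    MeasurePreserving (Prod.map id f) (relMeasure μ r) (relMeasure μ r) := by
  have hm : Measurable (Prod.map (id : X → X) f) := measurable_id.prodMap f.measurable
  refine ⟨hm, Measure.ext fun E hE => ?_⟩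
  have hrel' : ∀ᵐ x ∂μ, r x (f.symm x) := by
    filter_upwards [(hf.symm f).quasiMeasurePreserving.ae hrel] with x hx
    rw [f.apply_symm_apply] at hx
    exact r.symm hx
  rw [Measure.map_apply hm hE, relMeasure_apply hr (hm hE), relMeasure_apply hr hE]
  refine lintegral_congr_ae ?_
  filter_upwards [ae_forall_rel hr hrel, ae_forall_rel hr hrel'] with x h1 h2
  refine count_image_of_injOn (f := f) (measurableSet_section_rel hr (hm hE) x)
    (measurableSet_section_rel hr hE x) f.injective.injOn ?_
  ext w
  constructor
  · rintro ⟨z, ⟨h3, h4⟩, rfl⟩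
    exact ⟨r.trans h3 (h1 z h3), h4⟩
  · rintro ⟨h3, h4⟩
    refine ⟨f.symm w, ⟨r.trans h3 (h2 w h3), ?_⟩, f.apply_symm_apply w⟩
    change (x, f (f.symm w)) ∈ E
    rwa [f.apply_symm_apply]

/-! ### Countable covers of `r ∩ (A × B)` by graphs -/

/-- The graphs of the partial isomorphisms `e k` from `A` to `B` cover almost all of
`r ∩ (A × B)`. -/
structure IsRelCover (μ : Measure X) [IsFiniteMeasure μ] (r : Setoid X) (A B : Set X)
    (e : ℕ → RelPartialIso r) : Prop where
  source_subset : ∀ k, (e k).source ⊆ A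
  target_subset : ∀ k, (e k).target ⊆ B
  ae_mem : ∀ᵐ p ∂relMeasure μ r, p ∈ A ×ˢ B → ∃ k, p ∈ (e k).graph

theorem IsRelCover.symm {A B : Set X} {e : ℕ → RelPartialIso r} (h : IsRelCover μ r A B e)
    (hr : IsCountablePMP μ r) : IsRelCover μ r B A fun k => (e k).symm where
  source_subset := h.target_subset
  target_subset := h.source_subset
  ae_mem := by
    filter_upwards [ae_swap_relMeasure hr h.ae_mem] with p hp hpm
    obtain ⟨k, hk⟩ := hp ⟨hpm.2, hpm.1⟩
    exact ⟨k, (mem_graph_symm (e k) p.swap).2 hk⟩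

theorem IsRelCover.restr {A B : Set X} {e : ℕ → RelPartialIso r} (h : IsRelCover μ r A B e)
    {S : Set X} (hS : MeasurableSet S) : IsRelCover μ r (A ∩ S) B fun k => (e k).restr S hS where
  source_subset := fun k => inter_subset_inter_left _ (h.source_subset k)
  target_subset := fun k => inter_subset_left.trans (h.target_subset k)
  ae_mem := by
    filter_upwards [h.ae_mem] with p hp hpm
    obtain ⟨k, hk⟩ := hp ⟨hpm.1.1, hpm.2⟩
    exact ⟨k, ⟨hk.1, hpm.1.2⟩, hk.2⟩

theorem IsRelCover.sigmaFinite {A B : Set X} {e : ℕ → RelPartialIso r} (h : IsRelCover μ r A B e)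
    (hr : IsCountablePMP μ r) (hA : MeasurableSet A) (hB : MeasurableSet B) :
    SigmaFinite ((relMeasure μ r).restrict (A ×ˢ B)) := by
  have hU : MeasurableSet (⋃ k, (e k).graph) :=
    MeasurableSet.iUnion fun k => (e k).measurableSet_graph
  refine ⟨⟨{ set := fun n => Nat.casesOn n (⋃ k, (e k).graph)ᶜ fun k => (e k).graph
             set_mem := fun _ => trivial
             finite := ?_
             spanning := ?_ }⟩⟩
  · rintro (_ | k)
    · have : (relMeasure μ r).restrict (A ×ˢ B) (⋃ k, (e k).graph)ᶜ = 0 := by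
        rw [measure_eq_zero_iff_ae_notMem, ae_restrict_iff' (hA.prod hB)]
        filter_upwards [h.ae_mem] with p hp hpm hcon
        exact hcon (mem_iUnion.2 (hp hpm))
      exact this.trans_lt ENNReal.zero_lt_top
    · exact lt_of_le_of_lt (Measure.restrict_apply_le _ _)
        (lt_top_iff_ne_top.2 ((e k).relMeasure_graph_ne_top hr))
  · rw [eq_univ_iff_forall]
    intro p
    by_cases hp : p ∈ ⋃ k, (e k).graph
    · obtain ⟨k, hk⟩ := mem_iUnion.1 hp
      exact mem_iUnion.2 ⟨k + 1, hk⟩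
    · exact mem_iUnion.2 ⟨0, hp⟩

/-- The flip preserves the measure of `r`, on products covered by countably many graphs. -/
theorem IsRelCover.measurePreserving_swap {A B : Set X} {e : ℕ → RelPartialIso r}
    (h : IsRelCover μ r A B e) (hr : IsCountablePMP μ r) (hA : MeasurableSet A)
    (hB : MeasurableSet B) :
    MeasurePreserving Prod.swap ((relMeasure μ r).restrict (B ×ˢ A))
      ((relMeasure μ r).restrict (A ×ˢ B)) := by
  refine ⟨measurable_swap, Measure.ext fun F hF => ?_⟩
  rw [Measure.map_apply measurable_swap hF, Measure.restrict_apply (measurable_swap hF),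
    Measure.restrict_apply hF]
  have hset : Prod.swap ⁻¹' F ∩ B ×ˢ A = Prod.swap ⁻¹' (F ∩ A ×ˢ B) := by
    ext p
    simp [and_comm]
  rw [hset]
  have hT : MeasurableSet (F ∩ A ×ˢ B) := hF.inter (hA.prod hB)
  set T := F ∩ A ×ˢ B with hTdef
  let G : ℕ → Set (X × X) := disjointed fun k => (e k).graph
  have hGm : ∀ k, MeasurableSet (G k) :=
    MeasurableSet.disjointed fun k => (e k).measurableSet_graph
  have hGd : Pairwise (Function.onFun Disjoint G) := disjoint_disjointed _
  have hGU : (⋃ k, G k) = ⋃ k, (e k).graph := iUnion_disjointed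
  have h1 : relMeasure μ r T = ∑' k, relMeasure μ r (T ∩ G k) := by
    rw [← measure_iUnion (fun i j hij => (hGd hij).mono inter_subset_right inter_subset_right)
      fun k => hT.inter (hGm k), ← inter_iUnion, hGU]
    refine measure_congr ?_
    filter_upwards [h.ae_mem] with p hp
    refine propext ⟨fun hpT => ⟨hpT, ?_⟩, fun hpT => hpT.1⟩
    exact mem_iUnion.2 (hp hpT.2)
  have h2 : relMeasure μ r (Prod.swap ⁻¹' T) =
      ∑' k, relMeasure μ r (Prod.swap ⁻¹' (T ∩ G k)) := by
    rw [← measure_iUnion (fun i j hij => ((hGd hij).mono inter_subset_right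
      inter_subset_right).preimage _) fun k => measurable_swap (hT.inter (hGm k)),
      ← preimage_iUnion, ← inter_iUnion, hGU]
    refine measure_congr ?_
    filter_upwards [ae_swap_relMeasure hr h.ae_mem] with p hp
    refine propext ⟨fun hpT => ⟨hpT, ?_⟩, fun hpT => hpT.1⟩
    exact mem_iUnion.2 (hp (show p.swap ∈ T from hpT).2)
  rw [h1, h2]
  refine tsum_congr fun k => ?_
  exact (e k).relMeasure_swap hr (hT.inter (hGm k))
    (inter_subset_right.trans (disjointed_subset _ k))

/-! ### Actions on `X` with orbits in `r` -/

/-- The action `a` of `G` on `X` preserves `μ`, and almost all its orbits lie in `r`. -/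
structure IsRelAction {G : Type*} [Group G] (μ : Measure X) (r : Setoid X)
    (a : G →* Equiv.Perm X) : Prop where
  measurePreserving : ∀ g, MeasurePreserving (a g) μ μ
  rel : ∀ g, ∀ᵐ x ∂μ, r x (a g x)

/-- The measurable automorphism of `X` given by a group element. -/
def IsRelAction.toMeasurableEquiv {G : Type*} [Group G] {a : G →* Equiv.Perm X}
    (ha : IsRelAction μ r a) (g : G) : X ≃ᵐ X where
  toEquiv := a g
  measurable_toFun := (ha.measurePreserving g).measurable
  measurable_invFun := by
    have : ((a g).symm : X → X) = a g⁻¹ := by rw [map_inv]; rfl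
    rw [this]
    exact (ha.measurePreserving g⁻¹).measurable

theorem IsRelAction.measurePreserving_left {G : Type*} [Group G] {a : G →* Equiv.Perm X}
    (ha : IsRelAction μ r a) (hr : IsCountablePMP μ r) (g : G) :
    MeasurePreserving (Prod.map (a g) id) (relMeasure μ r) (relMeasure μ r) :=
  measurePreserving_prodMap_left hr (ha.toMeasurableEquiv g) (ha.measurePreserving g) (ha.rel g)

theorem IsRelAction.measurePreserving_right {G : Type*} [Group G] {a : G →* Equiv.Perm X}
    (ha : IsRelAction μ r a) (hr : IsCountablePMP μ r) (g : G) :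
    MeasurePreserving (Prod.map id (a g)) (relMeasure μ r) (relMeasure μ r) :=
  measurePreserving_prodMap_right hr (ha.toMeasurableEquiv g) (ha.measurePreserving g) (ha.rel g)

/-- If `r` restricts on `A` to the orbit equivalence relation of a countable group, then
`r ∩ (A × B)` is covered by countably many graphs: choose for almost every `z ∈ B` whose class meets
`A` a point of `A`, cut the resulting map into injective pieces, and compose with the group. -/
theorem exists_isRelCover (hr : IsCountablePMP μ r) {G : Type*} [Group G] [Countable G]
    {a : G →* Equiv.Perm X} (ha : IsRelAction μ r a) {A B : Set X} (hA : MeasurableSet A)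
    (hB : MeasurableSet B) (haA : ∀ g, ∀ x ∈ A, a g x ∈ A)
    (horb : ∀ᵐ x ∂μ, x ∈ A → ∀ x' ∈ A, r x x' → ∃ g, a g x = x') :
    ∃ e, IsRelCover μ r A B e := by
  obtain ⟨C, ψ, hC, hψ, hCE, hCe⟩ := exists_measurable_selection μ
    (E := {q | r q.1 q.2} ∩ B ×ˢ A) (hr.measurableSet_graph.inter (hB.prod hA))
  have hCr : ∀ z ∈ C, r z (ψ z) := fun z hz => (hCE z hz).1
  obtain ⟨P, hPm, hPC, hPi, hPe⟩ := exists_injOn_pieces μ hC hψ (fun z hz =>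
    (hr.countable_class z).mono fun y hy =>
      r.trans (hCr z hz) (r.symm (by have := hCr y hy.1; rwa [hy.2] at this)))
  -- It is easier to cover `r ∩ (B × A)`, by the maps `z ↦ a g (ψ z)` on the pieces.
  have hex : ∀ c : ℕ × G, ∃ e : RelPartialIso r,
      e.source = {z | z ∈ P c.1 ∧ r z (a c.2 (ψ z))} ∧ e.toFun = (fun z => a c.2 (ψ z)) ∧
        e.target = (fun z => a c.2 (ψ z)) '' {z | z ∈ P c.1 ∧ r z (a c.2 (ψ z))} := by
    intro c
    have hm : Measurable fun z => a c.2 (ψ z) := (ha.measurePreserving c.2).measurable.comp hψ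
    refine exists_ofInjOn ?_ hm ?_ fun z hz => hz.2
    · exact (hPm c.1).inter ((measurable_id.prodMk hm) hr.measurableSet_graph)
    · intro z hz w hw hzw
      exact hPi c.1 hz.1 hw.1 ((a c.2).injective hzw)
  choose e hes hef het using hex
  obtain ⟨enum, henum⟩ := exists_surjective_nat (ℕ × G)
  have hcov : IsRelCover μ r B A fun k => e (enum k) := by
    refine ⟨fun k z hz => ?_, fun k y hy => ?_, ?_⟩
    · rw [hes] at hz
      exact (hCE z (hPC _ hz.1)).2.1
    · rw [het] at hy
      obtain ⟨z, hz, rfl⟩ := hy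
      exact haA _ _ (hCE z (hPC _ hz.1)).2.2
    · rw [ae_relMeasure_iff hr]
      filter_upwards [hCe, hPe, ae_forall_rel hr horb] with z h1 h2 h3 y hzy hmem
      have hzC := h1 ⟨y, hzy, hmem⟩
      obtain ⟨n, hn⟩ := h2 hzC
      obtain ⟨g, hg⟩ := h3 (ψ z) (hCr z hzC) (hCE z hzC).2.2 y hmem.2
        (r.trans (r.symm (hCr z hzC)) hzy)
      obtain ⟨k, hk⟩ := henum (n, g)
      refine ⟨k, ?_⟩
      rw [hk]
      refine ⟨?_, ?_⟩
      · rw [hes]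
        exact ⟨hn, by dsimp only; rw [hg]; exact hzy⟩
      · rw [hef]
        exact hg
  exact ⟨_, hcov.symm hr⟩

end Measure

/-! ### Weighted composition operators on `L²` -/

/-- `T` is the operator `(T ξ)(p) = c(p) ξ(Φ(p))` on `L²(ν)`. -/
def IsWeightedComp {W : Type*} [MeasurableSpace W] (ν : Measure W) (c : W → ℂ) (Φ : W → W)
    (T : Lp ℂ 2 ν →L[ℂ] Lp ℂ 2 ν) : Prop :=
  ∀ ξ : Lp ℂ 2 ν, T ξ =ᵐ[ν] fun p => c p * ξ (Φ p)

/-- `Φ` pulls conull sets back to conull sets, where the weight `c` does not vanish. -/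
def IsNonsingularOn {W : Type*} [MeasurableSpace W] (ν : Measure W) (c : W → ℂ) (Φ : W → W) :
    Prop :=
  ∀ P : W → Prop, (∀ᵐ p ∂ν, P p) → ∀ᵐ p ∂ν, c p ≠ 0 → P (Φ p)

section WeightedComp

variable {W : Type*} [MeasurableSpace W] {ν : Measure W}

theorem isNonsingularOn_id (c : W → ℂ) : IsNonsingularOn ν c id :=
  fun P hP => by filter_upwards [hP] with p hp _ using hp

theorem IsWeightedComp.mul {c c' : W → ℂ} {Φ Φ' : W → W} {T T' : Lp ℂ 2 ν →L[ℂ] Lp ℂ 2 ν}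
    (hT : IsWeightedComp ν c Φ T) (hT' : IsWeightedComp ν c' Φ' T')
    (hc : IsNonsingularOn ν c Φ) :
    IsWeightedComp ν (fun p => c p * c' (Φ p)) (fun p => Φ' (Φ p)) (T * T') := by
  intro ξ
  filter_upwards [hT (T' ξ), hc _ (hT' ξ)] with p h1 h2
  rw [mul_apply_eq_comp, h1]
  by_cases h0 : c p = 0
  · simp [h0]
  · rw [h2 h0, mul_assoc]

theorem IsWeightedComp.ext {c c' : W → ℂ} {Φ Φ' : W → W} {T T' : Lp ℂ 2 ν →L[ℂ] Lp ℂ 2 ν}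
    (hT : IsWeightedComp ν c Φ T) (hT' : IsWeightedComp ν c' Φ' T')
    (h : ∀ᵐ p ∂ν, ∀ ξ : W → ℂ, c p * ξ (Φ p) = c' p * ξ (Φ' p)) : T = T' := by
  refine ContinuousLinearMap.ext fun ξ => Lp.ext ?_
  filter_upwards [hT ξ, hT' ξ, h] with p h1 h2 h3
  rw [h1, h2, h3]

theorem ae_of_measurePreserving_restrict {S S' : Set W} {Φ : W → W} (hS : MeasurableSet S)
    (hΦ : MeasurePreserving Φ (ν.restrict S) (ν.restrict S')) {P : W → Prop} (hP : ∀ᵐ p ∂ν, P p) :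
    ∀ᵐ p ∂ν, p ∈ S → P (Φ p) := by
  rw [← ae_restrict_iff' hS]
  exact hΦ.quasiMeasurePreserving.ae (ae_restrict_of_ae hP)

theorem isNonsingularOn_indicator {S S' : Set W} {Φ : W → W} (hS : MeasurableSet S)
    (hΦ : MeasurePreserving Φ (ν.restrict S) (ν.restrict S')) :
    IsNonsingularOn ν (S.indicator 1) Φ := by
  intro P hP
  filter_upwards [ae_of_measurePreserving_restrict hS hΦ hP] with p hp hc
  exact hp (mem_of_indicator_ne_zero hc)

theorem memLp_indicator_comp {S S' : Set W} {Φ : W → W} (hS : MeasurableSet S)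
    (hΦ : MeasurePreserving Φ (ν.restrict S) (ν.restrict S')) (ξ : Lp ℂ 2 ν) :
    MemLp (S.indicator fun p => ξ (Φ p)) 2 ν :=
  (memLp_indicator_iff_restrict hS).2 (((Lp.memLp ξ).restrict S').comp_measurePreserving hΦ)

/-- The partial isometry `(T ξ)(p) = 1_S(p) ξ(Φ(p))` of a measure preserving map `Φ` from `S`
to `S'`. -/
def partialCompOp {S S' : Set W} (Φ : W → W) (hS : MeasurableSet S)
    (hΦ : MeasurePreserving Φ (ν.restrict S) (ν.restrict S')) : Lp ℂ 2 ν →L[ℂ] Lp ℂ 2 ν :=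
  LinearMap.mkContinuous
    { toFun := fun ξ => (memLp_indicator_comp hS hΦ ξ).toLp
      map_add' := by
        intro ξ η
        rw [← MemLp.toLp_add, MemLp.toLp_eq_toLp_iff]
        filter_upwards [ae_of_measurePreserving_restrict hS hΦ (Lp.coeFn_add ξ η)] with p hp
        by_cases h : p ∈ S
        · simpa only [Pi.add_apply, Set.indicator_of_mem h] using hp h
        · simp [h]
      map_smul' := by
        intro c ξ
        rw [RingHom.id_apply, ← MemLp.toLp_const_smul, MemLp.toLp_eq_toLp_iff]
        filter_upwards [ae_of_measurePreserving_restrict hS hΦ (Lp.coeFn_smul c ξ)] with p hp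
        by_cases h : p ∈ S
        · simpa only [Pi.smul_apply, Set.indicator_of_mem h] using hp h
        · simp [h] }
    1 (by
      intro ξ
      simp only [LinearMap.coe_mk, AddHom.coe_mk, one_mul, Lp.norm_toLp]
      rw [Lp.norm_def]
      refine ENNReal.toReal_mono (Lp.eLpNorm_ne_top ξ) ?_
      rw [eLpNorm_indicator_eq_eLpNorm_restrict hS]
      have := eLpNorm_comp_measurePreserving (p := 2)
        ((Lp.aestronglyMeasurable ξ).mono_measure Measure.restrict_le_self) hΦ
      exact this.le.trans (eLpNorm_mono_measure _ Measure.restrict_le_self))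

theorem coeFn_partialCompOp {S S' : Set W} {Φ : W → W} (hS : MeasurableSet S)
    (hΦ : MeasurePreserving Φ (ν.restrict S) (ν.restrict S')) (ξ : Lp ℂ 2 ν) :
    partialCompOp Φ hS hΦ ξ =ᵐ[ν] S.indicator fun p => ξ (Φ p) :=
  MemLp.coeFn_toLp (memLp_indicator_comp hS hΦ ξ)

theorem isWeightedComp_partialCompOp {S S' : Set W} {Φ : W → W} (hS : MeasurableSet S)
    (hΦ : MeasurePreserving Φ (ν.restrict S) (ν.restrict S')) :
    IsWeightedComp ν (S.indicator 1) Φ (partialCompOp Φ hS hΦ) := by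
  intro ξ
  filter_upwards [coeFn_partialCompOp hS hΦ ξ] with p hp
  rw [hp]
  by_cases h : p ∈ S <;> simp [h]

theorem norm_partialCompOp_le {S S' : Set W} {Φ : W → W} (hS : MeasurableSet S)
    (hΦ : MeasurePreserving Φ (ν.restrict S) (ν.restrict S')) : ‖partialCompOp Φ hS hΦ‖ ≤ 1 := by
  rw [partialCompOp]
  exact LinearMap.mkContinuous_norm_le _ zero_le_one _

theorem IsWeightedComp.star_eq {S S' : Set W} {Φ Φ' : W → W} {T T' : Lp ℂ 2 ν →L[ℂ] Lp ℂ 2 ν}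
    (hT : IsWeightedComp ν (S.indicator 1) Φ T) (hT' : IsWeightedComp ν (S'.indicator 1) Φ' T')
    (hS : MeasurableSet S) (hS' : MeasurableSet S')
    (hΦ : MeasurePreserving Φ (ν.restrict S) (ν.restrict S')) (hΦ' : Measurable Φ')
    (hinv : ∀ᵐ p ∂ν, p ∈ S → Φ' (Φ p) = p) : star T = T' := by
  rw [ContinuousLinearMap.star_eq_adjoint]
  symm
  rw [ContinuousLinearMap.eq_adjoint_iff]
  intro x y
  rw [L2.inner_def, L2.inner_def]
  have h1 : ∫ p, inner ℂ (T' x p) (y p) ∂ν = ∫ p in S', inner ℂ (x (Φ' p)) (y p) ∂ν := by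
    rw [← integral_indicator hS']
    refine integral_congr_ae ?_
    filter_upwards [hT' x] with p hp
    rw [hp]
    by_cases h : p ∈ S' <;> simp [h]
  have h2 : ∫ p, inner ℂ (x p) (T y p) ∂ν = ∫ p in S, inner ℂ (x (Φ' (Φ p))) (y (Φ p)) ∂ν := by
    rw [← integral_indicator hS]
    refine integral_congr_ae ?_
    filter_upwards [hT y, hinv] with p hp hq
    rw [hp]
    by_cases h : p ∈ S
    · simp [h, hq h]
    · simp [h]
  rw [h1, h2, ← hΦ.map_eq]
  refine integral_map hΦ.measurable.aemeasurable ?_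
  refine StronglyMeasurable.aestronglyMeasurable ?_
  exact ((Lp.stronglyMeasurable x).comp_measurable hΦ').inner (Lp.stronglyMeasurable y)

/-- Multiplication by the indicator function of a measurable set. -/
def indicatorOp (ν : Measure W) {S : Set W} (hS : MeasurableSet S) : Lp ℂ 2 ν →L[ℂ] Lp ℂ 2 ν :=
  partialCompOp id hS (MeasurePreserving.id (ν.restrict S))

theorem isWeightedComp_indicatorOp {S : Set W} (hS : MeasurableSet S) :
    IsWeightedComp ν (S.indicator 1) id (indicatorOp ν hS) :=
  isWeightedComp_partialCompOp hS _

theorem coeFn_indicatorOp {S : Set W} (hS : MeasurableSet S) (ξ : Lp ℂ 2 ν) :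
    indicatorOp ν hS ξ =ᵐ[ν] S.indicator ξ :=
  coeFn_partialCompOp hS _ ξ

theorem star_indicatorOp {S : Set W} (hS : MeasurableSet S) :
    star (indicatorOp ν hS) = indicatorOp ν hS :=
  (isWeightedComp_indicatorOp hS).star_eq (isWeightedComp_indicatorOp hS) hS hS
    (MeasurePreserving.id _) measurable_id (by simp)

theorem norm_indicatorOp_apply {S : Set W} (hS : MeasurableSet S) (ξ : Lp ℂ 2 ν) :
    ‖indicatorOp ν hS ξ‖ = (eLpNorm ξ 2 (ν.restrict S)).toReal := by
  rw [Lp.norm_def, eLpNorm_congr_ae (coeFn_indicatorOp hS ξ),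
    eLpNorm_indicator_eq_eLpNorm_restrict hS]

end WeightedComp

/-! ### Vectors annihilated in the limit by a bounded sequence of operators -/

/-- The vectors on which a bounded sequence of operators tends to zero. -/
def nullLimitSubmodule {H : Type*} [NormedAddCommGroup H] [InnerProductSpace ℂ H]
    (N : ℕ → H →L[ℂ] H) : Submodule ℂ H where
  carrier := {ξ | Tendsto (fun n => N n ξ) atTop (𝓝 0)}
  add_mem' := by
    intro ξ η hξ hη
    simpa using Tendsto.add hξ hη
  zero_mem' := by simp
  smul_mem' := by
    intro c ξ hξ
    simpa using Tendsto.const_smul hξ c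

theorem isClosed_nullLimitSubmodule {H : Type*} [NormedAddCommGroup H] [InnerProductSpace ℂ H]
    (N : ℕ → H →L[ℂ] H) {C : ℝ} (hC : ∀ n, ‖N n‖ ≤ C) :
    IsClosed (nullLimitSubmodule N : Set H) := by
  have hC0 : 0 ≤ C := (norm_nonneg _).trans (hC 0)
  refine isClosed_of_closure_subset fun ξ hξ => ?_
  change Tendsto (fun n => N n ξ) atTop (𝓝 0)
  rw [Metric.tendsto_atTop]
  intro ε hε
  have hδ : 0 < ε / (2 * (C + 1)) := by positivity
  obtain ⟨η, hη, hd⟩ := Metric.mem_closure_iff.1 hξ _ hδ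
  have hη' : Tendsto (fun n => N n η) atTop (𝓝 0) := hη
  obtain ⟨n₀, hn₀⟩ := Metric.tendsto_atTop.1 hη' (ε / 2) (half_pos hε)
  refine ⟨n₀, fun n hn => ?_⟩
  have h1 := hn₀ n hn
  rw [dist_zero_right] at h1 ⊢
  rw [dist_eq_norm] at hd
  have h2 : ‖N n (ξ - η)‖ ≤ C * ‖ξ - η‖ :=
    (N n).le_of_opNorm_le (hC n) _
  have h3 : C * ‖ξ - η‖ ≤ ε / 2 := by
    have : (C + 1) * ‖ξ - η‖ ≤ (C + 1) * (ε / (2 * (C + 1))) := by gcongr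
    have h4 : (C + 1) * (ε / (2 * (C + 1))) = ε / 2 := by
      have : C + 1 ≠ 0 := by positivity
      field_simp
    have h5 : 0 ≤ ‖ξ - η‖ := norm_nonneg _
    nlinarith
  have h4 : N n ξ = N n (ξ - η) + N n η := by rw [← map_add, sub_add_cancel]
  rw [h4]
  exact lt_of_le_of_lt (norm_add_le _ _) (by linarith)

/-! ### Von Neumann algebras -/

section VonNeumann

variable {H : Type*} [NormedAddCommGroup H] [InnerProductSpace ℂ H] [CompleteSpace H]

theorem subset_vonNeumannGenerated (S : Set (H →L[ℂ] H)) {T : H →L[ℂ] H} (hT : T ∈ S) :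
    T ∈ vonNeumannGenerated S := by
  change T ∈ StarSubalgebra.centralizer ℂ (StarSubalgebra.centralizer ℂ S : Set (H →L[ℂ] H))
  rw [StarSubalgebra.mem_centralizer_iff]
  intro ρ hρ
  have h1 := (StarSubalgebra.mem_centralizer_iff ℂ).1 hρ T hT
  refine ⟨h1.1.symm, ?_⟩
  have := congrArg star h1.2
  rw [star_mul, star_mul, star_star] at this
  exact this

theorem commute_of_mem_vonNeumannGenerated {S : Set (H →L[ℂ] H)} {ρ : H →L[ℂ] H}
    (h1 : ∀ T ∈ S, T * ρ = ρ * T) (h2 : ∀ T ∈ S, T * star ρ = star ρ * T) {x : H →L[ℂ] H}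
    (hx : x ∈ vonNeumannGenerated S) : x * ρ = ρ * x := by
  change x ∈ StarSubalgebra.centralizer ℂ (StarSubalgebra.centralizer ℂ S : Set (H →L[ℂ] H)) at hx
  rw [StarSubalgebra.mem_centralizer_iff] at hx
  refine (hx ρ ?_).1.symm
  change ρ ∈ StarSubalgebra.centralizer ℂ S
  rw [StarSubalgebra.mem_centralizer_iff]
  intro T hT
  refine ⟨h1 T hT, ?_⟩
  have := congrArg star (h2 T hT)
  rw [star_mul, star_mul, star_star] at this
  exact this.symm

/-- A self-adjoint operator that fixes all the vectors `b Ω` with `b ∈ Q` bounds the conditional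
expectation onto `Q`. -/
theorem condExpNorm_le {Ω : H} {Q : Set (H →L[ℂ] H)} {m : H →L[ℂ] H} (hm : star m = m)
    (hQ : ∀ b ∈ Q, m (b Ω) = b Ω) (a : H →L[ℂ] H) : condExpNorm Ω Q a ≤ ‖m (a Ω)‖ := by
  rw [condExpNorm]
  set K := (Submodule.span ℂ ((fun b : H →L[ℂ] H => b Ω) '' Q)).topologicalClosure
  have hK : ∀ k ∈ K, m k = k := by
    have hcl : IsClosed {k | m k = k} := isClosed_eq m.continuous continuous_id
    have hsub : K ≤ LinearMap.eqLocus (m : H →ₗ[ℂ] H) LinearMap.id := by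
      refine Submodule.topologicalClosure_minimal _ ?_ hcl
      rw [Submodule.span_le]
      rintro _ ⟨b, hb, rfl⟩
      exact hQ b hb
    exact fun k hk => hsub hk
  have h0 : K.starProjection (a Ω - m (a Ω)) = 0 := by
    rw [Submodule.starProjection_apply_eq_zero_iff, Submodule.mem_orthogonal]
    intro k hk
    rw [inner_sub_right, sub_eq_zero]
    conv_lhs => rw [← hK k hk]
    rw [← ContinuousLinearMap.adjoint_inner_right, ← ContinuousLinearMap.star_eq_adjoint, hm]
  rw [map_sub, sub_eq_zero] at h0
  rw [h0]
  exact K.norm_starProjection_apply_le _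

end VonNeumann

/-! ### Orbits in the second variable -/

theorem monoidHom_inv_apply_self {X G : Type*} [Group G] (a : G →* Equiv.Perm X) (g : G) (x : X) :
    a g⁻¹ (a g x) = x := by
  rw [← Equiv.Perm.mul_apply, ← map_mul, inv_mul_cancel, map_one, Equiv.Perm.one_apply]

theorem monoidHom_apply_inv_self {X G : Type*} [Group G] (a : G →* Equiv.Perm X) (g : G) (x : X) :
    a g (a g⁻¹ x) = x := by
  rw [← Equiv.Perm.mul_apply, ← map_mul, mul_inv_cancel, map_one, Equiv.Perm.one_apply]

/-- The saturation of `F ⊆ X × X` under an action on the second variable. -/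
def orbitSat {X H : Type*} [Group H] (b : H →* Equiv.Perm X) (F : Set (X × X)) : Set (X × X) :=
  {p | ∃ h, (p.1, b h p.2) ∈ F}

theorem IsRelAction.measurableSet_orbitSat {X : Type*} [MeasurableSpace X] {μ : Measure X}
    {r : Setoid X} {H : Type*} [Group H] [Countable H] {b : H →* Equiv.Perm X}
    (hb : IsRelAction μ r b) {F : Set (X × X)} (hF : MeasurableSet F) :
    MeasurableSet (orbitSat b F) := by
  have : orbitSat b F = ⋃ h, Prod.map id (b h) ⁻¹' F := by
    ext p
    simp [orbitSat, Prod.map]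
  rw [this]
  exact MeasurableSet.iUnion fun h =>
    (measurable_id.prodMap (hb.measurePreserving h).measurable) hF

theorem RelPartialIso.graph_restr {X : Type*} [MeasurableSpace X] {r : Setoid X}
    (e : RelPartialIso r) {S : Set (X × X)} (hS : MeasurableSet S) :
    (e.restr {x | (x, e.toFun x) ∈ S}
      ((measurable_id.prodMk e.measurable_toFun) hS)).graph = S ∩ e.graph := by
  ext p
  constructor
  · rintro ⟨⟨h1, h2⟩, h3⟩
    have h3' : e.toFun p.1 = p.2 := h3
    have h2' : (p.1, e.toFun p.1) ∈ S := h2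
    rw [h3'] at h2'
    exact ⟨h2', h1, h3⟩
  · rintro ⟨h1, h2, h3⟩
    refine ⟨⟨h2, ?_⟩, h3⟩
    change (p.1, e.toFun p.1) ∈ S
    rw [h3]
    exact h1

/-! ### The commutant of `L(r)` and the adjoint -/

section RelOperators

variable {X : Type*} [MeasurableSpace X] [StandardBorelSpace X] {μ : Measure X}
  [IsFiniteMeasure μ] {r : Setoid X}

/-- The right multiplication by a partial isomorphism: `(ρ ξ)(x, z) = 1_{target}(z) ξ(x, e⁻¹ z)`. -/
def rightOp (hr : IsCountablePMP μ r) (e : RelPartialIso r) : RelL2 μ r →L[ℂ] RelL2 μ r :=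
  partialCompOp (Prod.map id e.invFun) (measurable_snd e.measurableSet_target)
    (e.symm.measurePreserving_snd hr)

theorem isWeightedComp_rightOp (hr : IsCountablePMP μ r) (e : RelPartialIso r) :
    IsWeightedComp (relMeasure μ r) ((Prod.snd ⁻¹' e.target).indicator 1) (Prod.map id e.invFun)
      (rightOp hr e) :=
  isWeightedComp_partialCompOp _ _

theorem isNonsingularOn_rightOp (hr : IsCountablePMP μ r) (e : RelPartialIso r) :
    IsNonsingularOn (relMeasure μ r) ((Prod.snd ⁻¹' e.target).indicator 1)
      (Prod.map id e.invFun) :=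
  isNonsingularOn_indicator (measurable_snd e.measurableSet_target)
    (e.symm.measurePreserving_snd hr)

theorem star_rightOp (hr : IsCountablePMP μ r) (e : RelPartialIso r) :
    star (rightOp hr e) = rightOp hr e.symm := by
  refine (isWeightedComp_rightOp hr e).star_eq (isWeightedComp_rightOp hr e.symm)
    (measurable_snd e.measurableSet_target) (measurable_snd e.measurableSet_source)
    (e.symm.measurePreserving_snd hr) (measurable_id.prodMap e.measurable_toFun) ?_
  exact Eventually.of_forall fun p hp => Prod.ext rfl (e.right_inv p.2 hp)

theorem coeFn_diagVec : diagVec μ r =ᵐ[relMeasure μ r] (diagonal X).indicator fun _ => (1 : ℂ) :=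
  indicatorConstLp_coeFn

theorem rightOp_diagVec (hr : IsCountablePMP μ r) (e : RelPartialIso r) :
    rightOp hr e (diagVec μ r) =
      indicatorConstLp 2 e.measurableSet_graph (e.relMeasure_graph_ne_top hr) (1 : ℂ) := by
  refine Lp.ext ?_
  filter_upwards [isWeightedComp_rightOp hr e (diagVec μ r),
    isNonsingularOn_rightOp hr e _ coeFn_diagVec,
    indicatorConstLp_coeFn (p := 2) (hs := e.measurableSet_graph)
      (hμs := e.relMeasure_graph_ne_top hr) (c := (1 : ℂ))] with p h1 h2 h3
  rw [h1, h3]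
  by_cases ht : p.2 ∈ e.target
  · have ht' : p ∈ Prod.snd ⁻¹' e.target := ht
    rw [h2 (by rw [indicator_of_mem ht']; exact one_ne_zero), indicator_of_mem ht', Pi.one_apply,
      one_mul]
    by_cases hg : p ∈ e.graph
    · rw [indicator_of_mem hg, indicator_of_mem]
      exact ((e.mem_graph_iff_target p).1 hg).2.symm
    · rw [indicator_of_notMem hg, indicator_of_notMem]
      intro hcon
      exact hg ((e.mem_graph_iff_target p).2 ⟨ht, Eq.symm hcon⟩)
  · have ht' : p ∉ Prod.snd ⁻¹' e.target := ht
    rw [indicator_of_notMem ht', zero_mul, indicator_of_notMem]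
    intro hg
    exact ht ((e.mem_graph_iff_target p).1 hg).1

theorem isNonsingularOn_left (hr : IsCountablePMP μ r) {B : Set X} {φ : X → X}
    (hB : MeasurableSet B) (hφ : Measurable φ) (hi : InjOn φ B) (hrel : ∀ x ∈ B, r x (φ x)) :
    IsNonsingularOn (relMeasure μ r) (fun p => B.indicator 1 p.1) (fun p => (φ p.1, p.2)) := by
  intro P hP
  rw [ae_relMeasure_iff hr] at hP ⊢
  obtain ⟨N, hN, hNm, hN0⟩ := exists_measurable_superset_of_null (ae_iff.1 hP)
  have h0 : μ (B ∩ φ ⁻¹' N) = 0 := by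
    rw [← hr.measure_image _ φ (hB.inter (hφ hNm)) hφ (hi.mono inter_subset_left)
      fun x hx => hrel x hx.1]
    refine measure_mono_null ?_ hN0
    rintro _ ⟨x, hx, rfl⟩
    exact hx.2
  filter_upwards [measure_eq_zero_iff_ae_notMem.1 h0] with x hx z hz hc
  have hxB : x ∈ B := mem_of_indicator_ne_zero hc
  have hxN : φ x ∉ N := fun h => hx ⟨hxB, h⟩
  by_contra hP'
  exact hxN (hN fun hall => hP' (hall z (r.trans (r.symm (hrel x hxB)) hz)))

/-- Operators that act on the second variable of `r` commute with operators that act on the first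
one. -/
theorem left_comm_right {c d : X → ℂ} {φ τ : X → X} {T ρ : RelL2 μ r →L[ℂ] RelL2 μ r}
    (hT : IsWeightedComp (relMeasure μ r) (fun p => c p.1) (fun p => (φ p.1, p.2)) T)
    (hTn : IsNonsingularOn (relMeasure μ r) (fun p => c p.1) (fun p => (φ p.1, p.2)))
    (hρ : IsWeightedComp (relMeasure μ r) (fun p => d p.2) (fun p => (p.1, τ p.2)) ρ)
    (hρn : IsNonsingularOn (relMeasure μ r) (fun p => d p.2) (fun p => (p.1, τ p.2))) :
    T * ρ = ρ * T :=
  (hT.mul hρ hTn).ext (hρ.mul hT hρn) (Eventually.of_forall fun p ξ => by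
    dsimp only
    rw [mul_comm (c p.1)])

theorem relVonNeumann_comm_right (hr : IsCountablePMP μ r) {d d' : X → ℂ} {τ τ' : X → X}
    {ρ : RelL2 μ r →L[ℂ] RelL2 μ r}
    (hρ : IsWeightedComp (relMeasure μ r) (fun p => d p.2) (fun p => (p.1, τ p.2)) ρ)
    (hρn : IsNonsingularOn (relMeasure μ r) (fun p => d p.2) (fun p => (p.1, τ p.2)))
    (hρ' : IsWeightedComp (relMeasure μ r) (fun p => d' p.2) (fun p => (p.1, τ' p.2)) (star ρ))
    (hρn' : IsNonsingularOn (relMeasure μ r) (fun p => d' p.2) (fun p => (p.1, τ' p.2)))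
    {x : RelL2 μ r →L[ℂ] RelL2 μ r} (hx : x ∈ relVonNeumann μ r) : x * ρ = ρ * x := by
  have hgen : ∀ T ∈ ({T | ∃ f : X → ℂ, Measurable f ∧ (∃ C, ∀ x, ‖f x‖ ≤ C) ∧
        IsWeightedTranslation μ r f id T} ∪
     {T | ∃ (B : Set X) (φ : X → X), MeasurableSet B ∧ Measurable φ ∧ InjOn φ B ∧
        (∀ x ∈ B, r x (φ x)) ∧ IsWeightedTranslation μ r (B.indicator 1) φ T} :
        Set (RelL2 μ r →L[ℂ] RelL2 μ r)), ∃ (c : X → ℂ) (φ : X → X),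
      IsWeightedComp (relMeasure μ r) (fun p => c p.1) (fun p => (φ p.1, p.2)) T ∧
      IsNonsingularOn (relMeasure μ r) (fun p => c p.1) (fun p => (φ p.1, p.2)) := by
    rintro T (⟨f, -, -, hT⟩ | ⟨B, φ, hB, hφ, hi, hrel, hT⟩)
    · exact ⟨f, id, hT, isNonsingularOn_id _⟩
    · exact ⟨B.indicator 1, φ, hT, isNonsingularOn_left hr hB hφ hi hrel⟩
  refine commute_of_mem_vonNeumannGenerated (fun T hT => ?_) (fun T hT => ?_) hx
  · obtain ⟨c, φ, h1, h2⟩ := hgen T hT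
    exact left_comm_right h1 h2 hρ hρn
  · obtain ⟨c, φ, h1, h2⟩ := hgen T hT
    exact left_comm_right h1 h2 hρ' hρn'

theorem relVonNeumann_comm_rightOp (hr : IsCountablePMP μ r) (e : RelPartialIso r)
    {x : RelL2 μ r →L[ℂ] RelL2 μ r} (hx : x ∈ relVonNeumann μ r) :
    x * rightOp hr e = rightOp hr e * x := by
  have h := isWeightedComp_rightOp hr e.symm
  rw [← star_rightOp] at h
  exact relVonNeumann_comm_right hr (d := e.target.indicator 1) (d' := e.source.indicator 1)
    (τ := e.invFun) (τ' := e.toFun)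
    (isWeightedComp_rightOp hr e) (isNonsingularOn_rightOp hr e) h
    (isNonsingularOn_rightOp hr e.symm) hx

theorem relVonNeumann_comm_indicatorOp_snd (hr : IsCountablePMP μ r) {B : Set X}
    (hB : MeasurableSet B) {x : RelL2 μ r →L[ℂ] RelL2 μ r} (hx : x ∈ relVonNeumann μ r) :
    x * indicatorOp (relMeasure μ r) (measurable_snd hB) =
      indicatorOp (relMeasure μ r) (measurable_snd hB) * x := by
  have h := isWeightedComp_indicatorOp (ν := relMeasure μ r) (measurable_snd hB)
  have h' := h
  rw [← star_indicatorOp] at h'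
  exact relVonNeumann_comm_right hr (d := B.indicator 1) (d' := B.indicator 1)
    (τ := id) (τ' := id) h (isNonsingularOn_id _) h' (isNonsingularOn_id _) hx

theorem RelPartialIso.measurePreserving_swap_graph (e : RelPartialIso r)
    (hr : IsCountablePMP μ r) :
    MeasurePreserving Prod.swap ((relMeasure μ r).restrict e.graph)
      ((relMeasure μ r).restrict e.symm.graph) := by
  refine ⟨measurable_swap, Measure.ext fun F hF => ?_⟩
  rw [Measure.map_apply measurable_swap hF, Measure.restrict_apply (measurable_swap hF),
    Measure.restrict_apply hF,
    ← e.symm.relMeasure_swap hr (hF.inter e.symm.measurableSet_graph) inter_subset_right]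
  congr 1
  ext p
  exact and_congr_right fun _ => (mem_graph_symm e p).symm

/-- The function of the adjoint of `a ∈ L(r)` is the flipped complex conjugate of the function
of `a`. -/
theorem ae_star_apply_diagVec (hr : IsCountablePMP μ r) (e : RelPartialIso r)
    {a : RelL2 μ r →L[ℂ] RelL2 μ r} (ha : a ∈ relVonNeumann μ r) :
    ∀ᵐ p ∂relMeasure μ r, p ∈ e.graph →
      star a (diagVec μ r) p.swap = star (a (diagVec μ r) p) := by
  set Ω := diagVec μ r
  have hfin : IsFiniteMeasure ((relMeasure μ r).restrict e.graph) :=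
    ⟨by rw [Measure.restrict_apply_univ]; exact lt_top_iff_ne_top.2 (e.relMeasure_graph_ne_top hr)⟩
  rw [← ae_restrict_iff' e.measurableSet_graph]
  have hf : MemLp (fun p : X × X => star a Ω p.swap) 2 ((relMeasure μ r).restrict e.graph) :=
    ((Lp.memLp (star a Ω)).restrict e.symm.graph).comp_measurePreserving
      (e.measurePreserving_swap_graph hr)
  have hg : MemLp (fun p => star (a Ω p)) 2 ((relMeasure μ r).restrict e.graph) :=
    ((Lp.memLp (a Ω)).restrict e.graph).star
  -- Both functions have the same integral over every Borel subset of the graph, that is, over the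
  -- graph of a restriction `e'` of `e`; these integrals are inner products with `ρ_{e'} Ω`, and
  -- `ρ_{e'}` commutes with `a`.
  refine Integrable.ae_eq_of_forall_setIntegral_eq _ _ (hf.integrable one_le_two)
    (hg.integrable one_le_two) fun S hS _ => ?_
  rw [Measure.restrict_restrict hS, ← e.graph_restr hS]
  set e' := e.restr {x | (x, e.toFun x) ∈ S} ((measurable_id.prodMk e.measurable_toFun) hS)
  have h1 : ∫ p in e'.graph, star a Ω p.swap ∂relMeasure μ r =
      inner ℂ (rightOp hr e'.symm Ω) (star a Ω) := by
    rw [rightOp_diagVec hr e'.symm, L2.inner_indicatorConstLp_one,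
      ← (e'.measurePreserving_swap_graph hr).integral_comp
        MeasurableEquiv.prodComm.measurableEmbedding]
  have h2 : ∫ p in e'.graph, star (a Ω p) ∂relMeasure μ r =
      starRingEnd ℂ (inner ℂ (rightOp hr e' Ω) (a Ω)) := by
    rw [rightOp_diagVec hr e', L2.inner_indicatorConstLp_one, ← integral_conj]
    rfl
  rw [h1, h2, inner_conj_symm, ← star_rightOp, ContinuousLinearMap.star_eq_adjoint,
    ContinuousLinearMap.adjoint_inner_left, ContinuousLinearMap.star_eq_adjoint,
    ← mul_apply_eq_comp, ← ContinuousLinearMap.star_eq_adjoint,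
    ← relVonNeumann_comm_rightOp hr e' (star_mem ha), mul_apply_eq_comp,
    ContinuousLinearMap.star_eq_adjoint, ContinuousLinearMap.adjoint_inner_right]

/-- The part on the orbits of the vector `a* ρ_{e'} Ω = ρ_{e'} a* Ω` is dominated by the part of the
vector `a Ω` on the saturation of the graph of `e'`: the right multiplication by `e'` moves the flip
of that saturation onto the orbits, and `a* Ω` is the flipped complex conjugate of `a Ω`. -/
theorem norm_indicatorOp_orbit_rightOp_le (hr : IsCountablePMP μ r) {H : Type*} [Group H]
    [Countable H] {b : H →* Equiv.Perm X} (hb : IsRelAction μ r b) {A B : Set X}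
    (hA : MeasurableSet A) (hB : MeasurableSet B) {e : ℕ → RelPartialIso r}
    (he : IsRelCover μ r A B e) {e' : RelPartialIso r} (he' : e'.source ⊆ A)
    {a : RelL2 μ r →L[ℂ] RelL2 μ r} (ha : a ∈ relVonNeumann μ r)
    (haB : ∀ᵐ p ∂relMeasure μ r, p.1 ∉ B → star a (diagVec μ r) p = 0) :
    ‖indicatorOp (relMeasure μ r) (hb.measurableSet_orbitSat measurableSet_diagonal)
        (rightOp hr e' (star a (diagVec μ r)))‖ ≤
      ‖indicatorOp (relMeasure μ r) (hb.measurableSet_orbitSat e'.measurableSet_graph)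
        (a (diagVec μ r))‖ := by
  set f := star a (diagVec μ r)
  set R := orbitSat b (diagonal X) with hRdef
  have hR : MeasurableSet R := hb.measurableSet_orbitSat measurableSet_diagonal
  have hT : MeasurableSet (orbitSat b e'.graph) := hb.measurableSet_orbitSat e'.measurableSet_graph
  have hs : MeasurableSet (Prod.snd ⁻¹' e'.source : Set (X × X)) :=
    measurable_snd e'.measurableSet_source
  have ht : MeasurableSet (Prod.snd ⁻¹' e'.target : Set (X × X)) :=
    measurable_snd e'.measurableSet_target
  have hswap : ∀ p : X × X, p ∈ Prod.swap ⁻¹' (orbitSat b e'.graph) ↔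
      p.2 ∈ e'.source ∧ (p.1, e'.toFun p.2) ∈ R := by
    rintro ⟨z', w⟩
    constructor
    · rintro ⟨h, h1, h2⟩
      exact ⟨h1, h⁻¹, by
        change z' = b h⁻¹ (e'.toFun w)
        have h2' : e'.toFun w = b h z' := h2
        rw [h2', monoidHom_inv_apply_self]⟩
    · rintro ⟨h1, h, h2⟩
      refine ⟨h⁻¹, h1, ?_⟩
      change e'.toFun w = b h⁻¹ z'
      have h2' : z' = b h (e'.toFun w) := h2
      rw [h2', monoidHom_inv_apply_self]
  have hS0 : MeasurableSet (Prod.swap ⁻¹' (orbitSat b e'.graph)) := measurable_swap hT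
  set S0 := Prod.swap ⁻¹' (orbitSat b e'.graph) with hS0def
  rw [norm_indicatorOp_apply, norm_indicatorOp_apply]
  refine ENNReal.toReal_mono ((eLpNorm_mono_measure _ Measure.restrict_le_self).trans_lt
    (Lp.eLpNorm_lt_top (a (diagVec μ r)))).ne ?_
  have hfm : AEStronglyMeasurable f (relMeasure μ r) := Lp.aestronglyMeasurable f
  have hgm : AEStronglyMeasurable (S0.indicator f) (relMeasure μ r) := hfm.indicator hS0
  calc eLpNorm (rightOp hr e' f) 2 ((relMeasure μ r).restrict R)
      = eLpNorm (R.indicator (rightOp hr e' f)) 2 (relMeasure μ r) :=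
        (eLpNorm_indicator_eq_eLpNorm_restrict hR).symm
    _ = eLpNorm ((Prod.snd ⁻¹' e'.target).indicator (S0.indicator f ∘ Prod.map id e'.invFun)) 2
          (relMeasure μ r) := by
        refine eLpNorm_congr_ae ?_
        filter_upwards [isWeightedComp_rightOp hr e' f] with p hp
        by_cases h1 : p ∈ Prod.snd ⁻¹' e'.target
        · have h1' : p.2 ∈ e'.target := h1
          have h3 : Prod.map id e'.invFun p ∈ S0 ↔ p ∈ R := by
            rw [hswap]
            change e'.invFun p.2 ∈ e'.source ∧ (p.1, e'.toFun (e'.invFun p.2)) ∈ R ↔ p ∈ R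
            rw [e'.right_inv _ h1']
            exact and_iff_right (e'.map_target _ h1')
          rw [indicator_of_mem h1, Function.comp_apply]
          by_cases h2 : p ∈ R
          · rw [indicator_of_mem h2, indicator_of_mem (h3.2 h2), hp, indicator_of_mem h1,
              Pi.one_apply, one_mul]
          · rw [indicator_of_notMem h2, indicator_of_notMem fun h => h2 (h3.1 h)]
        · rw [indicator_of_notMem h1]
          by_cases h2 : p ∈ R
          · rw [indicator_of_mem h2, hp, indicator_of_notMem h1, zero_mul]
          · rw [indicator_of_notMem h2]
    _ = eLpNorm (S0.indicator f) 2 ((relMeasure μ r).restrict (Prod.snd ⁻¹' e'.source)) := by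
        rw [eLpNorm_indicator_eq_eLpNorm_restrict ht]
        exact eLpNorm_comp_measurePreserving (hgm.mono_measure Measure.restrict_le_self)
          (e'.symm.measurePreserving_snd hr)
    _ ≤ eLpNorm (S0.indicator f) 2 (relMeasure μ r) :=
        eLpNorm_mono_measure _ Measure.restrict_le_self
    _ = eLpNorm ((B ×ˢ A).indicator (S0.indicator f)) 2 (relMeasure μ r) := by
        refine eLpNorm_congr_ae ?_
        filter_upwards [haB] with p hp
        by_cases h1 : p ∈ B ×ˢ A
        · rw [indicator_of_mem h1]
        · rw [indicator_of_notMem h1]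
          by_cases h2 : p ∈ S0
          · rw [indicator_of_mem h2]
            exact hp fun hpB => h1 ⟨hpB, he' ((hswap p).1 h2).1⟩
          · rw [indicator_of_notMem h2]
    _ = eLpNorm (S0.indicator f) 2 ((relMeasure μ r).restrict (B ×ˢ A)) :=
        eLpNorm_indicator_eq_eLpNorm_restrict (hB.prod hA)
    _ = eLpNorm (S0.indicator f ∘ Prod.swap) 2 ((relMeasure μ r).restrict (A ×ˢ B)) :=
        (eLpNorm_comp_measurePreserving (hgm.mono_measure Measure.restrict_le_self)
          ((he.symm hr).measurePreserving_swap hr hB hA)).symm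
    _ = eLpNorm ((orbitSat b e'.graph).indicator (a (diagVec μ r))) 2
          ((relMeasure μ r).restrict (A ×ˢ B)) := by
        refine eLpNorm_congr_norm_ae ?_
        rw [ae_restrict_iff' (hA.prod hB)]
        filter_upwards [he.ae_mem, ae_all_iff.2 fun k => ae_star_apply_diagVec hr (e k) ha]
          with p h1 h2 hp
        obtain ⟨k, hk⟩ := h1 hp
        by_cases h3 : p ∈ orbitSat b e'.graph
        · have h4 : p.swap ∈ S0 := h3
          rw [Function.comp_apply, indicator_of_mem h3, indicator_of_mem h4, h2 k hk, norm_star]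
        · have h4 : p.swap ∉ S0 := h3
          rw [Function.comp_apply, indicator_of_notMem h3, indicator_of_notMem h4]
    _ ≤ eLpNorm ((orbitSat b e'.graph).indicator (a (diagVec μ r))) 2 (relMeasure μ r) :=
        eLpNorm_mono_measure _ Measure.restrict_le_self
    _ = _ := eLpNorm_indicator_eq_eLpNorm_restrict hT

/-! ### Density of the graphs -/

/-- A closed subspace that contains the indicator functions of all Borel subsets of the graphs of a
cover contains all the vectors supported on `A × B`. -/
theorem IsRelCover.mem_of_forall_graph_mem (hr : IsCountablePMP μ r) {A B : Set X}
    {e : ℕ → RelPartialIso r} (he : IsRelCover μ r A B e) {V : Submodule ℂ (RelL2 μ r)}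
    (hV : IsClosed (V : Set (RelL2 μ r)))
    (hmem : ∀ k, ∀ (S : Set X) (hS : MeasurableSet S),
      rightOp hr ((e k).restr S hS) (diagVec μ r) ∈ V)
    {ξ : RelL2 μ r} (hξ : ∀ᵐ p ∂relMeasure μ r, p ∉ A ×ˢ B → ξ p = 0) : ξ ∈ V := by
  have hVV : Vᗮᗮ = V := by
    rw [Submodule.orthogonal_orthogonal_eq_closure]
    exact hV.submodule_topologicalClosure_eq
  rw [← hVV, Submodule.mem_orthogonal]
  intro η hη
  rw [Submodule.mem_orthogonal] at hη
  have hη0 : ∀ k, ∀ᵐ p ∂relMeasure μ r, p ∈ (e k).graph → η p = 0 := by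
    intro k
    rw [← ae_restrict_iff' (e k).measurableSet_graph]
    have hfin : IsFiniteMeasure ((relMeasure μ r).restrict (e k).graph) :=
      ⟨by rw [Measure.restrict_apply_univ]
          exact lt_top_iff_ne_top.2 ((e k).relMeasure_graph_ne_top hr)⟩
    refine Integrable.ae_eq_of_forall_setIntegral_eq _ (fun _ => (0 : ℂ))
      (((Lp.memLp η).restrict (e k).graph).integrable one_le_two) (integrable_zero _ _ _)
      fun S hS _ => ?_
    rw [Measure.restrict_restrict hS, ← (e k).graph_restr hS, integral_zero]
    have := hη _ (hmem k _ ((measurable_id.prodMk (e k).measurable_toFun) hS))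
    rwa [rightOp_diagVec, L2.inner_indicatorConstLp_one] at this
  rw [L2.inner_def]
  refine integral_eq_zero_of_ae ?_
  filter_upwards [ae_all_iff.2 hη0, he.ae_mem, hξ] with p h1 h2 h3
  by_cases hp : p ∈ A ×ˢ B
  · obtain ⟨k, hk⟩ := h2 hp
    rw [h1 k hk, inner_zero_left, Pi.zero_apply]
  · rw [h3 hp, inner_zero_right, Pi.zero_apply]

end RelOperators

/-! ### The canonical unitaries -/

section Unitaries

variable {X : Type*} [MeasurableSpace X] [StandardBorelSpace X] {μ : Measure X}
  [IsFiniteMeasure μ] {r : Setoid X} {G : Type*} [Group G] {a : G →* Equiv.Perm X}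

theorem IsRelAction.measurePreserving_left_restrict (ha : IsRelAction μ r a)
    (hr : IsCountablePMP μ r) {A : Set X} (hA : MeasurableSet A)
    (hinv : ∀ g, ∀ᵐ x ∂μ, a g x ∈ A ↔ x ∈ A) (g : G) :
    MeasurePreserving (Prod.map (a g) id) ((relMeasure μ r).restrict (Prod.fst ⁻¹' A))
      ((relMeasure μ r).restrict (Prod.fst ⁻¹' A)) := by
  have h := (ha.measurePreserving_left hr g).restrict_preimage
    (s := Prod.fst ⁻¹' A) (measurable_fst hA)
  rwa [Measure.restrict_congr_set (s := Prod.map (a g) id ⁻¹' (Prod.fst ⁻¹' A))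
    (t := Prod.fst ⁻¹' A)] at h
  have h2 : ∀ᵐ p ∂relMeasure μ r, a g p.1 ∈ A ↔ p.1 ∈ A := by
    rw [ae_relMeasure_iff hr]
    filter_upwards [hinv g] with x hx z _ using hx
  filter_upwards [h2] with p hp
  exact propext hp

/-- The canonical unitary `(u_g ξ)(x, z) = 1_A(x) ξ(g⁻¹ x, z)` of an action that leaves `A`
invariant. -/
def leftOp (hr : IsCountablePMP μ r) (ha : IsRelAction μ r a) {A : Set X} (hA : MeasurableSet A)
    (hinv : ∀ g, ∀ᵐ x ∂μ, a g x ∈ A ↔ x ∈ A) (g : G) : RelL2 μ r →L[ℂ] RelL2 μ r :=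
  partialCompOp (Prod.map (a g⁻¹) id) (measurable_fst hA)
    (ha.measurePreserving_left_restrict hr hA hinv g⁻¹)

variable (hr : IsCountablePMP μ r) (ha : IsRelAction μ r a) {A : Set X} (hA : MeasurableSet A)
  (hinv : ∀ g, ∀ᵐ x ∂μ, a g x ∈ A ↔ x ∈ A)

theorem isWeightedComp_leftOp (g : G) :
    IsWeightedComp (relMeasure μ r) ((Prod.fst ⁻¹' A).indicator 1) (Prod.map (a g⁻¹) id)
      (leftOp hr ha hA hinv g) :=
  isWeightedComp_partialCompOp _ _

theorem isWeightedTranslation_leftOp (g : G) :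
    IsWeightedTranslation μ r (A.indicator 1) (a g⁻¹) (leftOp hr ha hA hinv g) :=
  isWeightedComp_leftOp hr ha hA hinv g

theorem star_leftOp (g : G) : star (leftOp hr ha hA hinv g) = leftOp hr ha hA hinv g⁻¹ := by
  refine (isWeightedComp_leftOp hr ha hA hinv g).star_eq (isWeightedComp_leftOp hr ha hA hinv g⁻¹)
    (measurable_fst hA) (measurable_fst hA) (ha.measurePreserving_left_restrict hr hA hinv g⁻¹)
    ((ha.measurePreserving _).measurable.prodMap measurable_id) ?_
  refine Eventually.of_forall fun p _ => ?_
  exact Prod.ext (monoidHom_inv_apply_self a g⁻¹ p.1) rfl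

theorem leftOp_inv_mul_self (g : G) :
    leftOp hr ha hA hinv g⁻¹ * leftOp hr ha hA hinv g = supportProj μ r A hA := by
  have h1 := (isWeightedComp_leftOp hr ha hA hinv g⁻¹).mul (isWeightedComp_leftOp hr ha hA hinv g)
    (isNonsingularOn_indicator (measurable_fst hA)
      (ha.measurePreserving_left_restrict hr hA hinv g⁻¹⁻¹))
  refine h1.ext (isWeightedTranslation_supportProj μ r A hA :
    IsWeightedComp (relMeasure μ r) (fun p => A.indicator 1 p.1) (fun p => (id p.1, p.2)) _) ?_
  have h2 : ∀ᵐ p ∂relMeasure μ r, a g p.1 ∈ A ↔ p.1 ∈ A := by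
    rw [ae_relMeasure_iff hr]
    filter_upwards [hinv g] with x hx z _ using hx
  filter_upwards [h2] with p hp ξ
  rw [inv_inv]
  have h3 : Prod.map (a g⁻¹) id (Prod.map (a g) id p) = p :=
    Prod.ext (monoidHom_inv_apply_self a g p.1) rfl
  rw [h3]
  by_cases h : p.1 ∈ A
  · have h4 : p ∈ Prod.fst ⁻¹' A := h
    have h5 : Prod.map (a g) id p ∈ Prod.fst ⁻¹' A := hp.2 h
    rw [indicator_of_mem h4, indicator_of_mem h5, indicator_of_mem h]
    simp
  · have h4 : p ∉ Prod.fst ⁻¹' A := h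
    rw [indicator_of_notMem h4, indicator_of_notMem h]
    simp

theorem star_leftOp_mul_self (g : G) :
    star (leftOp hr ha hA hinv g) * leftOp hr ha hA hinv g = supportProj μ r A hA := by
  rw [star_leftOp, leftOp_inv_mul_self]

theorem leftOp_mul_star_self (g : G) :
    leftOp hr ha hA hinv g * star (leftOp hr ha hA hinv g) = supportProj μ r A hA := by
  rw [star_leftOp]
  have := leftOp_inv_mul_self hr ha hA hinv g⁻¹
  rwa [inv_inv] at this

theorem supportProj_eq_indicatorOp :
    supportProj μ r A hA = indicatorOp (relMeasure μ r) (measurable_fst hA) := by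
  refine ContinuousLinearMap.ext fun ξ => Lp.ext ?_
  filter_upwards [coeFn_supportProj μ r A hA ξ, coeFn_indicatorOp (ν := relMeasure μ r)
    (measurable_fst hA) ξ] with p h1 h2
  rw [h1, h2]

theorem star_supportProj : star (supportProj μ r A hA) = supportProj μ r A hA := by
  rw [supportProj_eq_indicatorOp, star_indicatorOp]

theorem supportProj_mul_self :
    supportProj μ r A hA * supportProj μ r A hA = supportProj μ r A hA := by
  refine ContinuousLinearMap.ext fun ξ => Lp.ext ?_
  rw [mul_apply_eq_comp]
  filter_upwards [coeFn_supportProj μ r A hA ξ,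
    coeFn_supportProj μ r A hA (supportProj μ r A hA ξ)] with p h1 h2
  rw [h2]
  by_cases h : p ∈ Prod.fst ⁻¹' A
  · rw [indicator_of_mem h]
  · rw [indicator_of_notMem h, h1, indicator_of_notMem h]

theorem supportProj_mul_leftOp (g : G) :
    supportProj μ r A hA * leftOp hr ha hA hinv g = leftOp hr ha hA hinv g := by
  refine ContinuousLinearMap.ext fun ξ => Lp.ext ?_
  rw [mul_apply_eq_comp]
  filter_upwards [coeFn_supportProj μ r A hA (leftOp hr ha hA hinv g ξ),
    isWeightedComp_leftOp hr ha hA hinv g ξ] with p h1 h2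
  rw [h1]
  by_cases h : p ∈ Prod.fst ⁻¹' A
  · rw [indicator_of_mem h]
  · rw [indicator_of_notMem h, h2, indicator_of_notMem h, zero_mul]

theorem leftOp_mul_supportProj (g : G) :
    leftOp hr ha hA hinv g * supportProj μ r A hA = leftOp hr ha hA hinv g := by
  have h := congrArg star (supportProj_mul_leftOp hr ha hA hinv g⁻¹)
  rwa [star_mul, star_leftOp, inv_inv, star_supportProj] at h

theorem leftOp_mem (g : G) : leftOp hr ha hA hinv g ∈ relVonNeumann μ r := by
  refine subset_vonNeumannGenerated _ (Or.inr ⟨{x | x ∈ A ∧ r x (a g⁻¹ x)}, a g⁻¹, ?_, ?_, ?_, ?_,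
    ?_⟩)
  · exact hA.inter ((measurable_id.prodMk (ha.measurePreserving g⁻¹).measurable)
      hr.measurableSet_graph)
  · exact (ha.measurePreserving g⁻¹).measurable
  · exact (a g⁻¹).injective.injOn
  · exact fun x hx => hx.2
  · intro ξ
    have h2 : ∀ᵐ p ∂relMeasure μ r, r p.1 (a g⁻¹ p.1) := by
      rw [ae_relMeasure_iff hr]
      filter_upwards [ha.rel g⁻¹] with x hx z _ using hx
    filter_upwards [isWeightedTranslation_leftOp hr ha hA hinv g ξ, h2] with p h1 h3
    rw [h1]
    by_cases h : p.1 ∈ A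
    · rw [indicator_of_mem h,
        indicator_of_mem (show p.1 ∈ {x | x ∈ A ∧ r x (a g⁻¹ x)} from ⟨h, h3⟩)]
    · rw [indicator_of_notMem h,
        indicator_of_notMem (show p.1 ∉ {x | x ∈ A ∧ r x (a g⁻¹ x)} from fun h' => h h'.1)]

/-- The vector of an element of `1_A L(r) 1_B` is supported on `A × B`. -/
theorem ae_support_of_mem_corner (hr : IsCountablePMP μ r) {A : Set X} (hA : MeasurableSet A)
    {B : Set X} (hB : MeasurableSet B)
    {x : RelL2 μ r →L[ℂ] RelL2 μ r} (hx : x ∈ relVonNeumann μ r)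
    (hxAB : supportProj μ r A hA * x * supportProj μ r B hB = x) :
    ∀ᵐ p ∂relMeasure μ r, p ∉ A ×ˢ B → x (diagVec μ r) p = 0 := by
  classical
  set Ω := diagVec μ r
  set q := indicatorOp (relMeasure μ r) (measurable_snd hB)
  have hq : supportProj μ r B hB Ω = q Ω := by
    refine Lp.ext ?_
    filter_upwards [coeFn_supportProj μ r B hB Ω, coeFn_indicatorOp (ν := relMeasure μ r)
      (measurable_snd hB) Ω, coeFn_diagVec (μ := μ) (r := r)] with p h1 h2 h3
    rw [h1, h2]
    by_cases hp : p ∈ diagonal X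
    · have hp' : p.1 = p.2 := hp
      by_cases h : p.2 ∈ B
      · rw [indicator_of_mem (show p ∈ Prod.fst ⁻¹' B by rw [mem_preimage, hp']; exact h),
          indicator_of_mem (show p ∈ Prod.snd ⁻¹' B from h)]
      · rw [indicator_of_notMem (show p ∉ Prod.fst ⁻¹' B by rw [mem_preimage, hp']; exact h),
          indicator_of_notMem (show p ∉ Prod.snd ⁻¹' B from h)]
    · have h0 : Ω p = 0 := by rw [h3, indicator_of_notMem hp]
      rw [indicator_apply, indicator_apply, h0, ite_self, ite_self]
  have h1 : x Ω = supportProj μ r A hA (q (x Ω)) := by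
    conv_lhs => rw [← hxAB]
    rw [mul_apply_eq_comp, mul_apply_eq_comp, hq, ← mul_apply_eq_comp x q,
      relVonNeumann_comm_indicatorOp_snd hr hB hx, mul_apply_eq_comp]
  filter_upwards [coeFn_supportProj μ r A hA (q (x Ω)), coeFn_indicatorOp (ν := relMeasure μ r)
      (measurable_snd hB) (x Ω)] with p h2 h3 hp
  rw [h1, h2]
  by_cases h : p ∈ Prod.fst ⁻¹' A
  · rw [indicator_of_mem h, h3, indicator_of_notMem]
    exact fun h' => hp ⟨h, h'⟩
  · rw [indicator_of_notMem h]

/-- If the translates by `g n` of the saturated graphs of a cover asymptotically leave every graph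
of the cover, then the unitaries `u_{g n}` tend to zero relative to every algebra whose vectors are
supported on the orbits. -/
theorem tendsto_condExpNorm_leftOp {H : Type*} [Group H] [Countable H] {b : H →* Equiv.Perm X}
    (hb : IsRelAction μ r b) {B : Set X} (hB : MeasurableSet B) {e : ℕ → RelPartialIso r}
    (he : IsRelCover μ r A B e) {Q : Set (RelL2 μ r →L[ℂ] RelL2 μ r)}
    (hQ : ∀ c ∈ Q, indicatorOp (relMeasure μ r) (hb.measurableSet_orbitSat measurableSet_diagonal)
      (c (diagVec μ r)) = c (diagVec μ r)) {g : ℕ → G}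
    (hg : ∀ j k, Tendsto (fun n => relMeasure μ r
      (Prod.map (a (g n)⁻¹) id ⁻¹' orbitSat b (e k).graph ∩ (e j).graph)) atTop (𝓝 0))
    {x y : RelL2 μ r →L[ℂ] RelL2 μ r} (hx : x ∈ relVonNeumann μ r) (hy : y ∈ relVonNeumann μ r)
    (hxAB : supportProj μ r A hA * x * supportProj μ r B hB = x)
    (hyAB : supportProj μ r A hA * y * supportProj μ r B hB = y) :
    Tendsto (fun n => condExpNorm (diagVec μ r) Q (star x * leftOp hr ha hA hinv (g n) * y))
      atTop (𝓝 0) := by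
  set Ω := diagVec μ r
  set m := indicatorOp (relMeasure μ r) (hb.measurableSet_orbitSat measurableSet_diagonal)
  have hTm : ∀ k n, MeasurableSet (Prod.map (a (g n)⁻¹) id ⁻¹' orbitSat b (e k).graph) :=
    fun k n => ((ha.measurePreserving _).measurable.prodMap measurable_id)
      (hb.measurableSet_orbitSat (e k).measurableSet_graph)
  -- `x Ω` is a limit of combinations of indicator functions of subsets of the graphs of the cover,
  -- and these escape the translated saturations.
  have hξ : ∀ k, Tendsto (fun n => indicatorOp (relMeasure μ r) (hTm k n) (x Ω)) atTop (𝓝 0) := by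
    intro k
    refine he.mem_of_forall_graph_mem hr (V := nullLimitSubmodule fun n =>
      indicatorOp (relMeasure μ r) (hTm k n)) (isClosed_nullLimitSubmodule _ (C := 1)
        fun n => norm_partialCompOp_le _ _) ?_ (ae_support_of_mem_corner hr hA hB hx hxAB)
    intro j S hS
    change Tendsto _ _ _
    rw [tendsto_zero_iff_norm_tendsto_zero]
    simp_rw [norm_indicatorOp_apply]
    rw [← ENNReal.toReal_zero]
    refine (ENNReal.tendsto_toReal ENNReal.zero_ne_top).comp ?_
    have hlim := ((hg j k).ennrpow_const (1 / 2 : ℝ))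
    rw [ENNReal.zero_rpow_of_pos (by norm_num)] at hlim
    refine tendsto_of_tendsto_of_tendsto_of_le_of_le tendsto_const_nhds hlim
      (fun n => zero_le) fun n => ?_
    dsimp only
    rw [rightOp_diagVec, eLpNorm_congr_ae (ae_restrict_of_ae indicatorConstLp_coeFn),
      eLpNorm_indicator_const ((e j).restr S hS).measurableSet_graph two_ne_zero
        ENNReal.ofNat_ne_top, Measure.restrict_apply ((e j).restr S hS).measurableSet_graph]
    simp only [enorm_one, one_mul, ENNReal.toReal_ofNat]
    refine ENNReal.rpow_le_rpow (measure_mono ?_) (by norm_num)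
    rintro p ⟨⟨hp1, hp2⟩, hp3⟩
    exact ⟨hp3, hp1.1, hp2⟩
  -- Similarly `y Ω` may be replaced by the indicator function `ρ_{e'} Ω` of a subset of the graph
  -- of `e k`; then the part of `x* u ρ_{e'} Ω` on the orbits is dominated by the part of
  -- `u* x Ω` on the saturated graph, a translate of the part of `x Ω` treated above.
  have hη : Tendsto (fun n => (m * (star x * leftOp hr ha hA hinv (g n))) (y Ω)) atTop (𝓝 0) := by
    refine he.mem_of_forall_graph_mem hr (V := nullLimitSubmodule fun n =>
      m * (star x * leftOp hr ha hA hinv (g n))) (isClosed_nullLimitSubmodule _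
        (C := 1 * (‖star x‖ * 1)) fun n => ?_) ?_ (ae_support_of_mem_corner hr hA hB hy hyAB)
    · refine (norm_mul_le _ _).trans (mul_le_mul (norm_partialCompOp_le _ _)
        ((norm_mul_le _ _).trans ?_) (norm_nonneg _) zero_le_one)
      exact mul_le_mul_of_nonneg_left (norm_partialCompOp_le _ _) (norm_nonneg _)
    · intro k S hS
      change Tendsto _ _ _
      refine squeeze_zero_norm (fun n => ?_) (tendsto_zero_iff_norm_tendsto_zero.1 (hξ k))
      set u := leftOp hr ha hA hinv (g n)
      have hu : u ∈ relVonNeumann μ r := leftOp_mem hr ha hA hinv (g n)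
      have hc : star u * x ∈ relVonNeumann μ r := mul_mem (star_mem hu) hx
      have hcs : star x * u = star (star u * x) := by rw [star_mul, star_star]
      have hcB : ∀ᵐ p ∂relMeasure μ r, p.1 ∉ B → star (star u * x) Ω p = 0 := by
        have h1 : star (star u * x) = supportProj μ r B hB * star (star u * x) := by
          rw [← hcs, ← mul_assoc]
          congr 1
          conv_lhs => rw [← hxAB]
          conv_rhs => rw [← hxAB]
          rw [star_mul, star_mul, star_supportProj, star_supportProj, ← mul_assoc, ← mul_assoc,
            ← mul_assoc, supportProj_mul_self]
        rw [h1, mul_apply_eq_comp]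
        filter_upwards [coeFn_supportProj μ r B hB (star (star u * x) Ω)] with p h2 hp
        rw [h2, indicator_of_notMem]
        exact hp
      have h1 := norm_indicatorOp_orbit_rightOp_le hr hb hA hB he
        (e' := (e k).restr S hS) (inter_subset_left.trans (he.source_subset k)) hc hcB
      have h2 : (m * (star x * u)) (rightOp hr ((e k).restr S hS) Ω) =
          m (rightOp hr ((e k).restr S hS) (star (star u * x) Ω)) := by
        rw [hcs, mul_apply_eq_comp, ← mul_apply_eq_comp (star (star u * x)),
          relVonNeumann_comm_rightOp hr _ (star_mem hc), mul_apply_eq_comp]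
      rw [h2]
      refine h1.trans ?_
      rw [norm_indicatorOp_apply, norm_indicatorOp_apply]
      refine ENNReal.toReal_mono ((eLpNorm_mono_measure _ Measure.restrict_le_self).trans_lt
        (Lp.eLpNorm_lt_top (x Ω))).ne ?_
      have hmp := ha.measurePreserving_left hr (g n)
      have hpre : Prod.map (a (g n)) id ⁻¹'
          (Prod.map (a (g n)⁻¹) id ⁻¹' orbitSat b (e k).graph) = orbitSat b (e k).graph := by
        rw [← preimage_comp]
        convert preimage_id
        funext p
        exact Prod.ext (monoidHom_inv_apply_self a (g n) p.1) rfl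
      have hmp' := hmp.restrict_preimage (hTm k n)
      rw [hpre] at hmp'
      rw [← eLpNorm_comp_measurePreserving ((Lp.aestronglyMeasurable (x Ω)).mono_measure
        Measure.restrict_le_self) hmp']
      refine (eLpNorm_mono_measure _ (Measure.restrict_mono ?_ le_rfl)).trans
        (eLpNorm_mono_ae (ae_restrict_of_ae ?_))
      · rintro p ⟨h, h3, h4⟩
        exact ⟨h, h3.1, h4⟩
      · rw [mul_apply_eq_comp, star_leftOp]
        filter_upwards [isWeightedComp_leftOp hr ha hA hinv (g n)⁻¹ (x Ω)] with p hp
        rw [hp, norm_mul, inv_inv]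
        refine mul_le_of_le_one_left (norm_nonneg _) ?_
        refine (norm_indicator_le_norm_self _ _).trans ?_
        simp
  refine squeeze_zero (fun n => norm_nonneg _) (fun n => ?_)
    (tendsto_zero_iff_norm_tendsto_zero.1 hη)
  refine (condExpNorm_le (star_indicatorOp _) hQ _).trans_eq ?_
  rw [mul_apply_eq_comp, mul_apply_eq_comp]
  rfl

/-- The vectors of the crossed product are supported on the orbits. -/
theorem indicatorOp_orbit_crossedProduct (hr : IsCountablePMP μ r) {H : Type*} [Group H]
    [Countable H] {b : H →* Equiv.Perm X} (hb : IsRelAction μ r b) {Z : Set X}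
    (hZ : MeasurableSet Z) {β : H →* Equiv.Perm Z} (hbβ : ∀ h, ⇑(b h) = extendById (β h))
    {c : RelL2 μ r →L[ℂ] RelL2 μ r} (hc : c ∈ crossedProduct μ r Z hZ β) :
    indicatorOp (relMeasure μ r) (hb.measurableSet_orbitSat measurableSet_diagonal)
      (c (diagVec μ r)) = c (diagVec μ r) := by
  set R := orbitSat b (diagonal X)
  have hR : MeasurableSet R := hb.measurableSet_orbitSat measurableSet_diagonal
  set m := indicatorOp (relMeasure μ r) hR
  have hm : IsWeightedComp (relMeasure μ r) (R.indicator 1) id m := isWeightedComp_indicatorOp hR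
  have hcomm : c * m = m * c := by
    have hgen : ∀ T ∈ ({T | ∃ f : X → ℂ, Measurable f ∧ (∃ C, ∀ x, ‖f x‖ ≤ C) ∧
        (∀ x, x ∉ Z → f x = 0) ∧ IsWeightedTranslation μ r f id T} ∪
       {T | ∃ g : H, IsWeightedTranslation μ r (Z.indicator 1) (extendById (β g⁻¹)) T} :
       Set (RelL2 μ r →L[ℂ] RelL2 μ r)), T * m = m * T := by
      rintro T (⟨f, -, -, -, hT⟩ | ⟨g, hT⟩)
      · have hT' : IsWeightedComp (relMeasure μ r) (fun p => f p.1) id T := hT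
        refine (hT'.mul hm (isNonsingularOn_id _)).ext (hm.mul hT' (isNonsingularOn_id _))
          (Eventually.of_forall fun p ξ => ?_)
        simp only [id]
        rw [mul_comm (f p.1)]
      · rw [← hbβ] at hT
        have hT' : IsWeightedComp (relMeasure μ r) (fun p => Z.indicator 1 p.1)
          (Prod.map (b g⁻¹) id) T := hT
        have hn : IsNonsingularOn (relMeasure μ r) (fun p => Z.indicator 1 p.1)
            (Prod.map (b g⁻¹) id) := fun P hP => by
          filter_upwards [(hb.measurePreserving_left hr g⁻¹).quasiMeasurePreserving.ae hP]
            with p hp _ using hp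
        refine (hT'.mul hm hn).ext (hm.mul hT' (isNonsingularOn_id _))
          (Eventually.of_forall fun p ξ => ?_)
        have hiff : Prod.map (b g⁻¹) id p ∈ R ↔ p ∈ R := by
          constructor
          · rintro ⟨h, hh⟩
            refine ⟨g * h, ?_⟩
            have hh' : b g⁻¹ p.1 = b h p.2 := hh
            change p.1 = b (g * h) p.2
            rw [map_mul, Equiv.Perm.mul_apply, ← hh', monoidHom_apply_inv_self]
          · rintro ⟨h, hh⟩
            refine ⟨g⁻¹ * h, ?_⟩
            have hh' : p.1 = b h p.2 := hh
            change b g⁻¹ p.1 = b (g⁻¹ * h) p.2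
            rw [map_mul, Equiv.Perm.mul_apply, ← hh']
        have hR1 : R.indicator (1 : X × X → ℂ) (Prod.map (b g⁻¹) id p) = R.indicator 1 p := by
          by_cases h : p ∈ R
          · rw [indicator_of_mem h, indicator_of_mem (hiff.2 h)]
            rfl
          · rw [indicator_of_notMem h, indicator_of_notMem fun h' => h (hiff.1 h')]
        simp only [id]
        change Z.indicator 1 p.1 * R.indicator (1 : X × X → ℂ) (Prod.map (b g⁻¹) id p) * _ = _
        rw [hR1, mul_comm (Z.indicator 1 p.1)]
    refine commute_of_mem_vonNeumannGenerated hgen ?_ hc.1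
    rw [star_indicatorOp]
    exact hgen
  have hmΩ : m (diagVec μ r) = diagVec μ r := by
    refine Lp.ext ?_
    filter_upwards [coeFn_indicatorOp (ν := relMeasure μ r) hR (diagVec μ r),
      coeFn_diagVec (μ := μ) (r := r)] with p h1 h2
    rw [h1]
    by_cases h : p ∈ R
    · rw [indicator_of_mem h]
    · rw [indicator_of_notMem h, h2, indicator_of_notMem]
      intro hd
      refine h ⟨1, ?_⟩
      rw [map_one]
      exact hd
  rw [← mul_apply_eq_comp, ← hcomm, mul_apply_eq_comp, hmΩ]

end Unitaries

/-! ### Invariant sets of finite measure -/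

/-- If a set of finite measure does not become asymptotically disjoint from its translates, then
there is an invariant set of positive finite measure: a level set of the vector of minimal norm in
the closed convex hull of the orbit of the indicator function. -/
theorem exists_invariant_set {W : Type*} [MeasurableSpace W] {ν : Measure W} {G : Type*} [Group G]
    [Countable G] {T : G → W → W} (hT : ∀ g, MeasurePreserving (T g) ν ν)
    (hmul : ∀ g h w, T (g * h) w = T g (T h w)) {S : Set W} (hS : MeasurableSet S)
    (hSf : ν S ≠ ∞) {ε : ℝ≥0∞} (hε : ε ≠ 0) (h : ∀ g, ε ≤ ν (S ∩ T g ⁻¹' S)) :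
    ∃ E, MeasurableSet E ∧ (∀ g, T g ⁻¹' E = E) ∧ ν E ≠ 0 ∧ ν E ≠ ∞ := by
  -- `U` is the Koopman representation (of the opposite group).
  let U : G → Lp ℝ 2 ν →ₗᵢ[ℝ] Lp ℝ 2 ν := fun g => Lp.compMeasurePreservingₗᵢ ℝ (T g) (hT g)
  have hU : ∀ g (ξ : Lp ℝ 2 ν), U g ξ =ᵐ[ν] ξ ∘ T g := fun g ξ =>
    Lp.coeFn_compMeasurePreserving ξ (hT g)
  have hUU : ∀ g k (ξ : Lp ℝ 2 ν), U g (U k ξ) = U (k * g) ξ := by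
    intro g k ξ
    refine Lp.ext ?_
    filter_upwards [hU g (U k ξ), (hT g).quasiMeasurePreserving.ae (hU k ξ), hU (k * g) ξ]
      with w h1 h2 h3
    rw [h1, h3, Function.comp_apply, h2, Function.comp_apply, Function.comp_apply, hmul]
  let ξ₀ : Lp ℝ 2 ν := indicatorConstLp 2 hS hSf 1
  have hU0 : ∀ g, inner ℝ ξ₀ (U g ξ₀) = ν.real (S ∩ T g ⁻¹' S) := by
    intro g
    have hSg : ν (T g ⁻¹' S) ≠ ∞ := by rwa [(hT g).measure_preimage hS.nullMeasurableSet]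
    have : U g ξ₀ = indicatorConstLp 2 ((hT g).measurable hS) hSg 1 :=
      Lp.indicatorConstLp_compMeasurePreserving hS hSf 1 (hT g)
    rw [this, L2.real_inner_indicatorConstLp_one_indicatorConstLp_one]
  have hεt : ε ≠ ∞ := ne_top_of_le_ne_top hSf ((h 1).trans (measure_mono inter_subset_left))
  have hδ : 0 < ε.toReal := ENNReal.toReal_pos hε hεt
  let O : Set (Lp ℝ 2 ν) := range fun g => U g ξ₀
  let C : Set (Lp ℝ 2 ν) := closure (convexHull ℝ O)
  have hCc : Convex ℝ C := (convex_convexHull ℝ O).closure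
  have hCn : C.Nonempty := ⟨U 1 ξ₀, subset_closure (subset_convexHull ℝ O ⟨1, rfl⟩)⟩
  -- This half-space contains the orbit of `ξ₀`; hence zero is not in `C`.
  have hCpos : ∀ v ∈ C, ε.toReal ≤ inner ℝ ξ₀ v := by
    have hcl : IsClosed {v : Lp ℝ 2 ν | ε.toReal ≤ inner ℝ ξ₀ v} :=
      isClosed_le continuous_const (continuous_const.inner continuous_id)
    have hcv : Convex ℝ {v : Lp ℝ 2 ν | ε.toReal ≤ inner ℝ ξ₀ v} :=
      convex_halfSpace_ge ⟨fun x y => inner_add_right _ _ _, fun c x => inner_smul_right _ _ _⟩ _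
    refine fun v hv => closure_minimal (convexHull_min ?_ hcv) hcl hv
    rintro _ ⟨g, rfl⟩
    change ε.toReal ≤ inner ℝ ξ₀ (U g ξ₀)
    rw [hU0]
    exact ENNReal.toReal_mono (ne_top_of_le_ne_top hSf (measure_mono inter_subset_left)) (h g)
  have hCU : ∀ g, ∀ v ∈ C, U g v ∈ C := by
    intro g v hv
    have h1 : MapsTo (U g) (convexHull ℝ O) (convexHull ℝ O) := by
      intro w hw
      have h2 : U g w ∈ (U g).toLinearMap '' convexHull ℝ O := ⟨w, hw, rfl⟩
      rw [LinearMap.image_convexHull] at h2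
      refine convexHull_mono ?_ h2
      rintro _ ⟨_, ⟨k, rfl⟩, rfl⟩
      exact ⟨k * g, (hUU g k ξ₀).symm⟩
    exact h1.closure (U g).continuous hv
  obtain ⟨v, hvC, hv⟩ :=
    exists_norm_eq_iInf_of_complete_convex hCn isClosed_closure.isComplete hCc 0
  have hmin : ∀ w ∈ C, ‖w‖ = ‖v‖ → w = v := by
    intro w hw hwv
    have h1 := (norm_eq_iInf_iff_real_inner_le_zero hCc hvC).1 hv w hw
    rw [zero_sub, inner_neg_left, inner_sub_right, real_inner_self_eq_norm_sq] at h1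
    have h2 := norm_sub_sq_real w v
    rw [hwv, real_inner_comm] at h2
    have h3 : ‖w - v‖ ^ 2 ≤ 0 := by rw [h2]; linarith
    have h4 : ‖w - v‖ = 0 := by
      have := sq_nonneg ‖w - v‖
      exact pow_eq_zero_iff two_ne_zero |>.1 (le_antisymm h3 this)
    exact sub_eq_zero.1 (norm_eq_zero.1 h4)
  have hvU : ∀ g, v ∘ T g =ᵐ[ν] v := by
    intro g
    have h1 := hU g v
    rw [hmin _ (hCU g v hvC) ((U g).norm_map v)] at h1
    exact h1.symm
  have hv0 : v ≠ 0 := by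
    rintro rfl
    have := hCpos 0 hvC
    rw [inner_zero_right] at this
    exact absurd this (not_le.2 hδ)
  have hlev : ∃ n : ℕ, ν {w | ((n : NNReal) + 1)⁻¹ ≤ ‖v w‖₊} ≠ 0 := by
    by_contra! hcon
    refine hv0 (Lp.ext ?_)
    filter_upwards [ae_all_iff.2 fun n => measure_eq_zero_iff_ae_notMem.1 (hcon n),
      Lp.coeFn_zero ℝ 2 ν] with w hw h0
    rw [h0]
    by_contra hne
    obtain ⟨n, hn⟩ := exists_nat_one_div_lt (norm_pos_iff.2 hne)
    refine hw n ?_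
    rw [← NNReal.coe_le_coe]
    push_cast
    rw [← one_div]
    exact hn.le
  obtain ⟨n, hn⟩ := hlev
  set E₀ := {w | ((n : NNReal) + 1)⁻¹ ≤ ‖v w‖₊} with hE₀
  have hE₀m : MeasurableSet E₀ :=
    measurableSet_le measurable_const (Lp.stronglyMeasurable v).measurable.nnnorm
  have hE₀f : ν E₀ < ∞ :=
    (Lp.memLp v).meas_ge_lt_top two_ne_zero ENNReal.ofNat_ne_top (by positivity)
  -- The level set is invariant up to null sets only; the intersection of its translates is
  -- invariant.
  have hEe : (⋂ g, T g ⁻¹' E₀) =ᵐ[ν] E₀ := by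
    filter_upwards [ae_all_iff.2 hvU] with w hw
    refine propext ?_
    change w ∈ (⋂ g, T g ⁻¹' E₀) ↔ w ∈ E₀
    have hiff : ∀ g, w ∈ T g ⁻¹' E₀ ↔ w ∈ E₀ := by
      intro g
      have : v (T g w) = v w := hw g
      rw [mem_preimage, hE₀, mem_ofPred_eq, mem_ofPred_eq, this]
    rw [mem_iInter]
    exact ⟨fun h => (hiff 1).1 (h 1), fun h g => (hiff g).2 h⟩
  refine ⟨⋂ g, T g ⁻¹' E₀, MeasurableSet.iInter fun g => (hT g).measurable hE₀m, fun k => ?_,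
    ?_, ?_⟩
  · ext w
    simp only [mem_preimage, mem_iInter, ← hmul]
    exact ⟨fun h g => by simpa using h (g * k⁻¹), fun h g => h (g * k)⟩
  · rwa [measure_congr hEe]
  · rw [measure_congr hEe]
    exact hE₀f.ne

/-! ### Fundamental domains for the action on the second variable -/

/-- The action of `H` on the second variable of `X × X`. -/
abbrev sndAction {X H : Type*} [Group H] (b : H →* Equiv.Perm X) : MulAction H (X × X) where
  smul h p := (p.1, b h p.2)
  one_smul p := by
    change (p.1, b 1 p.2) = p
    rw [map_one]
    rfl
  mul_smul g h p := by
    change (p.1, b (g * h) p.2) = (p.1, b g (b h p.2))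
    rw [map_mul]
    rfl

theorem orbitSat_smul {X H : Type*} [Group H] (b : H →* Equiv.Perm X) (F : Set (X × X)) (h : H) :
    (fun p : X × X => (p.1, b h p.2)) ⁻¹' orbitSat b F = orbitSat b F := by
  ext p
  constructor
  · rintro ⟨k, hk⟩
    exact ⟨k * h, by rw [map_mul]; exact hk⟩
  · rintro ⟨k, hk⟩
    refine ⟨k * h⁻¹, ?_⟩
    change (p.1, b (k * h⁻¹) (b h p.2)) ∈ F
    rw [← Equiv.Perm.mul_apply, ← map_mul, inv_mul_cancel_right]
    exact hk

theorem subset_orbitSat {X H : Type*} [Group H] (b : H →* Equiv.Perm X) (F : Set (X × X)) :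
    F ⊆ orbitSat b F := fun p hp => ⟨1, by rw [map_one]; exact hp⟩

section FundamentalDomain

variable {X : Type*} [MeasurableSpace X] [StandardBorelSpace X] {μ : Measure X}
  [IsFiniteMeasure μ] {r : Setoid X} {A B : Set X}

theorem IsRelAction.measurePreserving_left_prod {G : Type*} [Group G] {a : G →* Equiv.Perm X}
    (ha : IsRelAction μ r a) (hr : IsCountablePMP μ r) (hA : MeasurableSet A)
    (hB : MeasurableSet B) (hinv : ∀ g, ∀ᵐ x ∂μ, a g x ∈ A ↔ x ∈ A) (g : G) :
    MeasurePreserving (Prod.map (a g) id) ((relMeasure μ r).restrict (A ×ˢ B))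
      ((relMeasure μ r).restrict (A ×ˢ B)) := by
  have h := (ha.measurePreserving_left hr g).restrict_preimage (hA.prod hB)
  rwa [Measure.restrict_congr_set (s := Prod.map (a g) id ⁻¹' (A ×ˢ B)) (t := A ×ˢ B)] at h
  have h2 : ∀ᵐ p ∂relMeasure μ r, a g p.1 ∈ A ↔ p.1 ∈ A := by
    rw [ae_relMeasure_iff hr]
    filter_upwards [hinv g] with x hx z _ using hx
  filter_upwards [h2] with p hp
  exact propext (and_congr_left fun _ => hp)

theorem IsRelAction.measurePreserving_right_prod {H : Type*} [Group H] {b : H →* Equiv.Perm X}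
    (hb : IsRelAction μ r b) (hr : IsCountablePMP μ r) (hA : MeasurableSet A)
    (hB : MeasurableSet B) (hinv : ∀ h, ∀ᵐ x ∂μ, b h x ∈ B ↔ x ∈ B) (h : H) :
    MeasurePreserving (Prod.map id (b h)) ((relMeasure μ r).restrict (A ×ˢ B))
      ((relMeasure μ r).restrict (A ×ˢ B)) := by
  have h' := (hb.measurePreserving_right hr h).restrict_preimage (hA.prod hB)
  rwa [Measure.restrict_congr_set (s := Prod.map id (b h) ⁻¹' (A ×ˢ B)) (t := A ×ˢ B)] at h'
  have h2 : ∀ᵐ p ∂relMeasure μ r, b h p.2 ∈ B ↔ p.2 ∈ B := by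
    rw [ae_relMeasure_iff hr]
    filter_upwards [ae_forall_rel hr (hinv h)] with x hx z hz using hx z hz
  filter_upwards [h2] with p hp
  exact propext (and_congr_right fun _ => hp)

/-- A group that acts freely on the second variable of `r ∩ (A × B)` has a fundamental domain that
contains the graph of a prescribed member of the cover. An orbit of the group in `{x} × B` meets
every graph at most once, and the fundamental domain selects the point on the first graph that
it meets. -/
theorem IsRelCover.exists_isFundamentalDomain (hr : IsCountablePMP μ r) (hA : MeasurableSet A)
    (hB : MeasurableSet B) {e : ℕ → RelPartialIso r} (he : IsRelCover μ r A B e)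
    {H : Type*} [Group H] [Countable H] {b : H →* Equiv.Perm X} (hb : IsRelAction μ r b)
    (hinv : ∀ h, ∀ᵐ x ∂μ, b h x ∈ B ↔ x ∈ B) (hfree : ∀ h, h ≠ 1 → ∀ᵐ x ∂μ, x ∈ B → b h x ≠ x)
    (j : ℕ) : ∃ D : Set (X × X), MeasurableSet D ∧
      (letI := sndAction b; IsFundamentalDomain H D ((relMeasure μ r).restrict (A ×ˢ B))) ∧
      orbitSat b (e j).graph ∩ D = (e j).graph := by
  let _ := sndAction b
  -- The swap puts the graph of `e j` first, so that `D` contains it entirely.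
  let E : ℕ → Set (X × X) := fun n => (e (Equiv.swap j 0 n)).graph
  have hEm : ∀ n, MeasurableSet (E n) := fun n => (e _).measurableSet_graph
  have hE0 : E 0 = (e j).graph := by simp [E]
  let D : Set (X × X) := ⋃ n, E n \ ⋃ m ∈ Iio n, orbitSat b (E m)
  have hDm : MeasurableSet D := MeasurableSet.iUnion fun n => (hEm n).diff
    (MeasurableSet.biUnion (Set.to_countable _) fun m _ => hb.measurableSet_orbitSat (hEm m))
  have hD : ∀ p, p ∈ D ↔ ∃ n, p ∈ E n ∧ ∀ m < n, p ∉ orbitSat b (E m) := by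
    intro p
    simp [D]
  have hsmul : ∀ (h : H) (p : X × X) (F : Set (X × X)), h • p ∈ orbitSat b F ↔ p ∈ orbitSat b F :=
    fun h p F => by
      conv_rhs => rw [← orbitSat_smul b F h]
      rfl
  refine ⟨D, hDm, ?_, ?_⟩
  · refine IsFundamentalDomain.mk'' hDm.nullMeasurableSet ?_ ?_ fun h =>
      (hb.measurePreserving_right_prod hr hA hB hinv h).quasiMeasurePreserving
    · rw [ae_restrict_iff' (hA.prod hB)]
      filter_upwards [he.ae_mem] with p hp hpm
      obtain ⟨k, hk⟩ := hp hpm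
      have hex : ∃ n, p ∈ orbitSat b (E n) := by
        refine ⟨Equiv.swap j 0 k, subset_orbitSat b _ ?_⟩
        simp only [E, Equiv.swap_apply_self]
        exact hk
      classical
      obtain ⟨h, hh⟩ := Nat.find_spec hex
      refine ⟨h, (hD _).2 ⟨Nat.find hex, hh, fun m hm hcon => ?_⟩⟩
      exact Nat.find_min hex hm ((hsmul h p _).1 hcon)
    · intro h hh
      have hnull : ∀ᵐ p ∂relMeasure μ r, p.2 ∈ B → b h p.2 ≠ p.2 := by
        rw [ae_relMeasure_iff hr]
        filter_upwards [ae_forall_rel hr (hfree h hh)] with x hx z hz using hx z hz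
      rw [AEDisjoint, measure_eq_zero_iff_ae_notMem, ae_restrict_iff' (hA.prod hB)]
      filter_upwards [hnull] with p hp hpm hcon
      obtain ⟨⟨q, hq, hqp⟩, hpD⟩ := hcon
      have hqp' : (q.1, b h q.2) = p := hqp
      obtain ⟨n, hn, hn'⟩ := (hD q).1 hq
      obtain ⟨m, hm, hm'⟩ := (hD p).1 hpD
      have hpn : p ∈ orbitSat b (E n) := by
        rw [← hqp]
        exact (hsmul h q _).2 (subset_orbitSat b _ hn)
      have hqm : q ∈ orbitSat b (E m) := by
        rw [← hsmul h q]
        have : h • q = p := hqp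
        rw [this]
        exact subset_orbitSat b _ hm
      have hnm : n = m := by
        rcases lt_trichotomy n m with hlt | heq | hlt
        · exact (hm' n hlt hpn).elim
        · exact heq
        · exact (hn' m hlt hqm).elim
      subst hnm
      have h1 : q.1 = p.1 := by rw [← hqp']
      have h2 : b h q.2 = p.2 := by rw [← hqp']
      have h3 : q.2 = p.2 := by
        rw [← hn.2, ← hm.2, h1]
      exact hp hpm.2 (by rw [← h3, h2, h3])
  · rw [← hE0]
    ext p
    constructor
    · rintro ⟨h1, h2⟩
      obtain ⟨n, hn, hn'⟩ := (hD p).1 h2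
      rcases Nat.eq_zero_or_pos n with rfl | hpos
      · exact hn
      · exact (hn' 0 hpos h1).elim
    · intro hp
      exact ⟨subset_orbitSat b _ hp, (hD p).2 ⟨0, hp, fun m hm => absurd hm (Nat.not_lt_zero m)⟩⟩

end FundamentalDomain

/-! ### From intertwining to invariant sets -/

section Core

variable {X : Type*} [MeasurableSpace X] [StandardBorelSpace X] {μ : Measure X}
  [IsFiniteMeasure μ] {r : Setoid X} {A B : Set X}

theorem IsRelCover.relMeasure_inter_graph {e : ℕ → RelPartialIso r} (he : IsRelCover μ r A B e)
    (hA : MeasurableSet A) (hB : MeasurableSet B) (j : ℕ) (F : Set (X × X)) :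
    (relMeasure μ r).restrict (A ×ˢ B) (F ∩ (e j).graph) = relMeasure μ r (F ∩ (e j).graph) := by
  rw [Measure.restrict_apply' (hA.prod hB), inter_assoc]
  congr 2
  refine inter_eq_left.2 ?_
  rintro p ⟨h1, h2⟩
  refine ⟨he.source_subset j h1, ?_⟩
  rw [← h2]
  exact he.target_subset j ((e j).map_source _ h1)

/-- Intertwining yields an invariant subset of `r ∩ (A × B)` that has finite measure modulo `H`.
Otherwise a sequence in `G` moves the saturations of all the graphs of a cover asymptotically away
from all these graphs, and its unitaries contradict the intertwining. -/
theorem exists_invariant_of_intertwines (hr : IsCountablePMP μ r) {G H : Type*} [Group G] [Group H]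
    [Countable G] [Countable H] {a : G →* Equiv.Perm X} {b : H →* Equiv.Perm X}
    (ha : IsRelAction μ r a) (hb : IsRelAction μ r b) (hA : MeasurableSet A)
    (hB : MeasurableSet B) (hainv : ∀ g, ∀ᵐ x ∂μ, a g x ∈ A ↔ x ∈ A)
    (hbinv : ∀ h, ∀ᵐ x ∂μ, b h x ∈ B ↔ x ∈ B) (hfree : ∀ h, h ≠ 1 → ∀ᵐ x ∂μ, x ∈ B → b h x ≠ x)
    {e : ℕ → RelPartialIso r} (he : IsRelCover μ r A B e)
    {P Q : Set (RelL2 μ r →L[ℂ] RelL2 μ r)} (hP : ∀ g, leftOp hr ha hA hainv g ∈ P)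
    (hQ : ∀ c ∈ Q, indicatorOp (relMeasure μ r) (hb.measurableSet_orbitSat measurableSet_diagonal)
      (c (diagVec μ r)) = c (diagVec μ r))
    (hint : Intertwines (diagVec μ r) (relVonNeumann μ r) (supportProj μ r A hA) P
      (supportProj μ r B hB) Q) :
    ∃ E D : Set (X × X), MeasurableSet E ∧ MeasurableSet D ∧
      (∀ g, Prod.map (a g) id ⁻¹' E = E) ∧ (∀ h, Prod.map id (b h) ⁻¹' E = E) ∧
      (letI := sndAction b; IsFundamentalDomain H D ((relMeasure μ r).restrict (A ×ˢ B))) ∧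
      (relMeasure μ r).restrict (A ×ˢ B) E ≠ 0 ∧
      (relMeasure μ r).restrict (A ×ˢ B) (E ∩ D) ≠ ∞ := by
  let _ := sndAction b
  set κ := (relMeasure μ r).restrict (A ×ˢ B) with hκ
  have hmc : MeasurableConstSMul H (X × X) :=
    ⟨fun h => measurable_id.prodMap (hb.measurePreserving h).measurable⟩
  have hsi : SMulInvariantMeasure H (X × X) κ := ⟨fun h s hs =>
    (hb.measurePreserving_right_prod hr hA hB hbinv h).measure_preimage hs.nullMeasurableSet⟩
  choose D hDm hD hDe using he.exists_isFundamentalDomain hr hA hB hb hbinv hfree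
  -- Pass to the quotient `W` by `H`, with the measure `ν` for which the measure of a set is that of
  -- its preimage in any of the fundamental domains `D j`. The group `G` acts on `W` by the maps
  -- `T g`.
  let W := Quotient (MulAction.orbitRel H (X × X))
  let π : X × X → W := Quotient.mk''
  have hπ : Measurable π := measurable_quotient_mk''
  have hπinv : ∀ (F : Set W) (h : H), (fun p => h • p) ⁻¹' (π ⁻¹' F) = π ⁻¹' F := by
    intro F h
    ext p
    have : π (h • p) = π p := Quotient.sound' (MulAction.orbitRel_apply.2 ⟨h, rfl⟩)
    rw [mem_preimage, mem_preimage, mem_preimage, this]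
  let ν : Measure W := (κ.restrict (D 0)).map π
  have hν : ∀ F, MeasurableSet F → ν F = κ (π ⁻¹' F ∩ D 0) := fun F hF => by
    rw [Measure.map_apply hπ hF, Measure.restrict_apply (hπ hF)]
  have hνj : ∀ F, MeasurableSet F → ∀ j, ν F = κ (π ⁻¹' F ∩ D j) := fun F hF j => by
    rw [hν F hF]
    exact (hD 0).measure_set_eq (hD j) (hπ hF) (hπinv F)
  let T : G → W → W := fun g => Quotient.map' (fun p : X × X => (a g p.1, p.2)) (by
    rintro p q ⟨h, rfl⟩
    exact ⟨h, rfl⟩)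
  have hTπ : ∀ g p, T g (π p) = π (Prod.map (a g) id p) := fun g p => rfl
  have hTm : ∀ g, Measurable (T g) := fun g => by
    refine measurable_from_quotient.2 ?_
    exact hπ.comp ((ha.measurePreserving g).measurable.prodMap measurable_id)
  have hTmul : ∀ g h w, T (g * h) w = T g (T h w) := by
    intro g h w
    induction w using Quotient.inductionOn' with | _ p
    change π (a (g * h) p.1, p.2) = π (a g (a h p.1), p.2)
    rw [map_mul]
    rfl
  have hT : ∀ g, MeasurePreserving (T g) ν ν := by
    intro g
    refine ⟨hTm g, Measure.ext fun F hF => ?_⟩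
    have hmp := ha.measurePreserving_left_prod hr hA hB hainv
    have hD' : IsFundamentalDomain H (Prod.map (a g⁻¹) id ⁻¹' D 0) κ :=
      (hD 0).preimage_of_equiv (hmp g⁻¹).quasiMeasurePreserving (e := id) Function.bijective_id
        fun h p => rfl
    have hn : NullMeasurableSet (π ⁻¹' F ∩ Prod.map (a g⁻¹) id ⁻¹' D 0) κ :=
      ((hπ hF).inter (((ha.measurePreserving g⁻¹).measurable.prodMap measurable_id)
        (hDm 0))).nullMeasurableSet
    rw [Measure.map_apply (hTm g) hF, hν _ (hTm g hF), hν F hF,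
      (hD 0).measure_set_eq hD' (hπ hF) (hπinv F), ← (hmp g).measure_preimage hn]
    congr 1
    ext p
    have h1 : Prod.map (a g⁻¹) id (Prod.map (a g) id p) = p :=
      Prod.ext (monoidHom_inv_apply_self a g p.1) rfl
    simp only [mem_inter_iff, mem_preimage, hTπ, h1]
  -- `F n` is the union of the classes that meet one of the first graphs of the cover. Modulo `H`
  -- it has finite measure, because the saturation of a graph meets a suitable fundamental domain in
  -- exactly that graph.
  let F : ℕ → Set (X × X) := fun n => ⋃ k ∈ Iic n, orbitSat b (e k).graph
  have hFm : ∀ n, MeasurableSet (F n) := fun n =>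
    MeasurableSet.biUnion (Set.to_countable _) fun k _ =>
      hb.measurableSet_orbitSat (e k).measurableSet_graph
  have hFsmul : ∀ n (h : H) (p : X × X), h • p ∈ F n ↔ p ∈ F n := by
    intro n h p
    have h1 : ∀ k, h • p ∈ orbitSat b (e k).graph ↔ p ∈ orbitSat b (e k).graph := fun k => by
      conv_rhs => rw [← orbitSat_smul b _ h]
      rfl
    simp only [F, mem_iUnion, h1]
  have hπF : ∀ n, π ⁻¹' (π '' F n) = F n := by
    intro n
    refine Subset.antisymm ?_ (subset_preimage_image _ _)
    rintro p ⟨q, hq, hqp⟩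
    obtain ⟨h, rfl⟩ := MulAction.orbitRel_apply.1 (Quotient.exact' hqp)
    exact (hFsmul n h p).1 hq
  have hSm : ∀ n, MeasurableSet (π '' F n) := fun n => by
    refine measurableSet_quotient.2 ?_
    change MeasurableSet (π ⁻¹' (π '' F n))
    rw [hπF]
    exact hFm n
  have hSf : ∀ n, ν (π '' F n) ≠ ∞ := by
    intro n
    rw [hν _ (hSm n), hπF, iUnion₂_inter]
    refine (measure_biUnion_lt_top (finite_Iic n) fun k _ => ?_).ne
    have h1 := (hD 0).measure_set_eq (hD k) (hb.measurableSet_orbitSat (e k).measurableSet_graph)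
      (orbitSat_smul b (e k).graph)
    rw [h1, hDe k]
    exact (Measure.restrict_apply_le _ _).trans_lt
      (lt_top_iff_ne_top.2 ((e k).relMeasure_graph_ne_top hr))
  by_cases hcase : ∃ n : ℕ, ∀ g, ((n : ℝ≥0∞) + 1)⁻¹ ≤ ν (π '' F n ∩ T g ⁻¹' (π '' F n))
  · obtain ⟨n, hn⟩ := hcase
    obtain ⟨E, hEm, hET, hE0, hEf⟩ := exists_invariant_set hT hTmul (hSm n) (hSf n)
      (ENNReal.inv_ne_zero.2 (by simp)) hn
    rw [hν E hEm] at hE0 hEf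
    refine ⟨π ⁻¹' E, D 0, hπ hEm, hDm 0, fun g => ?_, fun h => hπinv E h, hD 0, fun h0 => ?_, hEf⟩
    · conv_rhs => rw [← hET g]
      rfl
    · exact hE0 (measure_mono_null inter_subset_left h0)
  · exfalso
    push Not at hcase
    choose g hg using hcase
    refine hint ⟨fun n => leftOp hr ha hA hainv (g n)⁻¹, fun n => ⟨hP _,
      star_leftOp_mul_self hr ha hA hainv _, leftOp_mul_star_self hr ha hA hainv _⟩,
      fun x hx y hy hxAB hyAB => ?_⟩
    refine tendsto_condExpNorm_leftOp hr ha hA hainv hb hB he hQ (fun j k => ?_) hx hy hxAB hyAB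
    have hlim : Tendsto (fun n : ℕ => ((n : ℝ≥0∞) + 1)⁻¹) atTop (𝓝 0) := by
      have := (tendsto_add_atTop_iff_nat 1).2 ENNReal.tendsto_inv_nat_nhds_zero
      simpa using this
    refine tendsto_of_tendsto_of_tendsto_of_le_of_le' tendsto_const_nhds hlim
      (Eventually.of_forall fun n => zero_le) ?_
    filter_upwards [eventually_ge_atTop j, eventually_ge_atTop k] with n hj hk
    refine le_trans ?_ (hg n).le
    -- Compute `ν` with the fundamental domain that contains the graph of `e j`.
    rw [hνj _ ((hSm n).inter (hTm _ (hSm n))) j,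
      ← he.relMeasure_inter_graph hA hB, inv_inv]
    refine measure_mono ?_
    rintro p ⟨hp1, hp2⟩
    have hpj : p ∈ orbitSat b (e j).graph ∩ D j := by
      rw [hDe j]
      exact hp2
    refine ⟨⟨⟨p, ?_, rfl⟩, ⟨Prod.map (a (g n)) id p, ?_, rfl⟩⟩, hpj.2⟩
    · exact mem_biUnion (show j ∈ Iic n from hj) hpj.1
    · exact mem_biUnion (show k ∈ Iic n from hk) hp1

end Core

/-! ### Extension of actions by the identity -/

theorem extendById_of_mem {X : Type*} {Y : Set X} (σ : Equiv.Perm Y) {x : X} (hx : x ∈ Y) :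
    extendById σ x = σ ⟨x, hx⟩ := dif_pos hx

theorem extendById_of_notMem {X : Type*} {Y : Set X} (σ : Equiv.Perm Y) {x : X} (hx : x ∉ Y) :
    extendById σ x = x := dif_neg hx

theorem extendById_mem_iff {X : Type*} {Y : Set X} (σ : Equiv.Perm Y) (x : X) :
    extendById σ x ∈ Y ↔ x ∈ Y := by
  by_cases hx : x ∈ Y
  · rw [extendById_of_mem σ hx]
    exact iff_of_true (Subtype.coe_prop _) hx
  · rw [extendById_of_notMem σ hx]

theorem extendById_one {X : Type*} {Y : Set X} (x : X) :
    extendById (1 : Equiv.Perm Y) x = x := by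
  by_cases hx : x ∈ Y
  · rw [extendById_of_mem _ hx, Equiv.Perm.one_apply]
  · rw [extendById_of_notMem _ hx]

theorem extendById_mul {X : Type*} {Y : Set X} (σ τ : Equiv.Perm Y) (x : X) :
    extendById (σ * τ) x = extendById σ (extendById τ x) := by
  by_cases hx : x ∈ Y
  · rw [extendById_of_mem _ hx, extendById_of_mem τ hx, extendById_of_mem σ (Subtype.coe_prop _)]
    rfl
  · rw [extendById_of_notMem _ hx, extendById_of_notMem τ hx, extendById_of_notMem σ hx]

/-- An action on `Y ⊆ X`, extended to `X` by the identity outside `Y`. -/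
def extendAction {X G : Type*} [Group G] {Y : Set X} (α : G →* Equiv.Perm Y) :
    G →* Equiv.Perm X where
  toFun g :=
    { toFun := extendById (α g)
      invFun := extendById (α g⁻¹)
      left_inv := fun x => by
        rw [← extendById_mul, ← map_mul, inv_mul_cancel, map_one, extendById_one]
      right_inv := fun x => by
        rw [← extendById_mul, ← map_mul, mul_inv_cancel, map_one, extendById_one] }
  map_one' := Equiv.ext fun x => by
    change extendById (α 1) x = x
    rw [map_one, extendById_one]
  map_mul' g h := Equiv.ext fun x => by
    change extendById (α (g * h)) x = extendById (α g) (extendById (α h) x)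
    rw [map_mul, extendById_mul]

theorem coe_extendAction {X G : Type*} [Group G] {Y : Set X} (α : G →* Equiv.Perm Y) (g : G) :
    ⇑(extendAction α g) = extendById (α g) := rfl

theorem ae_of_ae_comap_subtype {X : Type*} [MeasurableSpace X] {μ : Measure X} {Y : Set X}
    (hY : MeasurableSet Y) {p : Y → Prop} (h : ∀ᵐ y ∂(μ.comap Subtype.val), p y) :
    ∀ᵐ x ∂μ, ∀ hx : x ∈ Y, p ⟨x, hx⟩ := by
  rw [ae_iff, comap_subtype_coe_apply hY] at h
  rw [ae_iff]
  refine measure_mono_null (fun x hx => ?_) h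
  rw [mem_ofPred_eq] at hx
  push Not at hx
  obtain ⟨hxY, hx⟩ := hx
  exact ⟨⟨x, hxY⟩, hx, rfl⟩

theorem measurePreserving_extendById {X : Type*} [MeasurableSpace X] {μ : Measure X} {Y : Set X}
    (hY : MeasurableSet Y) {σ : Equiv.Perm Y}
    (hσ : MeasurePreserving σ (μ.comap Subtype.val) (μ.comap Subtype.val)) :
    MeasurePreserving (extendById σ) μ μ := by
  have hm : Measurable (extendById σ) := by
    refine measurable_of_restrict_of_restrict_compl hY ?_ ?_
    · have : Y.domRestrict (extendById σ) = fun y => (σ y : X) :=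
        funext fun y => extendById_of_mem σ y.2
      rw [this]
      exact measurable_subtype_coe.comp hσ.measurable
    · have : Yᶜ.domRestrict (extendById σ) = fun y : (Yᶜ : Set X) => (y : X) :=
        funext fun y => extendById_of_notMem σ y.2
      rw [this]
      exact measurable_subtype_coe
  refine ⟨hm, Measure.ext fun E hE => ?_⟩
  rw [Measure.map_apply hm hE, ← measure_inter_add_sdiff _ hY, ← measure_inter_add_sdiff E hY]
  congr 1
  · have h1 := hσ.measure_preimage (measurable_subtype_coe hE).nullMeasurableSet
    rw [comap_subtype_coe_apply hY, comap_subtype_coe_apply hY] at h1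
    have h2 : ((↑) : Y → X) '' (σ ⁻¹' (((↑) : Y → X) ⁻¹' E)) = extendById σ ⁻¹' E ∩ Y := by
      ext x
      constructor
      · rintro ⟨y, hy, rfl⟩
        refine ⟨?_, y.2⟩
        rw [mem_preimage, extendById_of_mem σ y.2]
        exact hy
      · rintro ⟨hx, hxY⟩
        rw [mem_preimage, extendById_of_mem σ hxY] at hx
        exact ⟨⟨x, hxY⟩, hx, rfl⟩
    rw [h2, Subtype.image_preimage_coe, inter_comm Y] at h1
    exact h1
  · congr 1
    ext x
    constructor
    · rintro ⟨hx, hxY⟩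
      rw [mem_preimage, extendById_of_notMem σ hxY] at hx
      exact ⟨hx, hxY⟩
    · rintro ⟨hx, hxY⟩
      refine ⟨?_, hxY⟩
      rw [mem_preimage, extendById_of_notMem σ hxY]
      exact hx

theorem IsFreeMPAction.isRelAction_extendAction {X : Type*} [MeasurableSpace X]
    [StandardBorelSpace X] {μ : Measure X} {r : Setoid X} {Y : Set X} (hY : MeasurableSet Y)
    {G : Type*} [Group G] {α : G →* Equiv.Perm Y} (hα : IsFreeMPAction (μ.comap Subtype.val) α)
    (hrel : ∀ g, ∀ᵐ y : Y ∂(μ.comap Subtype.val), r (y : X) (α g y : X)) :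
    IsRelAction μ r (extendAction α) where
  measurePreserving g := measurePreserving_extendById hY (hα.measurePreserving g)
  rel g := by
    filter_upwards [ae_of_ae_comap_subtype hY (hrel g)] with x hx
    rw [coe_extendAction]
    by_cases hxY : x ∈ Y
    · rw [extendById_of_mem _ hxY]
      exact hx hxY
    · rw [extendById_of_notMem _ hxY]

theorem IsFreeMPAction.ae_extendAction_ne {X : Type*} [MeasurableSpace X] {μ : Measure X}
    {Y : Set X} (hY : MeasurableSet Y) {G : Type*} [Group G] {α : G →* Equiv.Perm Y}
    (hα : IsFreeMPAction (μ.comap Subtype.val) α) {g : G} (hg : g ≠ 1) :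
    ∀ᵐ x ∂μ, x ∈ Y → extendAction α g x ≠ x := by
  filter_upwards [ae_of_ae_comap_subtype hY (hα.free g hg)] with x hx hxY
  rw [coe_extendAction, extendById_of_mem _ hxY]
  exact fun h => hx hxY (Subtype.ext h)

/-! ### Unitaries in crossed products and in their corners -/

section CrossedProduct

variable {X : Type*} [MeasurableSpace X] [StandardBorelSpace X] {μ : Measure X}
  [IsFiniteMeasure μ] {r : Setoid X} {G : Type*} [Group G] {a : G →* Equiv.Perm X}

theorem leftOp_mem_crossedProduct (hr : IsCountablePMP μ r) (ha : IsRelAction μ r a) {Y : Set X}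
    (hY : MeasurableSet Y) (hinv : ∀ g, ∀ᵐ x ∂μ, a g x ∈ Y ↔ x ∈ Y) {α : G →* Equiv.Perm Y}
    (haα : ∀ g, ⇑(a g) = extendById (α g)) (g : G) :
    leftOp hr ha hY hinv g ∈ crossedProduct μ r Y hY α := by
  refine ⟨subset_vonNeumannGenerated _ (Or.inr ⟨g, ?_⟩), supportProj_mul_leftOp hr ha hY hinv g,
    leftOp_mul_supportProj hr ha hY hinv g⟩
  rw [← haα]
  exact isWeightedTranslation_leftOp hr ha hY hinv g

theorem isWeightedComp_supportProj {Y : Set X} (hY : MeasurableSet Y) :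
    IsWeightedComp (relMeasure μ r) (fun p => Y.indicator 1 p.1) id (supportProj μ r Y hY) :=
  isWeightedTranslation_supportProj μ r Y hY

theorem supportProj_mem {Y : Set X} (hY : MeasurableSet Y) :
    supportProj μ r Y hY ∈ relVonNeumann μ r := by
  refine subset_vonNeumannGenerated _ (Or.inl ⟨Y.indicator 1, measurable_one.indicator hY,
    ⟨1, fun x => ?_⟩, isWeightedTranslation_supportProj μ r Y hY⟩)
  refine (norm_indicator_le_norm_self _ _).trans ?_
  simp

theorem supportProj_mul_of_subset {Y Z : Set X} (hY : MeasurableSet Y) (hZ : MeasurableSet Z)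
    (hYZ : Y ⊆ Z) : supportProj μ r Z hZ * supportProj μ r Y hY = supportProj μ r Y hY := by
  refine ((isWeightedComp_supportProj hZ).mul (isWeightedComp_supportProj hY)
    (isNonsingularOn_id _)).ext (isWeightedComp_supportProj hY)
    (Eventually.of_forall fun p ξ => ?_)
  simp only [id]
  by_cases h : p.1 ∈ Y
  · rw [indicator_of_mem h, indicator_of_mem (hYZ h)]
    simp
  · rw [indicator_of_notMem h]
    simp

theorem supportProj_ne_zero (hr : IsCountablePMP μ r) {Y : Set X} (hY : MeasurableSet Y)
    (hpos : μ Y ≠ 0) : supportProj μ r Y hY ≠ 0 := by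
  intro h
  refine hpos (measure_eq_zero_iff_ae_notMem.2 ?_)
  have h1 : ∀ᵐ p ∂relMeasure μ r, p ∈ diagonal X → p.1 ∉ Y := by
    have h0 : supportProj μ r Y hY (diagVec μ r) = 0 := by rw [h]; rfl
    filter_upwards [coeFn_supportProj μ r Y hY (diagVec μ r), coeFn_diagVec (μ := μ) (r := r),
      Lp.coeFn_zero ℂ 2 (relMeasure μ r)] with p h2 h3 h4 hp hpY
    rw [h0, h4, indicator_of_mem (show p ∈ Prod.fst ⁻¹' Y from hpY), h3, indicator_of_mem hp] at h2
    exact zero_ne_one h2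
  rw [ae_relMeasure_iff hr] at h1
  filter_upwards [h1] with x hx
  exact hx x (r.refl x) rfl

theorem leftOp_mul_supportProj_of_subset (hr : IsCountablePMP μ r) (ha : IsRelAction μ r a)
    {Y Z : Set X} (hY : MeasurableSet Y) (hZ : MeasurableSet Z) (hYZ : Y ⊆ Z)
    (hYinv : ∀ g, ∀ᵐ x ∂μ, a g x ∈ Y ↔ x ∈ Y) (hZinv : ∀ g, ∀ᵐ x ∂μ, a g x ∈ Z ↔ x ∈ Z) (g : G) :
    leftOp hr ha hZ hZinv g * supportProj μ r Y hY = leftOp hr ha hY hYinv g := by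
  refine ((isWeightedComp_leftOp hr ha hZ hZinv g).mul (isWeightedComp_supportProj hY)
    (isNonsingularOn_indicator (measurable_fst hZ)
      (ha.measurePreserving_left_restrict hr hZ hZinv g⁻¹))).ext
    (isWeightedComp_leftOp hr ha hY hYinv g) ?_
  have h2 : ∀ᵐ p ∂relMeasure μ r, a g⁻¹ p.1 ∈ Y ↔ p.1 ∈ Y := by
    rw [ae_relMeasure_iff hr]
    filter_upwards [hYinv g⁻¹] with x hx z _ using hx
  filter_upwards [h2] with p hp ξ
  by_cases h : p.1 ∈ Y
  · rw [indicator_of_mem (show p ∈ Prod.fst ⁻¹' Z from hYZ h),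
      indicator_of_mem (show p ∈ Prod.fst ⁻¹' Y from h),
      indicator_of_mem (show (Prod.map (a g⁻¹) id p).1 ∈ Y from hp.2 h)]
    simp
  · rw [indicator_of_notMem (show p ∉ Prod.fst ⁻¹' Y from h),
      indicator_of_notMem (show (Prod.map (a g⁻¹) id p).1 ∉ Y from fun h' => h (hp.1 h'))]
    simp

/-- The projections of invariant subsets commute with the crossed product. -/
theorem crossedProduct_comm_supportProj (hr : IsCountablePMP μ r) (ha : IsRelAction μ r a)
    {Y Z : Set X} (hY : MeasurableSet Y) (hZ : MeasurableSet Z)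
    (hYinv : ∀ g, ∀ᵐ x ∂μ, a g x ∈ Y ↔ x ∈ Y) {α : G →* Equiv.Perm Z}
    (haα : ∀ g, ⇑(a g) = extendById (α g)) {c : RelL2 μ r →L[ℂ] RelL2 μ r}
    (hc : c ∈ crossedProduct μ r Z hZ α) :
    c * supportProj μ r Y hY = supportProj μ r Y hY * c := by
  have hp := isWeightedComp_supportProj (μ := μ) (r := r) hY
  have hgen : ∀ T ∈ ({T | ∃ f : X → ℂ, Measurable f ∧ (∃ C, ∀ x, ‖f x‖ ≤ C) ∧
        (∀ x, x ∉ Z → f x = 0) ∧ IsWeightedTranslation μ r f id T} ∪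
       {T | ∃ g : G, IsWeightedTranslation μ r (Z.indicator 1) (extendById (α g⁻¹)) T} :
       Set (RelL2 μ r →L[ℂ] RelL2 μ r)), T * supportProj μ r Y hY = supportProj μ r Y hY * T := by
    rintro T (⟨f, -, -, -, hT⟩ | ⟨g, hT⟩)
    · have hT' : IsWeightedComp (relMeasure μ r) (fun p => f p.1) id T := hT
      refine (hT'.mul hp (isNonsingularOn_id _)).ext (hp.mul hT' (isNonsingularOn_id _))
        (Eventually.of_forall fun p ξ => ?_)
      simp only [id]
      rw [mul_comm (f p.1)]
    · rw [← haα] at hT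
      have hT' : IsWeightedComp (relMeasure μ r) (fun p => Z.indicator 1 p.1)
        (Prod.map (a g⁻¹) id) T := hT
      have hn : IsNonsingularOn (relMeasure μ r) (fun p => Z.indicator 1 p.1)
          (Prod.map (a g⁻¹) id) := fun P hP => by
        filter_upwards [(ha.measurePreserving_left hr g⁻¹).quasiMeasurePreserving.ae hP]
          with p hp _ using hp
      refine (hT'.mul hp hn).ext (hp.mul hT' (isNonsingularOn_id _)) ?_
      have h2 : ∀ᵐ p ∂relMeasure μ r, a g⁻¹ p.1 ∈ Y ↔ p.1 ∈ Y := by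
        rw [ae_relMeasure_iff hr]
        filter_upwards [hYinv g⁻¹] with x hx z _ using hx
      filter_upwards [h2] with p hpY ξ
      have h3 : Y.indicator (1 : X → ℂ) (Prod.map (a g⁻¹) id p).1 = Y.indicator 1 p.1 := by
        by_cases h : p.1 ∈ Y
        · rw [indicator_of_mem h,
            indicator_of_mem (show (Prod.map (a g⁻¹) id p).1 ∈ Y from hpY.2 h)]
          rfl
        · rw [indicator_of_notMem h,
            indicator_of_notMem (show (Prod.map (a g⁻¹) id p).1 ∉ Y from fun h' => h (hpY.1 h'))]
      rw [h3, mul_comm (Z.indicator 1 p.1)]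
      rfl
  refine commute_of_mem_vonNeumannGenerated hgen ?_ hc.1
  rw [star_supportProj]
  exact hgen

end CrossedProduct

/-! ### Measure equivalence -/

/-- The action of `G` on the first variable of `X × X`. -/
abbrev fstAction {X G : Type*} [Group G] (a : G →* Equiv.Perm X) : MulAction G (X × X) where
  smul g p := (a g p.1, p.2)
  one_smul p := by
    change (a 1 p.1, p.2) = p
    rw [map_one]
    rfl
  mul_smul g h p := by
    change (a (g * h) p.1, p.2) = (a g (a h p.1), p.2)
    rw [map_mul]
    rfl

/-- A measure equivalence coupling on a standard Borel space of any universe can be realized on a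
Borel subset of the real line. -/
theorem measureEquivalent_of_coupling {Γ Λ W : Type*} [Group Γ] [Group Λ] [MeasurableSpace W]
    [StandardBorelSpace W] (m : Measure W) [SigmaFinite m] [MulAction Γ W] [MulAction Λ W]
    [SMulCommClass Γ Λ W] (hm : m ≠ 0)
    (hΓ : ∀ g : Γ, MeasurePreserving (fun w : W => g • w) m m)
    (hΛ : ∀ h : Λ, MeasurePreserving (fun w : W => h • w) m m)
    (hΓfree : ∀ g : Γ, g ≠ 1 → ∀ᵐ w ∂m, g • w ≠ w) (hΛfree : ∀ h : Λ, h ≠ 1 → ∀ᵐ w ∂m, h • w ≠ w)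
    {D D' : Set W} (hDm : MeasurableSet D) (hD : IsFundamentalDomain Γ D m) (hDf : m D < ∞)
    (hDm' : MeasurableSet D') (hD' : IsFundamentalDomain Λ D' m) (hDf' : m D' < ∞) :
    MeasureEquivalent Γ Λ := by
  have hemb : MeasurableEmbedding (embeddingReal W) := measurableEmbedding_embeddingReal W
  have hstd : StandardBorelSpace (range (embeddingReal W)) :=
    hemb.measurableSet_range.standardBorel
  let f : W ≃ᵐ range (embeddingReal W) := hemb.equivRange
  have hf : MeasurePreserving f m (m.map f) := f.measurable.measurePreserving m
  have hf' : MeasurePreserving f.symm (m.map f) m := hf.symm f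
  let aΓ : MulAction Γ (range (embeddingReal W)) :=
    { smul := fun g w => f (g • f.symm w)
      one_smul := fun w => by
        change f ((1 : Γ) • f.symm w) = w
        rw [one_smul, f.apply_symm_apply]
      mul_smul := fun g h w => by
        change f ((g * h) • f.symm w) = f (g • f.symm (f (h • f.symm w)))
        rw [f.symm_apply_apply, mul_smul] }
  let aΛ : MulAction Λ (range (embeddingReal W)) :=
    { smul := fun g w => f (g • f.symm w)
      one_smul := fun w => by
        change f ((1 : Λ) • f.symm w) = w
        rw [one_smul, f.apply_symm_apply]
      mul_smul := fun g h w => by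
        change f ((g * h) • f.symm w) = f (g • f.symm (f (h • f.symm w)))
        rw [f.symm_apply_apply, mul_smul] }
  have hfin : ∀ {S : Set W}, MeasurableSet S → m S < ∞ → m.map f (f.symm ⁻¹' S) < ∞ := by
    intro S hS hSf
    rwa [hf'.measure_preimage hS.nullMeasurableSet]
  refine ⟨range (embeddingReal W), inferInstance, hstd, m.map f, aΓ, aΛ,
    f.sigmaFinite_map, ?_, ⟨fun g h w => ?_⟩, fun g => (hf.comp (hΓ g)).comp hf',
    fun h => (hf.comp (hΛ h)).comp hf', fun g hg => ?_, fun h hh => ?_,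
    ⟨f.symm ⁻¹' D, f.symm.measurable hDm, ?_, hfin hDm hDf⟩,
    ⟨f.symm ⁻¹' D', f.symm.measurable hDm', ?_, hfin hDm' hDf'⟩⟩
  · rw [Ne, Measure.map_eq_zero_iff f.measurable.aemeasurable]
    exact hm
  · change f (g • f.symm (f (h • f.symm w))) = f (h • f.symm (f (g • f.symm w)))
    rw [f.symm_apply_apply, f.symm_apply_apply, smul_comm]
  · filter_upwards [hf'.quasiMeasurePreserving.ae (hΓfree g hg)] with w hw hcon
    refine hw ?_
    have : f.symm (f (g • f.symm w)) = f.symm w := congrArg f.symm hcon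
    rwa [f.symm_apply_apply] at this
  · filter_upwards [hf'.quasiMeasurePreserving.ae (hΛfree h hh)] with w hw hcon
    refine hw ?_
    have : f.symm (f (h • f.symm w)) = f.symm w := congrArg f.symm hcon
    rwa [f.symm_apply_apply] at this
  · exact hD.preimage_of_equiv hf'.quasiMeasurePreserving (e := id) Function.bijective_id
      fun g w => f.symm_apply_apply _
  · exact hD'.preimage_of_equiv hf'.quasiMeasurePreserving (e := id) Function.bijective_id
      fun g w => f.symm_apply_apply _

/-! ### Gluing the two invariant sets -/

section Gluing

variable {X : Type*} [MeasurableSpace X] [StandardBorelSpace X] {μ : Measure X}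
  [IsFiniteMeasure μ] {r : Setoid X}

/-- The projection to the second variable of an invariant subset of `r ∩ (Y × Z)` is, up to null
sets, an invariant Borel subset of `Z`. -/
theorem IsRelAction.exists_invariant_projection (hr : IsCountablePMP μ r) {H : Type*} [Group H]
    {b : H →* Equiv.Perm X} (hb : IsRelAction μ r b) {Y Z : Set X} (hY : MeasurableSet Y)
    (hZ : MeasurableSet Z) (hbZ : ∀ h x, b h x ∈ Z ↔ x ∈ Z) {E : Set (X × X)}
    (hE : MeasurableSet E) (hEinv : ∀ h, Prod.map id (b h) ⁻¹' E = E)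
    (hE0 : (relMeasure μ r).restrict (Y ×ˢ Z) E ≠ 0) :
    ∃ Z₀ ⊆ Z, MeasurableSet Z₀ ∧ μ Z₀ ≠ 0 ∧ (∀ h, ∀ᵐ x ∂μ, b h x ∈ Z₀ ↔ x ∈ Z₀) ∧
      (∀ᵐ z ∂μ, z ∈ Z₀ ↔ z ∈ Z ∧ ∃ y ∈ Y, r y z ∧ (y, z) ∈ E) := by
  let _ := upgradeStandardBorel X
  let S : Set X := {z | z ∈ Z ∧ ∃ y ∈ Y, r y z ∧ (y, z) ∈ E}
  have hS : NullMeasurableSet S μ := by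
    have himg : S = Prod.snd '' ({p : X × X | r p.1 p.2} ∩ Y ×ˢ Z ∩ E) := by
      ext z
      constructor
      · rintro ⟨hz, y, hy, hyz, hyE⟩
        exact ⟨(y, z), ⟨⟨hyz, hy, hz⟩, hyE⟩, rfl⟩
      · rintro ⟨⟨y, w⟩, ⟨⟨hyz, hy, hz⟩, hyE⟩, rfl⟩
        exact ⟨hz, y, hy, hyz, hyE⟩
    rw [himg]
    exact analyticSet_nullMeasurableSet μ
      (((hr.measurableSet_graph.inter (hY.prod hZ)).inter hE).analyticSet_image measurable_snd)
  obtain ⟨Z₀, hZ₀S, hZ₀, hZ₀e⟩ := hS.exists_measurable_subset_ae_eq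
  have hae : ∀ᵐ z ∂μ, z ∈ Z₀ ↔ z ∈ S := hZ₀e.mem_iff
  refine ⟨Z₀, fun z hz => (hZ₀S hz).1, hZ₀, fun h0 => hE0 ?_, fun h => ?_, hae⟩
  · rw [Measure.restrict_apply hE, measure_eq_zero_iff_ae_notMem, ae_relMeasure_iff hr]
    filter_upwards [ae_forall_rel hr hae, ae_forall_rel hr (measure_eq_zero_iff_ae_notMem.1 h0)]
      with y h1 h2 z hyz hz
    exact h2 z hyz ((h1 z hyz).2 ⟨hz.2.2, y, hz.2.1, hyz, hz.1⟩)
  · filter_upwards [hae, (hb.measurePreserving h).quasiMeasurePreserving.ae hae, hb.rel h]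
      with z h1 h2 h3
    rw [h1, h2]
    refine and_congr (hbZ h z) (exists_congr fun y => and_congr_right fun _ =>
      and_congr ⟨fun h4 => r.trans h4 (r.symm h3), fun h4 => r.trans h4 h3⟩ ?_)
    exact Set.ext_iff.1 (hEinv h) (y, z)

/-- If `E` meets almost every fibre over `Z₀` and the action of `Γ₁ × Γ₂` is transitive on the
classes of `r|_Y`, then `E` meets a translate, by an element of `Γ₂`, of the flip of every non-null
`Γ₁`-invariant subset of `r ∩ (Z₀ × Y)`. -/
theorem exists_relMeasure_inter_translate_ne_zero (hr : IsCountablePMP μ r) {Γ₁ Γ₂ : Type*}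
    [Group Γ₁] [Group Γ₂] [Countable Γ₂] {a : Γ₁ × Γ₂ →* Equiv.Perm X} (ha : IsRelAction μ r a)
    {Y Z₀ : Set X} (horb : ∀ᵐ x ∂μ, x ∈ Y → ∀ x' ∈ Y, r x x' → ∃ g, a g x = x')
    {E E' : Set (X × X)} (hE : MeasurableSet E) (hE' : MeasurableSet E')
    (hE'inv : ∀ g : Γ₁, Prod.map id (a (g, 1)) ⁻¹' E' = E')
    (hfib : ∀ᵐ z ∂μ, z ∈ Z₀ → ∃ y ∈ Y, r y z ∧ (y, z) ∈ E)
    (hE'0 : (relMeasure μ r).restrict (Z₀ ×ˢ Y) E' ≠ 0) :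
    ∃ g : Γ₂, (relMeasure μ r).restrict (Y ×ˢ Z₀)
      (E ∩ Prod.map (a (1, g)) id ⁻¹' (Prod.swap ⁻¹' E')) ≠ 0 := by
  by_contra! hcon
  refine hE'0 ?_
  have h1 : ∀ᵐ q ∂relMeasure μ r, ∀ g : Γ₂,
      q ∉ E ∩ Prod.map (a (1, g)) id ⁻¹' (Prod.swap ⁻¹' E') ∩ Y ×ˢ Z₀ := by
    refine ae_all_iff.2 fun g => measure_eq_zero_iff_ae_notMem.1 ?_
    rw [← Measure.restrict_apply (hE.inter (((ha.measurePreserving (1, g)).measurable.prodMap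
      measurable_id) (measurable_swap hE')))]
    exact hcon g
  have h2 := (ae_relMeasure_iff hr).1 (ae_swap_relMeasure hr h1)
  rw [Measure.restrict_apply hE', measure_eq_zero_iff_ae_notMem, ae_relMeasure_iff hr]
  filter_upwards [h2, hfib, ae_forall_rel hr horb] with z h2 h3 h4 y' hzy' hmem
  obtain ⟨y, hy, hyz, hyE⟩ := h3 hmem.2.1
  obtain ⟨g, hg⟩ := h4 y (r.symm hyz) hy y' hmem.2.2 (r.trans hyz hzy')
  refine h2 y (r.symm hyz) g.2 ⟨⟨hyE, ?_⟩, hy, hmem.2.1⟩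
  have h5 : y' = a (g.1, 1) (a (1, g.2) y) := by
    rw [← Equiv.Perm.mul_apply, ← map_mul, Prod.mk_mul_mk, mul_one, one_mul, hg]
  have h6 := hmem.1
  rw [h5] at h6
  exact (Set.ext_iff.1 (hE'inv g.1) (z, a (1, g.2) y)).1 h6

end Gluing

/-- A fundamental domain for an action on the second variable, pulled back along an equivariant map
that exchanges the two variables. -/
theorem isFundamentalDomain_fstAction_preimage {X : Type*} [MeasurableSpace X] {G : Type*}
    [Group G] {a : G →* Equiv.Perm X} {D : Set (X × X)} {κ κ' : Measure (X × X)}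
    (hD : letI := sndAction a; IsFundamentalDomain G D κ') {f : X × X → X × X}
    (hf : MeasurePreserving f κ κ') (hfa : ∀ g p, f (a g p.1, p.2) = ((f p).1, a g (f p).2)) :
    letI := fstAction a; IsFundamentalDomain G (f ⁻¹' D) κ :=
  @IsFundamentalDomain.preimage_of_equiv G G (X × X) (X × X) _ _ (sndAction a) _ (fstAction a) _
    D κ' κ hD f hf.quasiMeasurePreserving id Function.bijective_id hfa

theorem proposition3p1 {X : Type*} [MeasurableSpace X] [StandardBorelSpace X]
    (μ : Measure X) [IsProbabilityMeasure μ] (r : Setoid X) (hr : IsCountablePMP μ r)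
    {Γ₁ Γ₂ Λ : Type*} [Group Γ₁] [Group Γ₂] [Group Λ] [Countable Γ₁] [Countable Γ₂] [Countable Λ]
    (Y Z : Set X) (hY : MeasurableSet Y) (hZ : MeasurableSet Z) (hYpos : 0 < μ Y) (hZpos : 0 < μ Z)
    (α : Γ₁ × Γ₂ →* Equiv.Perm Y) (β : Λ →* Equiv.Perm Z)
    (hα : IsFreeMPAction (μ.comap Subtype.val) α)
    (hβ : IsFreeMPAction (μ.comap Subtype.val) β)
    (hαr : ∀ᵐ y : Y ∂(μ.comap Subtype.val), ∀ y' : Y, r (y : X) (y' : X) ↔ ∃ g, α g y = y')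
    (hβr : ∀ᵐ z : Z ∂(μ.comap Subtype.val), ∀ h : Λ, r (z : X) (β h z : X))
    (hYZ : Intertwines (diagVec μ r) (relVonNeumann μ r)
      (supportProj μ r Y hY) (crossedProduct μ r Y hY (α.comp (MonoidHom.inl Γ₁ Γ₂)))
      (supportProj μ r Z hZ) (crossedProduct μ r Z hZ β))
    (hZY : StronglyIntertwines (diagVec μ r) (relVonNeumann μ r)
      (supportProj μ r Z hZ) (crossedProduct μ r Z hZ β)
      (supportProj μ r Y hY) (crossedProduct μ r Y hY (α.comp (MonoidHom.inl Γ₁ Γ₂)))) :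
    MeasureEquivalent Γ₁ Λ := by
  set a : Γ₁ × Γ₂ →* Equiv.Perm X := extendAction α with ha_def
  set b : Λ →* Equiv.Perm X := extendAction β with hb_def
  have ha : IsRelAction μ r a := hα.isRelAction_extendAction hY fun g => by
    filter_upwards [hαr] with y hy using (hy _).2 ⟨g, rfl⟩
  have hb : IsRelAction μ r b := hβ.isRelAction_extendAction hZ fun h => by
    filter_upwards [hβr] with z hz using hz h
  have haY : ∀ g x, a g x ∈ Y ↔ x ∈ Y := fun g x => extendById_mem_iff (α g) x
  have hbZ : ∀ h x, b h x ∈ Z ↔ x ∈ Z := fun h x => extendById_mem_iff (β h) x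
  have horb : ∀ᵐ x ∂μ, x ∈ Y → ∀ x' ∈ Y, r x x' → ∃ g, a g x = x' := by
    filter_upwards [ae_of_ae_comap_subtype hY hαr] with x hx hxY x' hx'Y hxx'
    obtain ⟨g, hg⟩ := (hx hxY ⟨x', hx'Y⟩).1 hxx'
    refine ⟨g, ?_⟩
    rw [ha_def, coe_extendAction, extendById_of_mem _ hxY, hg]
  set a₁ : Γ₁ →* Equiv.Perm X := a.comp (MonoidHom.inl Γ₁ Γ₂) with ha₁_def
  have ha₁ : IsRelAction μ r a₁ := ⟨fun g => ha.measurePreserving _, fun g => ha.rel _⟩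
  have ha₁α : ∀ g, ⇑(a₁ g) = extendById ((α.comp (MonoidHom.inl Γ₁ Γ₂)) g) := fun g => rfl
  have hbβ : ∀ h, ⇑(b h) = extendById (β h) := fun h => rfl
  have ha₁Y : ∀ g, ∀ᵐ x ∂μ, a₁ g x ∈ Y ↔ x ∈ Y := fun g => Eventually.of_forall (haY _)
  have hbZ' : ∀ h, ∀ᵐ x ∂μ, b h x ∈ Z ↔ x ∈ Z := fun h => Eventually.of_forall (hbZ h)
  have ha₁free : ∀ g, g ≠ 1 → ∀ᵐ x ∂μ, x ∈ Y → a₁ g x ≠ x := fun g hg =>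
    hα.ae_extendAction_ne hY fun h => hg (congrArg Prod.fst h)
  have hbfree : ∀ h, h ≠ 1 → ∀ᵐ x ∂μ, x ∈ Z → b h x ≠ x := fun h hh => hβ.ae_extendAction_ne hZ hh
  -- The covering graphs come from the action of `Γ₁ × Γ₂`, the only one transitive on the classes.
  obtain ⟨e, he⟩ := exists_isRelCover hr ha hY hZ (fun g x => (haY g x).2) horb
  obtain ⟨E, D, hE, hD, hEa, hEb, hDf, hE0, hEfin⟩ :=
    exists_invariant_of_intertwines hr ha₁ hb hY hZ ha₁Y hbZ' hbfree he
      (leftOp_mem_crossedProduct hr ha₁ hY ha₁Y ha₁α)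
      (fun c hc => indicatorOp_orbit_crossedProduct hr hb hZ hbβ hc) hYZ
  obtain ⟨Z₀, hZ₀Z, hZ₀, hZ₀0, hbZ₀, hfib⟩ := hb.exists_invariant_projection hr hY hZ hbZ hE hEb hE0
  -- The projection `1_{Z₀}` commutes with the crossed product by `Λ`: the strong intertwining
  -- applies to it, and the second invariant set lives over `Z₀`, where the first one has
  -- nonempty fibres.
  obtain ⟨e', he'⟩ : ∃ e', IsRelCover μ r Z₀ Y e' := by
    have := (he.symm hr).restr hZ₀
    rw [inter_eq_self_of_subset_right hZ₀Z] at this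
    exact ⟨_, this⟩
  have hPP : supportProj μ r Z hZ * supportProj μ r Z₀ hZ₀ = supportProj μ r Z₀ hZ₀ :=
    supportProj_mul_of_subset hZ₀ hZ hZ₀Z
  have hPP' : supportProj μ r Z₀ hZ₀ * supportProj μ r Z hZ = supportProj μ r Z₀ hZ₀ := by
    have := congrArg star hPP
    rwa [star_mul, star_supportProj, star_supportProj] at this
  have hint : Intertwines (diagVec μ r) (relVonNeumann μ r) (supportProj μ r Z₀ hZ₀)
      ((fun c => c * supportProj μ r Z₀ hZ₀) '' crossedProduct μ r Z hZ β)
      (supportProj μ r Y hY) (crossedProduct μ r Y hY (α.comp (MonoidHom.inl Γ₁ Γ₂))) :=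
    hZY _ (supportProj_mem hZ₀) ⟨supportProj_mul_self hZ₀, star_supportProj hZ₀⟩
      (supportProj_ne_zero hr hZ₀ hZ₀0) (by rw [hPP, hPP'])
      fun c hc => crossedProduct_comm_supportProj hr hb hZ₀ hZ hbZ₀ hbβ hc
  obtain ⟨E', D', hE', hD', hEb', hEa', hDf', hE0', hEfin'⟩ :=
    exists_invariant_of_intertwines hr hb ha₁ hZ₀ hY hbZ₀ ha₁Y ha₁free he'
      (P := (fun c => c * supportProj μ r Z₀ hZ₀) '' crossedProduct μ r Z hZ β)
      (fun h => ⟨_, leftOp_mem_crossedProduct hr hb hZ hbZ' hbβ h,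
        leftOp_mul_supportProj_of_subset hr hb hZ₀ hZ hZ₀Z hbZ₀ hbZ' h⟩)
      (fun c hc => indicatorOp_orbit_crossedProduct hr ha₁ hY ha₁α hc) hint
  obtain ⟨g₂, hg₂⟩ := exists_relMeasure_inter_translate_ne_zero hr ha horb hE hE' hEa'
    (hfib.mono fun z hz hzZ => (hz.1 hzZ).2) hE0'
  -- The coupling is the set `C` with the counting measure `κ`. It is the intersection of `E` with
  -- the preimage of `E'` under `f`, the flip composed with the translation by `g₂`, which
  -- commutes with `Γ₁`.
  set κ := (relMeasure μ r).restrict (Y ×ˢ Z₀) with hκ_def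
  have hcomm : ∀ g x, a (1, g₂) (a₁ g x) = a₁ g (a (1, g₂) x) := by
    intro g x
    change a (1, g₂) (a (g, 1) x) = a (g, 1) (a (1, g₂) x)
    rw [← Equiv.Perm.mul_apply, ← Equiv.Perm.mul_apply, ← map_mul, ← map_mul, Prod.mk_mul_mk,
      Prod.mk_mul_mk, one_mul, mul_one, one_mul, mul_one]
  let f : X × X → X × X := fun p => (p.2, a (1, g₂) p.1)
  have hf : MeasurePreserving f κ ((relMeasure μ r).restrict (Z₀ ×ˢ Y)) :=
    (he'.measurePreserving_swap hr hZ₀ hY).comp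
      (ha.measurePreserving_left_prod hr hY hZ₀ (fun g => Eventually.of_forall (haY g)) (1, g₂))
  set C : Set (X × X) := E ∩ f ⁻¹' E' with hC_def
  have hC : MeasurableSet C := hE.inter (hf.measurable hE')
  have hCa : ∀ g, Prod.map (a₁ g) id ⁻¹' C = C := by
    intro g
    rw [hC_def, preimage_inter, hEa, ← preimage_comp]
    have : f ∘ Prod.map (a₁ g) id = Prod.map id (a₁ g) ∘ f :=
      funext fun p => Prod.ext rfl (hcomm g p.1)
    rw [this, preimage_comp, hEa']
  have hCb : ∀ h, Prod.map id (b h) ⁻¹' C = C := by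
    intro h
    rw [hC_def, preimage_inter, hEb, ← preimage_comp]
    have : f ∘ Prod.map id (b h) = Prod.map (b h) id ∘ f := rfl
    rw [this, preimage_comp, hEb']
  let _ : MulAction Γ₁ (X × X) := fstAction a₁
  let _ : MulAction Λ (X × X) := sndAction b
  have hσ : SigmaFinite κ := (he'.symm hr).sigmaFinite hr hY hZ₀
  have hκle : κ ≤ (relMeasure μ r).restrict (Y ×ˢ Z) :=
    Measure.restrict_mono (prod_mono_right hZ₀Z) le_rfl
  have hac : κ.restrict C ≪ κ := Measure.restrict_le_self.absolutelyContinuous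
  have hYae : ∀ᵐ p ∂κ.restrict C, p ∈ Y ×ˢ Z₀ := hac (ae_restrict_mem (hY.prod hZ₀))
  have : SMulCommClass Γ₁ Λ (X × X) := ⟨fun _ _ _ => rfl⟩
  refine measureEquivalent_of_coupling (κ.restrict C) (D := f ⁻¹' D') (D' := D) ?_
    (fun g => ?_) (fun h => ?_) (fun g hg => ?_) (fun h hh => ?_) (hf.measurable hD')
    ((isFundamentalDomain_fstAction_preimage hDf' hf fun g p =>
      Prod.ext rfl (hcomm g p.1)).mono hac) ?_ hD
    (hDf.mono (hac.trans hκle.absolutelyContinuous)) ?_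
  · rw [Ne, Measure.restrict_eq_zero]
    exact hg₂
  · have := (ha₁.measurePreserving_left_prod hr hY hZ₀ ha₁Y g).restrict_preimage hC
    rwa [hCa] at this
  · have := (hb.measurePreserving_right_prod hr hY hZ₀ hbZ₀ h).restrict_preimage hC
    rwa [hCb] at this
  · have h1 : ∀ᵐ p ∂relMeasure μ r, p.1 ∈ Y → a₁ g p.1 ≠ p.1 := by
      rw [ae_relMeasure_iff hr]
      filter_upwards [ha₁free g hg] with x hx z _ using hx
    filter_upwards [hac (ae_restrict_of_ae h1), hYae] with p h2 h3 h4
    exact h2 h3.1 (congrArg Prod.fst h4)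
  · have h1 : ∀ᵐ p ∂relMeasure μ r, p.2 ∈ Z → b h p.2 ≠ p.2 := by
      rw [ae_relMeasure_iff hr]
      filter_upwards [ae_forall_rel hr (hbfree h hh)] with x hx z hz using hx z hz
    filter_upwards [hac (ae_restrict_of_ae h1), hYae] with p h2 h3 h4
    exact h2 (hZ₀Z h3.2) (congrArg Prod.snd h4)
  · rw [Measure.restrict_apply (hf.measurable hD')]
    have h1 := hf.measure_preimage (hE'.inter hD').nullMeasurableSet
    refine lt_of_le_of_lt (measure_mono ?_) (h1.trans_lt (lt_top_iff_ne_top.2 hEfin'))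
    rintro p ⟨hpD, -, hpE⟩
    exact ⟨hpE, hpD⟩
  · rw [Measure.restrict_apply hD]
    refine lt_of_le_of_lt ?_ (lt_top_iff_ne_top.2 hEfin)
    refine (hκle _).trans (measure_mono ?_)
    rintro p ⟨hpD, hpE, -⟩
    exact ⟨hpE, hpD⟩

end
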